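/- Let $\mathfrak H$, $\mathfrak H_*$ be complex separable Hilbert spaces, $X_0:\mathfrak H\to\mathfrak H_*$ a densely defined closed operator, $X_1:\mathfrak H\to\mathfrak H_*$ a bounded operator, $X(t)=X_0+tX_1$ on $\operatorname{Dom}X_0$ and $A(t)=X(t)^*X(t)$, $t\in\mathbb R$. Put $\mathfrak N=\operatorname{Ker}X_0$, $\mathfrak N_*=\operatorname{Ker}X_0^*$, and let $P$ be the orthogonal projection of $\mathfrak H$ onto $\mathfrak N$, $P^\perp=I-P$. Assume that $0$ is an isolated point of the spectrum of $A(0)$, that $0<n=\dim\mathfrak N<\infty$ and $n\le\dim\mathfrak N_*$, and that for some $c_*>0$, $t_0>0$ we have $A(t)\ge c_*t^2I$ for $|t|\le t_0$ (in the sense of the quadratic forms). Let $Zu=\phi(Pu)$, where for $\omega\in\mathfrak N$ the element $\phi=\phi(\omega)\in\operatorname{Dom}X_0\cap\mathfrak N^\perp$ is the weak solution of $X_0^*(X_0\phi+X_1\omega)=0$; let $R=(X_0Z+X_1)|_{\mathfrak N}:\mathfrak N\to\mathfrak N_*$ and $S=R^*R:\mathfrak N\to\mathfrak N$. Let $Z_2u=\psi(Pu)$,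 where $\psi=\psi(\omega)\in\operatorname{Dom}X_0\cap\mathfrak N^\perp$ is the weak solution of $X_0^*(X_0\psi+X_1Z\omega)=-P^\perp X_1^*R\omega$, and let $R_2=(X_0Z_2+X_1Z)|_{\mathfrak N}$. Put $$N=Z^*X_1^*RP+(RP)^*X_1Z,\qquad N_1^0=Z_2^*X_1^*RP+(RP)^*X_1Z_2+R_2^*R_2P .$$ Let $\gamma_1^\circ,\dots,\gamma_p^\circ$ be the different eigenvalues of $S$ and let $P_j$ be the orthogonal projection of $\mathfrak H$ onto $\mathfrak N_j=\operatorname{Ker}(S-\gamma_j^\circ I_{\mathfrak N})$. Put $N_0=\sum_{j=1}^pP_jNP_j$ and, in $\mathfrak N_q$, $$\mathcal N^{(q)}=P_q\Bigl(N_1^0-\tfrac12Z^*ZSP-\tfrac12SPZ^*Z\Bigr)\Big|_{\mathfrak N_q}+\sum_{j\ne q}(\gamma_q^\circ-\gamma_j^\circ)^{-1}P_qNP_jN\big|_{\mathfrak N_q}.$$ Finally, for $t\neq0$ let $$\mathcal J_1(t,\tau)=\cos(\tau A(t)^{1/2})P-\cos(\tau(t^2S)^{1/2})P,$$ $$\mathcal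 J_2(t,\tau)=A(t)^{-1/2}\sin(\tau A(t)^{1/2})P-(t^2S)^{-1/2}\sin(\tau(t^2S)^{1/2})P,$$ $$\Sigma(t,\tau)=\bigl(A(t)^{-1/2}\sin(\tau A(t)^{1/2})-(I+tZ)(t^2S)^{-1/2}\sin(\tau(t^2S)^{1/2})\bigr)P,$$ where $\lambda^{-1/2}\sin(\tau\lambda^{1/2})$ is taken to be $\tau$ at $\lambda=0$, and consider the estimates $$\text{(a)}\quad\|\mathcal J_1(t,\varepsilon^{-1}\tau)\|\,\varepsilon^s(t^2+\varepsilon^2)^{-s/2}\le C(\tau)\,\varepsilon,$$ $$\text{(b)}\quad\|\mathcal J_2(t,\varepsilon^{-1}\tau)\|\,\varepsilon^r(t^2+\varepsilon^2)^{-r/2}\le C(\tau),$$ $$\text{(c)}\quad\|A(t)^{1/2}\Sigma(t,\varepsilon^{-1}\tau)\|\,\varepsilon^s(t^2+\varepsilon^2)^{-s/2}\le C(\tau)\,\varepsilon.$$ **Theorem.** Suppose that $N_0=0$ and $\mathcal N^{(q)}\ne0$ for some $q\in\{1,\dots,p\}$. 1. Let $\tau\neq0$. If $s<3/2$, there is no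 constant $C(\tau)>0$ such that (a) holds for all sufficiently small $|t|>0$ and $\varepsilon>0$, and no constant $C(\tau)>0$ such that (c) holds for all sufficiently small $|t|>0$ and $\varepsilon>0$. If $r<1/2$, there is no constant $C(\tau)>0$ such that (b) holds for all sufficiently small $|t|>0$ and $\varepsilon>0$. 2. If $s\ge3/2$, there is no positive function $C(\tau)$ on $\mathbb R$ with $\lim_{\tau\to+\infty}C(\tau)/|\tau|^{1/2}=0$ for which there is an $\eta>0$ such that (a) holds for all $\tau\in\mathbb R$, $0<|t|<\eta$, $0<\varepsilon<\eta$; the same is true of (c). If $r\ge1/2$, the same is true of (b). -/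

import Mathlib

open scoped InnerProductSpace LinearPMap
open Filter Topology

noncomputable section

namespace AbstractScheme

section Unbounded

variable {E F G : Type*}
  [NormedAddCommGroup E] [InnerProductSpace ℂ E]
  [NormedAddCommGroup F] [InnerProductSpace ℂ F]
  [NormedAddCommGroup G] [InnerProductSpace ℂ G]

/-- The kernel `{u ∈ Dom f : f u = 0}` of a partially defined operator. -/
def pker (f : E →ₗ.[ℂ] F) : Submodule ℂ E :=
  (LinearMap.ker f.toFun).map f.domain.subtype

theorem mem_pker {f : E →ₗ.[ℂ] F} {u : E} : u ∈ pker f ↔ (u, (0 : F)) ∈ f.graph := by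
  simp only [pker, Submodule.mem_map, LinearMap.mem_ker, LinearPMap.mem_graph_iff]
  constructor
  · rintro ⟨y, hy, rfl⟩; exact ⟨y, rfl, hy⟩
  · rintro ⟨y, hy, h⟩; exact ⟨y, h, hy⟩

theorem isClosed_pker {f : E →ₗ.[ℂ] F} (hf : f.IsClosed) : IsClosed (pker f : Set E) := by
  have h : (pker f : Set E) = (fun u : E => (u, (0 : F))) ⁻¹' (f.graph : Set (E × F)) := by
    ext u; exact mem_pker
  rw [h]
  exact IsClosed.preimage (by fun_prop) hf

/-- The composition `g ∘ f` on its natural domain `{u ∈ Dom f : f u ∈ Dom g}`. -/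
def pcomp (g : F →ₗ.[ℂ] G) (f : E →ₗ.[ℂ] F) : E →ₗ.[ℂ] G :=
  g.comp (f.domRestrict ((g.domain.comap f.toFun).map f.domain.subtype)) (by
    rintro ⟨u, hu, hu'⟩
    obtain ⟨y, hy, rfl⟩ := hu
    exact hy)

theorem mem_graph_pcomp {g : F →ₗ.[ℂ] G} {f : E →ₗ.[ℂ] F} {u : E} {w : G} :
    (u, w) ∈ (pcomp g f).graph ↔ ∃ v, (u, v) ∈ f.graph ∧ (v, w) ∈ g.graph := by
  simp only [LinearPMap.mem_graph_iff]
  constructor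
  · rintro ⟨⟨u', hu, hu'⟩, h1, h2⟩
    obtain ⟨y, hy, rfl⟩ := hu
    simp only at h1
    subst h1
    exact ⟨f y, ⟨y, rfl, rfl⟩, ⟨f y, hy⟩, rfl, h2⟩
  · rintro ⟨v, ⟨y, rfl, rfl⟩, ⟨z, hz, rfl⟩⟩
    have hy : f y ∈ g.domain := hz ▸ z.2
    refine ⟨⟨(y : E), ⟨y, hy, rfl⟩, y.2⟩, rfl, ?_⟩
    change g ⟨f y, _⟩ = g z
    congr 1
    exact Subtype.ext hz.symm

/-- The bounded operator `g L` for `g` unbounded and `L` bounded: it is meant for the case where `L`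
maps into `Dom g` and `g L` is bounded, and then it is this operator (in the other cases, which do
not occur below, it is `0` by convention). -/
def bcomp (g : F →ₗ.[ℂ] G) (L : E →L[ℂ] F) : E →L[ℂ] G := by
  classical
  exact if h : ∃ M : E →L[ℂ] G, ∀ u, (L u, M u) ∈ g.graph then h.choose else 0

theorem bcomp_eq {g : F →ₗ.[ℂ] G} {L : E →L[ℂ] F} {M : E →L[ℂ] G}
    (hM : ∀ u, (L u, M u) ∈ g.graph) : bcomp g L = M := by
  have h : ∃ M : E →L[ℂ] G, ∀ u, (L u, M u) ∈ g.graph := ⟨M, hM⟩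
  rw [bcomp, dif_pos h]
  ext u
  exact LinearPMap.mem_graph_snd_inj g (h.choose_spec u) (hM u) rfl

/-- `T` is the bounded two-sided inverse of `A - z`. -/
def IsResolventAt (A : E →ₗ.[ℂ] E) (z : ℂ) (T : E →L[ℂ] E) : Prop :=
  (∀ u, ∃ h : T u ∈ A.domain, A ⟨T u, h⟩ - z • T u = u) ∧
    ∀ u : A.domain, T (A u - z • (u : E)) = u

/-- The spectrum of an unbounded operator. -/
def pspectrum (A : E →ₗ.[ℂ] E) : Set ℂ := {z | ¬ ∃ T : E →L[ℂ] E, IsResolventAt A z T}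

/-- The resolvent `(A - z)⁻¹` at a point `z` of the resolvent set (`0` on the spectrum). -/
def presolvent (A : E →ₗ.[ℂ] E) (z : ℂ) : E →L[ℂ] E := by
  classical
  exact if h : ∃ T : E →L[ℂ] E, IsResolventAt A z T then h.choose else 0

theorem presolvent_eq {A : E →ₗ.[ℂ] E} {z : ℂ} {T : E →L[ℂ] E} (hT : IsResolventAt A z T) :
    presolvent A z = T := by
  have h : ∃ T : E →L[ℂ] E, IsResolventAt A z T := ⟨T, hT⟩
  rw [presolvent, dif_pos h]
  ext u
  obtain ⟨hu, hu'⟩ := h.choose_spec.1 u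
  have := hT.2 ⟨_, hu⟩
  rw [hu'] at this
  exact this.symm

variable [CompleteSpace E]

/-- `-1` is in the resolvent set of `X* X`, for `X` densely defined and closed. -/
theorem exists_isResolventAt [CompleteSpace F]
  (X : E →ₗ.[ℂ] F) (hd : Dense (X.domain : Set E)) (hc : X.IsClosed) :
  ∃ T : E →L[ℂ] E, IsResolventAt (pcomp X† X) (-1) T := by
  let e := WithLp.prodContinuousLinearEquiv 2 ℂ E F
  let G : Submodule ℂ (WithLp 2 (E × F)) := X.graph.comap (e : WithLp 2 (E × F) →ₗ[ℂ] E × F)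
  have hG : IsClosed (G : Set (WithLp 2 (E × F))) := IsClosed.preimage e.continuous hc
  have : CompleteSpace G := hG.completeSpace_coe
  let J : G →L[ℂ] E :=
    (ContinuousLinearMap.fst ℂ E F) ∘L (e : WithLp 2 (E × F) →L[ℂ] E × F) ∘L G.subtypeL
  have key : ∀ (u : E) (g : G), J.adjoint u = g ↔ ((e g).2, u - (e g).1) ∈ X†.graph := by
    intro u g
    have h1 : J.adjoint u = g ↔ ∀ w : X.domain, ⟪(e g).1, (w:E)⟫_ℂ + ⟪(e g).2, X w⟫_ℂ = ⟪u, (w:E)⟫_ℂ := by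
      constructor
      · intro h w
        have hw : e.symm ((w:E), X w) ∈ G := by
          change e (e.symm _) ∈ X.graph
          simp
        have := ContinuousLinearMap.adjoint_inner_left J ⟨_, hw⟩ u
        rw [h] at this
        simpa [J, e, WithLp.prod_inner_apply] using this
      · intro h
        refine ext_inner_right ℂ fun w => ?_
        rw [ContinuousLinearMap.adjoint_inner_left]
        have hw := w.2
        change e (w : WithLp 2 (E × F)) ∈ X.graph at hw
        obtain ⟨y, hy1, hy2⟩ := (LinearPMap.mem_graph_iff _).1 hw
        have := h y
        rw [hy1, hy2] at this
        rw [Submodule.coe_inner, WithLp.prod_inner_apply]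
        exact this.symm
    rw [h1]
    constructor
    · intro h
      have h2 : ∀ x : X.domain, ⟪u - (e g).1, (x:E)⟫_ℂ = ⟪(e g).2, X x⟫_ℂ := fun x => by
        rw [inner_sub_left, ← h x]; ring
      have hm := LinearPMap.mem_adjoint_domain_of_exists _ ⟨_, h2⟩
      exact (LinearPMap.mem_graph_iff _).2 ⟨⟨_, hm⟩, rfl, LinearPMap.adjoint_apply_eq hd ⟨_, hm⟩ h2⟩
    · intro h w
      obtain ⟨y, hy1, hy2⟩ := (LinearPMap.mem_graph_iff _).1 h
      have := LinearPMap.adjoint_isFormalAdjoint (T := X) hd y w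
      rw [hy1, hy2, inner_sub_left] at this
      rw [← this]; ring
  refine ⟨J ∘L J.adjoint, ?_, ?_⟩
  · intro u
    have h := (key u _).1 rfl
    have hg := (J.adjoint u).2
    change e _ ∈ X.graph at hg
    have : (J (J.adjoint u), u - J (J.adjoint u)) ∈ (pcomp X† X).graph :=
      mem_graph_pcomp.2 ⟨_, hg, h⟩
    have hm := LinearPMap.mem_domain_of_mem_graph this
    refine ⟨hm, ?_⟩
    have h3 := (LinearPMap.image_iff hm).2 this
    change pcomp X† X ⟨J (J.adjoint u), hm⟩ - (-1 : ℂ) • J (J.adjoint u) = u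
    rw [← h3]; simp
  · intro u
    obtain ⟨v, h1, h2⟩ := mem_graph_pcomp.1 (LinearPMap.mem_graph (pcomp X† X) u)
    have hm : e.symm ((u:E), v) ∈ G := by
      change e (e.symm _) ∈ X.graph
      simpa using h1
    have := (key (pcomp X† X u - (-1:ℂ) • (u:E)) ⟨_, hm⟩).2 (by simpa using h2)
    rw [ContinuousLinearMap.comp_apply, this]
    simp [J, e]

/-- `φ(A)` for a nonnegative self-adjoint operator `A` and a real continuous function `φ` on `[0, ∞)`
that vanishes near infinity: with `T = (A + 1)⁻¹`, a bounded operator with spectrum in `[0, 1]`, one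
has `A = T⁻¹ - 1`, so `φ(A) = g(T)` for the continuous function `g x = φ (1 / x - 1)`, `g 0 = 0`. -/
def compactCalc (A : E →ₗ.[ℂ] E) (φ : ℝ → ℝ) : E →L[ℂ] E :=
  cfc (fun x : ℝ => if 0 < x then φ (x⁻¹ - 1) else 0) (presolvent A (-1))

/-- The continuous cut-off equal to `1` on `(-∞, n]` and to `0` on `[n + 1, ∞)`. -/
def cutoff (n : ℕ) (x : ℝ) : ℝ := max 0 (min 1 (n + 1 - x))

/-- The graph of `f(A)`: the pairs `(u, lim (f χₙ)(A) u)`, with the cut-offs `χₙ`. -/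
def calcGraph (A : E →ₗ.[ℂ] E) (f : ℝ → ℝ) : Submodule ℂ (E × E) where
  carrier := {p | Tendsto (fun n : ℕ => compactCalc A (fun x => cutoff n x * f x) p.1) atTop (𝓝 p.2)}
  zero_mem' := by simp
  add_mem' := by
    intro a b ha hb
    change Tendsto _ _ _ at ha hb
    change Tendsto _ _ _
    simpa using ha.add hb
  smul_mem' := by
    intro c a ha
    change Tendsto _ _ _ at ha
    change Tendsto _ _ _
    simpa using ha.const_smul c

/-- The functional calculus of a nonnegative self-adjoint operator `A`: for a real continuous `f` on
`[0, ∞)`, the self-adjoint operator `f(A) u = lim (f χₙ)(A) u`, whose domain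
`{u : ∫ |f|² d(E_A u, u) < ∞}` consists of the `u` for which this limit exists. -/
def funCalc (A : E →ₗ.[ℂ] E) (f : ℝ → ℝ) : E →ₗ.[ℂ] E := (calcGraph A f).toLinearPMap

theorem mem_graph_funCalc {A : E →ₗ.[ℂ] E} {f : ℝ → ℝ} {u v : E} :
    (u, v) ∈ (funCalc A f).graph ↔
      Tendsto (fun n : ℕ => compactCalc A (fun x => cutoff n x * f x) u) atTop (𝓝 v) := by
  rw [funCalc, Submodule.toLinearPMap_graph_eq]
  · rfl
  · rintro ⟨x, y⟩ hx (rfl : x = 0)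
    have hx' : Tendsto (fun n : ℕ => compactCalc A (fun x => cutoff n x * f x) (0 : E))
      atTop (𝓝 y) := hx
    simp only [map_zero] at hx'
    exact tendsto_nhds_unique hx' tendsto_const_nhds

end Unbounded

/-- The function `λ ↦ cos (τ √λ)`. -/
def cosSqrt (τ x : ℝ) : ℝ := Real.cos (τ * √x)

/-- The function `λ ↦ λ^(-1/2) sin (τ √λ)`, with its continuous value `τ` at `λ = 0`. -/
def sinSqrtDiv (τ x : ℝ) : ℝ := τ * Real.sinc (τ * √x)

theorem sinSqrtDiv_of_pos {τ x : ℝ} (hx : 0 < x) :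
    sinSqrtDiv τ x = (√x)⁻¹ * Real.sin (τ * √x) := by
  have h := Real.sqrt_pos.2 hx
  rcases eq_or_ne τ 0 with rfl | hτ
  · simp [sinSqrtDiv]
  · rw [sinSqrtDiv, Real.sinc_of_ne_zero (mul_ne_zero hτ h.ne')]
    field_simp

/-- The data `X₀` (densely defined, closed) and `X₁` (bounded) of a pencil `X(t) = X₀ + t X₁`. -/
structure Pencil (H K : Type*) [NormedAddCommGroup H] [InnerProductSpace ℂ H]
    [NormedAddCommGroup K] [InnerProductSpace ℂ K] where
  X₀ : H →ₗ.[ℂ] K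
  X₁ : H →L[ℂ] K
  dense_domain : Dense (X₀.domain : Set H)
  isClosed : X₀.IsClosed

namespace Pencil

variable {H K : Type*} [NormedAddCommGroup H] [InnerProductSpace ℂ H] [CompleteSpace H]
  [NormedAddCommGroup K] [InnerProductSpace ℂ K] [CompleteSpace K]

/-- `X(t) = X₀ + t X₁` on `Dom X₀`. -/
def X (p : Pencil H K) (t : ℝ) : H →ₗ.[ℂ] K :=
  ((t : ℂ) • (p.X₁ : H →ₗ[ℂ] K)) +ᵥ p.X₀

/-- `A(t) = X(t)* X(t)`. -/
def A (p : Pencil H K) (t : ℝ) : H →ₗ.[ℂ] H := pcomp (p.X t)† (p.X t)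

/-- `𝔑 = Ker X₀`. -/
def kerX (p : Pencil H K) : Submodule ℂ H := pker p.X₀

/-- `𝔑_* = Ker X₀*`. -/
def kerXadj (p : Pencil H K) : Submodule ℂ K := pker p.X₀†

instance (p : Pencil H K) : p.kerX.HasOrthogonalProjection :=
  haveI : CompleteSpace p.kerX := (isClosed_pker p.isClosed).completeSpace_coe
  inferInstance

instance (p : Pencil H K) : p.kerXadj.HasOrthogonalProjection :=
  haveI : CompleteSpace p.kerXadj :=
    (isClosed_pker (LinearPMap.adjoint_isClosed p.dense_domain)).completeSpace_coe
  inferInstance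

/-- The orthogonal projection `P` onto `𝔑`. -/
def P (p : Pencil H K) : H →L[ℂ] H := p.kerX.starProjection

/-- `φ ∈ Dom X₀ ∩ 𝔑^⊥` is a weak solution of `X₀* (X₀ φ + g) = h`. -/
def IsWeakSol (p : Pencil H K) (g : K) (h φ : H) : Prop :=
  φ ∈ p.kerXᗮ ∧ ∃ hφ : φ ∈ p.X₀.domain,
    ∀ v : p.X₀.domain, ⟪p.X₀ v, p.X₀ ⟨φ, hφ⟩ + g⟫_ℂ = ⟪(v : H), h⟫_ℂ

/-- The bounded operator that takes `u` to the weak solution `φ ∈ Dom X₀ ∩ 𝔑^⊥` of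
`X₀* (X₀ φ + B u) = D u` (such a `φ` is unique; `0` by convention if there is no such operator). -/
def solve (p : Pencil H K) (B : H →L[ℂ] K) (D : H →L[ℂ] H) : H →L[ℂ] H := by
  classical
  exact if h : ∃ L : H →L[ℂ] H, ∀ u, p.IsWeakSol (B u) (D u) (L u) then h.choose else 0

/-- `Z u = φ(P u)`, where `X₀* (X₀ φ(ω) + X₁ ω) = 0`. -/
def Z (p : Pencil H K) : H →L[ℂ] H := p.solve (p.X₁ ∘L p.P) 0

/-- `R = X₀ Z + X₁` on `𝔑`, extended by zero to `𝔑^⊥` (that is, `R P`). -/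
def R (p : Pencil H K) : H →L[ℂ] K := bcomp p.X₀ p.Z + p.X₁ ∘L p.P

/-- The spectral germ `S = R* R` on `𝔑`, extended by zero to `𝔑^⊥` (that is, `S P`). -/
def S (p : Pencil H K) : H →L[ℂ] H := p.R.adjoint ∘L p.R

/-- `Z₂ u = ψ(P u)`, where `X₀* (X₀ ψ(ω) + X₁ Z ω) = - P^⊥ X₁* R ω`. -/
def Z₂ (p : Pencil H K) : H →L[ℂ] H :=
  p.solve (p.X₁ ∘L p.Z) (-((1 - p.P) ∘L p.X₁.adjoint ∘L p.R))

/-- `R₂ = X₀ Z₂ + X₁ Z` on `𝔑`, extended by zero to `𝔑^⊥` (that is, `R₂ P`). -/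
def R₂ (p : Pencil H K) : H →L[ℂ] K := bcomp p.X₀ p.Z₂ + p.X₁ ∘L p.Z

/-- `N = Z* X₁* R P + (R P)* X₁ Z`. -/
def N (p : Pencil H K) : H →L[ℂ] H :=
  p.Z.adjoint ∘L p.X₁.adjoint ∘L p.R + p.R.adjoint ∘L p.X₁ ∘L p.Z

/-- `Ker (S - γ I_𝔑)`, a subspace of `𝔑`. -/
def germEigenspace (p : Pencil H K) (γ : ℝ) : Submodule ℂ H :=
  p.kerX ⊓ (p.S - (γ : ℂ) • 1).ker

instance (p : Pencil H K) (γ : ℝ) : (p.germEigenspace γ).HasOrthogonalProjection :=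
  haveI : CompleteSpace (p.germEigenspace γ) :=
    ((isClosed_pker p.isClosed).inter
      (ContinuousLinearMap.isClosed_ker (p.S - (γ : ℂ) • 1))).completeSpace_coe
  inferInstance

/-- The set `{γ₁°, …, γ_p°}` of the different eigenvalues of the germ. -/
def germEigenvalues (p : Pencil H K) : Set ℝ := {γ | p.germEigenspace γ ≠ ⊥}

/-- The orthogonal projection of `𝔥` onto `Ker (S - γ I_𝔑)`. -/
def eigProj (p : Pencil H K) (γ : ℝ) : H →L[ℂ] H := (p.germEigenspace γ).starProjection

/-- `N₀ = ∑_j P_j N P_j` (a finite sum, since `dim 𝔑 < ∞`). -/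
def N₀ (p : Pencil H K) : H →L[ℂ] H :=
  ∑ᶠ γ ∈ p.germEigenvalues, p.eigProj γ ∘L p.N ∘L p.eigProj γ

/-- `N₁⁰ = Z₂* X₁* R P + (R P)* X₁ Z₂ + R₂* R₂ P`. -/
def N₁ (p : Pencil H K) : H →L[ℂ] H :=
  p.Z₂.adjoint ∘L p.X₁.adjoint ∘L p.R + p.R.adjoint ∘L p.X₁ ∘L p.Z₂ + p.R₂.adjoint ∘L p.R₂

/-- The operator `𝒩^(q)` in `𝔑_q = Ker (S - γ I_𝔑)`, `γ = γ_q°`, extended by zero to `𝔑_q^⊥`: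
`P_q (N₁⁰ - ½ Z* Z S P - ½ S P Z* Z) P_q + ∑_{j ≠ q} (γ_q° - γ_j°)⁻¹ P_q N P_j N P_q`. -/
def germN (p : Pencil H K) (γ : ℝ) : H →L[ℂ] H :=
  p.eigProj γ ∘L
      (p.N₁ - (1 / 2 : ℂ) • (p.Z.adjoint ∘L p.Z ∘L p.S) - (1 / 2 : ℂ) • (p.S ∘L p.Z.adjoint ∘L p.Z))
        ∘L p.eigProj γ +
    ∑ᶠ γ' ∈ p.germEigenvalues \ {γ},
      ((γ - γ' : ℝ) : ℂ)⁻¹ • (p.eigProj γ ∘L p.N ∘L p.eigProj γ' ∘L p.N ∘L p.eigProj γ)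

/-- `J₁(t, τ) = cos (τ A(t)^(1/2)) P - cos (τ (t² S)^(1/2)) P`. -/
def J₁ (p : Pencil H K) (t τ : ℝ) : H →L[ℂ] H :=
  bcomp (funCalc (p.A t) (cosSqrt τ)) p.P - cfc (cosSqrt τ) ((t : ℂ) ^ 2 • p.S) ∘L p.P

/-- `J₂(t, τ) = A(t)^(-1/2) sin (τ A(t)^(1/2)) P - (t² S)^(-1/2) sin (τ (t² S)^(1/2)) P`. -/
def J₂ (p : Pencil H K) (t τ : ℝ) : H →L[ℂ] H :=
  bcomp (funCalc (p.A t) (sinSqrtDiv τ)) p.P - cfc (sinSqrtDiv τ) ((t : ℂ) ^ 2 • p.S) ∘L p.P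

/-- `Σ(t, τ) = (A(t)^(-1/2) sin (τ A(t)^(1/2)) - (I + t Z) (t² S)^(-1/2) sin (τ (t² S)^(1/2))) P`. -/
def Sig (p : Pencil H K) (t τ : ℝ) : H →L[ℂ] H :=
  bcomp (funCalc (p.A t) (sinSqrtDiv τ)) p.P -
    (1 + (t : ℂ) • p.Z) ∘L cfc (sinSqrtDiv τ) ((t : ℂ) ^ 2 • p.S) ∘L p.P

/-- `A(t)^(1/2) Σ(t, τ)`. -/
def sqrtASig (p : Pencil H K) (t τ : ℝ) : H →L[ℂ] H :=
  bcomp (funCalc (p.A t) Real.sqrt) (p.Sig t τ)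

/-- The standing assumptions: `0` is an isolated point of the spectrum of `A(0)`,
`0 < n = dim 𝔑 < ∞`, `n ≤ n_* = dim 𝔑_*`, and `A(t) ≥ c_* t² I` for small `|t|`, in the sense of
the quadratic form `‖X(t) u‖²` of `A(t)`, with some `c_* > 0`. -/
structure Admissible (p : Pencil H K) : Prop where
  zero_isolated : (0 : ℂ) ∈ pspectrum (p.A 0) ∧
    ∃ d > 0, ∀ z ∈ pspectrum (p.A 0), ‖z‖ < d → z = 0
  finite_ker : FiniteDimensional ℂ p.kerX
  ker_ne_bot : p.kerX ≠ ⊥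
  finrank_le : (Module.finrank ℂ p.kerX : Cardinal) ≤ Module.rank ℂ p.kerXadj
  nondegenerate : ∃ c > 0, ∃ t₀ > 0, ∀ t : ℝ, |t| ≤ t₀ → ∀ u : (p.X t).domain,
    c * t ^ 2 * ‖(u : H)‖ ^ 2 ≤ ‖p.X t u‖ ^ 2

end Pencil

/-- The smoothing factor `ε^s (t² + ε²)^(-s/2)`. -/
def smoothing (s t ε : ℝ) : ℝ := ε ^ s * (t ^ 2 + ε ^ 2) ^ (-s / 2)

end AbstractScheme

end

/-!
The smoothing exponent and the growth in time are tested on quasimodes, so that no analytic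
perturbation theory for `A(t)` is needed.

If `N₀ = 0` and `𝒩^(q) ≠ 0`, then the self-adjoint operator `𝒩^(q)` has an eigenvector `ω ∈ 𝔑_q` with
an eigenvalue `ν ≠ 0` (`Pencil.Admissible.exists_eigenvector_germN`). With `γ = γ_q° > 0`, a formal
power series computation up to `t⁴` gives a vector `w = ω + O(t)` for which `A(t) w = l w` holds in the
weak sense up to `O(t⁵)`, where `l = γ t² + ν t⁴` (`Pencil.Admissible.exists_quasimode`). The cubic
term of the eigenvalue vanishes because `N₀ = 0`. The coefficients of the series solve equations of
the form `X₀* (X₀ φ + g) = h` with `h ⊥ 𝔑`, and these are solvable because the isolation of `0` in the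
spectrum of `A(0)` makes the form of `A(0)` coercive on the orthogonal complement of `𝔑`
(`exists_gap`, `exists_pseudoinverse`).

The frequencies `√l` and `t √γ` differ by a quantity of exact order `t³`. Hence there are times
`T ~ t⁻³` at which `cos (T √l)` and `cos (T t √γ)` differ by at least `1`, and so do the sines
(`exists_separating_time`, `exists_resonant_time`). A weak quasimode is a quasimode of the resolvent
`(A(t) + 1)⁻¹`, with a residual `O(t⁵)` (`IsFormResolvent.norm_quasimode_le`), and then one of the
functions of `A(t)` in question, with the residual multiplied by a Lipschitz constant
(`IsNonnegResolvent.norm_inner_funCalc_sub_le`). At those times this constant is `O(t⁻⁴)` for the cosine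
and `O(t⁻⁵)` for `A(t)^(-1/2) sin (T A(t)^(1/2))`, so the errors are `O(t)` and `O(1)`, against main terms
of order `1` and `t⁻¹`. Pairing `J₁ ω`, `J₂ ω`
and `A(t)^(1/2) Σ ω` with the quasimode therefore gives lower bounds for `‖J₁‖`, `t ‖J₂‖` and
`‖A(t)^(1/2) Σ‖` which do not depend on `t` (`Pencil.norm_J₁_ge`, `Pencil.norm_J₂_ge`,
`Pencil.Admissible.norm_sqrtASig_ge`, `Pencil.Admissible.isResonant`). For the last one, the square
root is carried over to the quasimode, which requires that `Dom X(t)` be contained in the domain of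
`A(t)^(1/2)` (`IsNonnegResolvent.exists_mem_graph_sqrt`), and the corrector `t Z` is harmless because
`Z ω ⊥ ω`.

The choice `ε = |τ| / T ~ t³` makes the smoothing factor comparable to `t^(2 s)` and excludes the
small exponents (`IsResonant.not_smoothing_bound`). The choice `ε = t`, `τ = t T ~ t⁻²` makes it a
constant and excludes a growth in time slower than `|τ|^(1/2)` (`IsResonant.not_time_bound`).
-/

open scoped InnerProductSpace LinearPMap
open Filter Topology

noncomputable section

set_option linter.unusedSectionVars false

namespace AbstractScheme

/-! ### Resolvents of `X* X` in the weak form -/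

section Resolvent

variable {E F : Type*}
  [NormedAddCommGroup E] [InnerProductSpace ℂ E] [CompleteSpace E]
  [NormedAddCommGroup F] [InnerProductSpace ℂ F] [CompleteSpace F]

/-- The weak form of `T = (X* X + 1)⁻¹`: every `T z` lies in `Dom X` and, with `w = X (T z)`,
`⟪X v, X T z⟫ + ⟪v, T z⟫ = ⟪v, z⟫` for all `v ∈ Dom X`. -/
def IsFormResolvent (X : E →ₗ.[ℂ] F) (T : E →L[ℂ] E) : Prop :=
  ∀ z, ∃ w, (T z, w) ∈ X.graph ∧ ∀ v v', (v, v') ∈ X.graph → ⟪v', w⟫_ℂ + ⟪v, T z⟫_ℂ = ⟪v, z⟫_ℂ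

/-- A graph form of the relation between `X` and its adjoint. -/
theorem inner_eq_of_mem_graph_adjoint {X : E →ₗ.[ℂ] F} (hd : Dense (X.domain : Set E))
    {v : E} {v' : F} (hv : (v, v') ∈ X.graph) {w : F} {w' : E} (hw : (w, w') ∈ X†.graph) :
    ⟪v', w⟫_ℂ = ⟪v, w'⟫_ℂ := by
  obtain ⟨x, rfl, rfl⟩ := (LinearPMap.mem_graph_iff _).1 hv
  obtain ⟨y, rfl, rfl⟩ := (LinearPMap.mem_graph_iff _).1 hw
  have := LinearPMap.adjoint_isFormalAdjoint (T := X) hd y x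
  rw [← inner_conj_symm, ← this, inner_conj_symm]

theorem IsResolventAt.mem_graph {A : E →ₗ.[ℂ] E} {z : ℂ} {T : E →L[ℂ] E}
    (hT : IsResolventAt A z T) (u : E) : (T u, u + z • T u) ∈ A.graph := by
  obtain ⟨hu, h⟩ := hT.1 u
  refine (LinearPMap.mem_graph_iff _).2 ⟨⟨_, hu⟩, rfl, ?_⟩
  rw [← sub_eq_iff_eq_add]; exact h

theorem IsResolventAt.apply_of_mem_graph {A : E →ₗ.[ℂ] E} {z : ℂ} {T : E →L[ℂ] E}
    (hT : IsResolventAt A z T) {u v : E} (h : (u, v) ∈ A.graph) : T (v - z • u) = u := by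
  obtain ⟨x, rfl, rfl⟩ := (LinearPMap.mem_graph_iff _).1 h
  exact hT.2 x

theorem IsResolventAt.isFormResolvent {X : E →ₗ.[ℂ] F} (hd : Dense (X.domain : Set E))
    {T : E →L[ℂ] E} (hT : IsResolventAt (pcomp X† X) (-1) T) : IsFormResolvent X T := by
  intro z
  obtain ⟨w, h1, h2⟩ := mem_graph_pcomp.1 (hT.mem_graph z)
  refine ⟨w, h1, fun v v' hv => ?_⟩
  rw [inner_eq_of_mem_graph_adjoint hd hv h2, ← inner_add_right]
  simp

namespace IsFormResolvent

variable {X : E →ₗ.[ℂ] F} {T : E →L[ℂ] E}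

theorem inner_comm (hT : IsFormResolvent X T) (u v : E) : ⟪T u, v⟫_ℂ = ⟪u, T v⟫_ℂ := by
  obtain ⟨w, hw, h⟩ := hT u
  obtain ⟨w', hw', h'⟩ := hT v
  rw [← h' _ _ hw, ← inner_conj_symm u, ← h _ _ hw', map_add, inner_conj_symm, inner_conj_symm]

theorem isSelfAdjoint (hT : IsFormResolvent X T) : IsSelfAdjoint T :=
  ContinuousLinearMap.isSelfAdjoint_iff_isSymmetric.2 fun u v => hT.inner_comm u v

theorem exists_re_inner (hT : IsFormResolvent X T) (z : E) :
    ∃ w, (T z, w) ∈ X.graph ∧ (⟪z, T z⟫_ℂ).re = ‖w‖ ^ 2 + ‖T z‖ ^ 2 ∧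
      ∀ v v', (v, v') ∈ X.graph → ⟪v', w⟫_ℂ + ⟪v, T z⟫_ℂ = ⟪v, z⟫_ℂ := by
  obtain ⟨w, hw, h⟩ := hT z
  refine ⟨w, hw, ?_, h⟩
  rw [← hT.inner_comm, ← h _ _ hw, Complex.add_re]
  congr 1 <;> exact inner_self_eq_norm_sq (𝕜 := ℂ) _

theorem nonneg (hT : IsFormResolvent X T) : 0 ≤ T := by
  rw [ContinuousLinearMap.nonneg_iff_isPositive, ContinuousLinearMap.isPositive_def']
  refine ⟨hT.isSelfAdjoint, fun z => ?_⟩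
  obtain ⟨w, -, h, -⟩ := hT.exists_re_inner z
  change 0 ≤ (⟪T z, z⟫_ℂ).re
  rw [hT.inner_comm, h]; positivity

theorem exists_norm_le (hT : IsFormResolvent X T) (z : E) :
    ∃ w, (T z, w) ∈ X.graph ∧ ‖w‖ ≤ ‖z‖ ∧ ‖T z‖ ≤ ‖z‖ ∧
      ∀ v v', (v, v') ∈ X.graph → ⟪v', w⟫_ℂ + ⟪v, T z⟫_ℂ = ⟪v, z⟫_ℂ := by
  obtain ⟨w, hw, h, h'⟩ := hT.exists_re_inner z
  have h1 : (⟪z, T z⟫_ℂ).re ≤ ‖z‖ * ‖T z‖ := (Complex.re_le_norm _).trans (norm_inner_le_norm _ _)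
  have h2 : ‖T z‖ ≤ ‖z‖ := by
    by_contra! hc
    nlinarith [norm_nonneg z, norm_nonneg (T z), sq_nonneg ‖w‖]
  refine ⟨w, hw, ?_, h2, h'⟩
  apply le_of_sq_le_sq _ (norm_nonneg _)
  nlinarith [norm_nonneg z, norm_nonneg (T z)]

theorem norm_apply_le (hT : IsFormResolvent X T) (z : E) : ‖T z‖ ≤ ‖z‖ := by
  obtain ⟨-, -, -, h, -⟩ := hT.exists_norm_le z
  exact h

theorem spectrum_subset [Nontrivial E] (hT : IsFormResolvent X T) :
    spectrum ℝ T ⊆ Set.Icc 0 1 := by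
  intro x hx
  refine ⟨spectrum_nonneg_of_nonneg hT.nonneg hx, ?_⟩
  have h1 : ‖T‖ ≤ 1 := T.opNorm_le_bound zero_le_one (by simpa using hT.norm_apply_le)
  exact (le_abs_self x).trans ((spectrum.norm_le_norm_of_mem hx).trans h1)

/-- The Cauchy-Schwarz inequality for the form `‖X v‖² + ‖v‖²`, applied to `v` and `T z`. -/
theorem norm_inner_sq_le (hT : IsFormResolvent X T) {v : E} {v' : F} (hv : (v, v') ∈ X.graph)
    (z : E) : ‖⟪v, z⟫_ℂ‖ ^ 2 ≤ (‖v‖ ^ 2 + ‖v'‖ ^ 2) * (⟪z, T z⟫_ℂ).re := by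
  obtain ⟨w, hw, h, h'⟩ := hT.exists_re_inner z
  rw [← h' v v' hv, h]
  have h1 : ‖⟪v', w⟫_ℂ + ⟪v, T z⟫_ℂ‖ ≤ ‖v'‖ * ‖w‖ + ‖v‖ * ‖T z‖ :=
    (norm_add_le _ _).trans (add_le_add (norm_inner_le_norm _ _) (norm_inner_le_norm _ _))
  refine (pow_le_pow_left₀ (norm_nonneg _) h1 2).trans ?_
  nlinarith [sq_nonneg (‖v'‖ * ‖T z‖ - ‖v‖ * ‖w‖)]

/-- A weak quasimode of `X* X` with residual `r` is a quasimode of the resolvent `T`. -/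
theorem norm_quasimode_le (hT : IsFormResolvent X T) {f : E} {f' : F} (hf : (f, f') ∈ X.graph)
    {l r : ℝ} (hl : 0 ≤ l) (hr : 0 ≤ r)
    (h : ∀ v v', (v, v') ∈ X.graph → ‖⟪v', f'⟫_ℂ - l * ⟪v, f⟫_ℂ‖ ≤ r * (‖v‖ + ‖v'‖)) :
    ‖T f - ((1 + l)⁻¹ : ℝ) • f‖ ≤ 2 * r := by
  have key : ‖f - (1 + l) • T f‖ ≤ 2 * r := by
    have : ∀ z, ‖⟪z, f - (1 + l) • T f⟫_ℂ‖ ≤ 2 * r * ‖z‖ := by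
      intro z
      obtain ⟨w, hw, hwz, hTz, hz⟩ := hT.exists_norm_le z
      have h1 := hz _ _ hf
      have h2 : ⟪z, f - (1 + l) • T f⟫_ℂ = ⟪w, f'⟫_ℂ - l * ⟪T z, f⟫_ℂ := by
        have h3 : ⟪w, f'⟫_ℂ + ⟪T z, f⟫_ℂ = ⟪z, f⟫_ℂ := by
          rw [← inner_conj_symm w, ← inner_conj_symm (T z), ← map_add, h1, inner_conj_symm]
        rw [inner_sub_right, ← h3, ← Complex.coe_smul, inner_smul_right, ← hT.inner_comm]
        push_cast; ring
      rw [h2]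
      refine (h _ _ hw).trans ?_
      nlinarith
    have h3 := this (f - (1 + l) • T f)
    rw [inner_self_eq_norm_sq_to_K] at h3
    simp only [norm_pow, Complex.coe_algebraMap, Complex.norm_real, norm_norm] at h3
    rcases (norm_nonneg (f - (1 + l) • T f)).eq_or_lt with h0 | h0
    · rw [← h0]; positivity
    · nlinarith
  have h1 : T f - ((1 + l)⁻¹ : ℝ) • f = -((1 + l)⁻¹ : ℝ) • (f - (1 + l) • T f) := by
    rw [smul_sub, smul_smul]
    have : -(1 + l)⁻¹ * (1 + l) = -1 := by field_simp
    rw [this]; simp; abel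
  rw [h1, norm_smul, norm_neg, Real.norm_of_nonneg (by positivity)]
  have : (1 + l)⁻¹ ≤ 1 := inv_le_one_of_one_le₀ (by linarith)
  nlinarith [norm_nonneg (f - (1 + l) • T f), inv_nonneg.2 (by linarith : 0 ≤ 1 + l)]

end IsFormResolvent

end Resolvent

/-! ### Functional calculus of a nonnegative operator through its resolvent -/

section BoundedCalculus

variable {E : Type*} [NormedAddCommGroup E] [InnerProductSpace ℂ E] [CompleteSpace E]

theorem cfc_inner_comm (F : ℝ → ℝ) (T : E →L[ℂ] E) (u v : E) :
    ⟪cfc F T u, v⟫_ℂ = ⟪u, cfc F T v⟫_ℂ :=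
  ContinuousLinearMap.isSelfAdjoint_iff_isSymmetric.1 (IsSelfAdjoint.cfc (f := F) (a := T)) u v

theorem re_inner_cfc_mono {F G : ℝ → ℝ} {T : E →L[ℂ] E}
    (hF : Continuous F) (hG : Continuous G) (h : ∀ x ∈ spectrum ℝ T, F x ≤ G x) (u : E) :
    (⟪u, cfc F T u⟫_ℂ).re ≤ (⟪u, cfc G T u⟫_ℂ).re := by
  have h1 : cfc F T ≤ cfc G T := cfc_mono h hF.continuousOn hG.continuousOn
  rw [ContinuousLinearMap.le_def] at h1
  have h2 := h1.re_inner_nonneg_right u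
  rw [_root_.sub_apply, inner_sub_right, map_sub] at h2
  exact sub_nonneg.1 h2

theorem norm_cfc_apply_sq {F : ℝ → ℝ} {T : E →L[ℂ] E} (hF : Continuous F) (u : E) :
    ‖cfc F T u‖ ^ 2 = (⟪u, cfc (fun x => F x * F x) T u⟫_ℂ).re := by
  rw [cfc_mul F F T hF.continuousOn hF.continuousOn, mul_apply_eq_comp,
    ← cfc_inner_comm]
  exact (inner_self_eq_norm_sq (𝕜 := ℂ) _).symm

/-- If `‖F x - c‖ ≤ L ‖x - m‖` on the spectrum, then a quasimode of `T` at `m` is one of `F(T)` at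
`c`, with the residual multiplied by `L`. -/
theorem norm_cfc_apply_sub_le {F : ℝ → ℝ} {T : E →L[ℂ] E} (hT : IsSelfAdjoint T)
    (hF : Continuous F) {c m L : ℝ} (hL : 0 ≤ L)
    (h : ∀ x ∈ spectrum ℝ T, |F x - c| ≤ L * |x - m|) (u : E) :
    ‖cfc F T u - c • u‖ ≤ L * ‖T u - m • u‖ := by
  have h1 : cfc F T u - c • u = cfc (fun x => F x - c) T u := by
    rw [cfc_sub F (fun _ => c) T hF.continuousOn continuousOn_const, cfc_const c T]
    simp [Algebra.algebraMap_eq_smul_one]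
  have h2 : L • (T u - m • u) = cfc (fun x => L * (x - m)) T u := by
    rw [cfc_const_mul L (fun x => x - m) T, cfc_sub (fun x => x) (fun _ => m) T, cfc_const m T,
      cfc_id' ℝ T]
    simp [Algebra.algebraMap_eq_smul_one]
  apply le_of_sq_le_sq _ (by positivity)
  have h3 : (L * ‖T u - m • u‖) ^ 2 = ‖L • (T u - m • u)‖ ^ 2 := by
    rw [norm_smul, Real.norm_of_nonneg hL]
  rw [h3, h1, h2, norm_cfc_apply_sq (by fun_prop), norm_cfc_apply_sq (by fun_prop)]
  apply re_inner_cfc_mono (by fun_prop) (by fun_prop)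
  intro x hx
  have := h x hx
  rw [← sq, ← sq, ← sq_abs, ← sq_abs (L * (x - m)), abs_mul, abs_of_nonneg hL]
  exact pow_le_pow_left₀ (abs_nonneg _) this 2

/-- The functional calculus acts on an eigenvector by the value at the eigenvalue. -/
theorem cfc_apply_of_eigenvector {F : ℝ → ℝ} {T : E →L[ℂ] E} (hT : IsSelfAdjoint T)
    (hF : Continuous F) {c m L : ℝ} (hL : 0 ≤ L)
    (h : ∀ x ∈ spectrum ℝ T, |F x - c| ≤ L * |x - m|) {u : E} (hu : T u = m • u) :
    cfc F T u = c • u := by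
  have := norm_cfc_apply_sub_le hT hF hL h u
  rw [hu, sub_self, norm_zero, mul_zero] at this
  exact sub_eq_zero.1 (norm_le_zero_iff.1 this)

/-- Convergence of a sequence whose increments are controlled by a bounded monotone sequence. -/
theorem exists_tendsto_of_norm_sub_sq_le {s : ℕ → E} {a : ℕ → ℝ} {b : ℝ} (hb : ∀ n, a n ≤ b)
    (h : ∀ n m, n ≤ m → ‖s m - s n‖ ^ 2 ≤ a m - a n) : ∃ v, Tendsto s atTop (𝓝 v) := by
  have hmono : Monotone a := fun n m hnm => by
    have := h n m hnm
    nlinarith [sq_nonneg ‖s m - s n‖]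
  have hlim := tendsto_atTop_ciSup hmono ⟨b, by rintro _ ⟨n, rfl⟩; exact hb n⟩
  have hle : ∀ m, a m ≤ ⨆ i, a i := fun m => hmono.ge_of_tendsto hlim m
  apply cauchySeq_tendsto_of_complete
  apply cauchySeq_of_le_tendsto_0' (fun n => √((⨆ i, a i) - a n))
  · intro n m hnm
    rw [dist_comm, dist_eq_norm]
    apply Real.le_sqrt_of_sq_le
    linarith [h n m hnm, hle m]
  · have h2 : Tendsto (fun n => √((⨆ i, a i) - a n)) atTop (𝓝 √((⨆ i, a i) - ⨆ i, a i)) :=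
      (tendsto_const_nhds.sub hlim).sqrt
    simpa using h2

end BoundedCalculus

section Cutoff

theorem continuous_cutoff (n : ℕ) : Continuous (cutoff n) := by unfold cutoff; fun_prop

theorem cutoff_nonneg (n : ℕ) (y : ℝ) : 0 ≤ cutoff n y := le_max_left _ _

theorem cutoff_le_one (n : ℕ) (y : ℝ) : cutoff n y ≤ 1 :=
  max_le zero_le_one (min_le_left _ _)

theorem cutoff_eq_one {n : ℕ} {y : ℝ} (h : y ≤ n) : cutoff n y = 1 := by
  rw [cutoff, min_eq_left (by linarith), max_eq_right zero_le_one]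

theorem cutoff_eq_zero {n : ℕ} {y : ℝ} (h : (n : ℝ) + 1 ≤ y) : cutoff n y = 0 := by
  rw [cutoff, max_eq_left]
  exact (min_le_right _ _).trans (by linarith)

theorem cutoff_mono {n m : ℕ} (h : n ≤ m) (y : ℝ) : cutoff n y ≤ cutoff m y := by
  have : (n : ℝ) ≤ m := by exact_mod_cast h
  unfold cutoff
  gcongr

theorem cutoff_mul_cutoff {n m : ℕ} (h : n + 1 ≤ m) (y : ℝ) :
    cutoff n y * cutoff m y = cutoff n y := by
  have : (n : ℝ) + 1 ≤ m := by exact_mod_cast h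
  rcases le_total y m with hy | hy
  · rw [cutoff_eq_one hy, mul_one]
  · rw [cutoff_eq_zero (this.trans hy), zero_mul]

/-- The function `x ↦ φ (1 / x - 1)`, extended by zero to `x ≤ 0`, which carries `φ(A)` to a function
of the resolvent `(A + 1)⁻¹`. -/
def resFun (φ : ℝ → ℝ) (x : ℝ) : ℝ := if 0 < x then φ (x⁻¹ - 1) else 0

theorem continuous_resFun {φ : ℝ → ℝ} (hφ : Continuous φ) {b : ℝ} (hb : ∀ y, b ≤ y → φ y = 0) :
    Continuous (resFun φ) := by
  rw [continuous_iff_continuousAt]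
  intro x
  rcases lt_or_ge 0 x with hx | hx
  · have h1 : ContinuousAt (fun x : ℝ => φ (x⁻¹ - 1)) x :=
      hφ.continuousAt.comp ((continuousAt_inv₀ hx.ne').sub continuousAt_const)
    refine h1.congr ?_
    filter_upwards [lt_mem_nhds hx] with y hy
    rw [resFun, if_pos hy]
  · have h1 : ContinuousAt (fun _ : ℝ => (0 : ℝ)) x := continuousAt_const
    refine h1.congr ?_
    have hpos : 0 < (|b| + 1)⁻¹ := by positivity
    filter_upwards [gt_mem_nhds (hx.trans_lt hpos)] with y hy
    rw [resFun]
    split_ifs with h0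
    · refine (hb _ ?_).symm
      have : |b| + 1 < y⁻¹ := by
        rw [lt_inv_comm₀ (by positivity) h0]; exact hy
      linarith [le_abs_self b]
    · rfl

theorem continuous_resFun_cutoff_mul {f : ℝ → ℝ} (hf : Continuous f) (n : ℕ) :
    Continuous (resFun fun y => cutoff n y * f y) :=
  continuous_resFun (b := n + 1) ((continuous_cutoff n).mul hf) fun y hy => by
    rw [cutoff_eq_zero hy, zero_mul]

end Cutoff

theorem abs_sqrt_sub_sqrt_le (y : ℝ) {l : ℝ} (hl : 0 < l) : |√y - √l| ≤ (√l)⁻¹ * |y - l| := by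
  have h2 := Real.sqrt_pos.2 hl
  rw [inv_mul_eq_div, le_div_iff₀ h2]
  rcases le_total 0 y with hy | hy
  · have h1 : y - l = (√y - √l) * (√y + √l) := by
      nlinarith [Real.sq_sqrt hy, Real.sq_sqrt hl.le]
    rw [h1, abs_mul, abs_of_pos (by positivity : 0 < √y + √l)]
    gcongr
    linarith [Real.sqrt_nonneg y]
  · rw [Real.sqrt_eq_zero_of_nonpos hy, zero_sub, abs_neg, abs_of_pos h2, Real.mul_self_sqrt hl.le,
      abs_sub_comm]
    exact le_trans (by linarith) (le_abs_self _)

section FunCalc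

variable {E : Type*} [NormedAddCommGroup E] [InnerProductSpace ℂ E] [CompleteSpace E]

/-- `T = (A + 1)⁻¹` is a self-adjoint operator with spectrum in `[0, 1]`. -/
structure IsNonnegResolvent (A : E →ₗ.[ℂ] E) (T : E →L[ℂ] E) : Prop where
  presolvent_eq : presolvent A (-1) = T
  isSelfAdjoint : IsSelfAdjoint T
  spectrum_subset : spectrum ℝ T ⊆ Set.Icc 0 1

namespace IsNonnegResolvent

variable {A : E →ₗ.[ℂ] E} {T : E →L[ℂ] E}

theorem compactCalc_eq (h : IsNonnegResolvent A T) (φ : ℝ → ℝ) :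
    compactCalc A φ = cfc (resFun φ) T := by
  rw [compactCalc, h.presolvent_eq]; rfl

theorem inv_sub_one_nonneg (h : IsNonnegResolvent A T) {x : ℝ} (hx : x ∈ spectrum ℝ T) (h0 : 0 < x) :
    0 ≤ x⁻¹ - 1 := by
  have := one_le_inv₀ h0 |>.2 (h.spectrum_subset hx).2
  linarith

/-- Convergence of `Fₙ(A) u` when `(Fₘ - Fₙ)² ≤ Gₘ - Gₙ` for `n ≤ m` and `(Gₙ(A) u, u)` is bounded. -/
theorem exists_tendsto (h : IsNonnegResolvent A T) {F G : ℕ → ℝ → ℝ}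
    (hF : ∀ n, Continuous (resFun (F n))) (hG : ∀ n, Continuous (resFun (G n)))
    (hFG : ∀ n m, n ≤ m → ∀ y, 0 ≤ y → (F m y - F n y) ^ 2 ≤ G m y - G n y) {u : E} {b : ℝ}
    (hb : ∀ n, (⟪u, compactCalc A (G n) u⟫_ℂ).re ≤ b) :
    ∃ v, Tendsto (fun n => compactCalc A (F n) u) atTop (𝓝 v) := by
  refine exists_tendsto_of_norm_sub_sq_le hb fun n m hnm => ?_
  simp only [h.compactCalc_eq]
  rw [← _root_.sub_apply, ← cfc_sub _ _ T (hF m).continuousOn (hF n).continuousOn,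
    norm_cfc_apply_sq (F := fun x => resFun (F m) x - resFun (F n) x) ((hF m).sub (hF n)),
    ← Complex.sub_re, ← inner_sub_right,
    ← _root_.sub_apply, ← cfc_sub _ _ T (hG m).continuousOn (hG n).continuousOn]
  have hFm := hF m
  have hFn := hF n
  have hGm := hG m
  have hGn := hG n
  refine re_inner_cfc_mono (by fun_prop) (by fun_prop) (fun x hx => ?_) u
  simp only [resFun]
  split_ifs with h0
  · rw [← sq]; exact hFG n m hnm _ (h.inv_sub_one_nonneg hx h0)
  · simp

/-- A bounded function of a nonnegative self-adjoint operator is an everywhere defined bounded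
operator. -/
theorem exists_mem_graph_funCalc (h : IsNonnegResolvent A T) {f : ℝ → ℝ} (hf : Continuous f) {B : ℝ}
    (hB : ∀ y, 0 ≤ y → |f y| ≤ B) : ∃ M : E →L[ℂ] E, ∀ u, (u, M u) ∈ (funCalc A f).graph := by
  have hB0 : 0 ≤ B := (abs_nonneg _).trans (hB 0 le_rfl)
  have key : ∀ u, ∃ v, Tendsto (fun n => compactCalc A (fun y => cutoff n y * f y) u)
      atTop (𝓝 v) := by
    intro u
    have hGc : ∀ n, Continuous (resFun fun y => cutoff n y * B ^ 2) :=
      fun n => continuous_resFun_cutoff_mul continuous_const n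
    refine h.exists_tendsto (b := (⟪u, cfc (fun _ => B ^ 2) T u⟫_ℂ).re)
      (continuous_resFun_cutoff_mul hf) hGc ?_ ?_
    · intro n m hnm y hy
      have h1 := cutoff_mono hnm y
      have h2 := cutoff_le_one m y
      have h3 := cutoff_nonneg n y
      have h4 : f y ^ 2 ≤ B ^ 2 := sq_le_sq' (abs_le.1 (hB y hy)).1 (abs_le.1 (hB y hy)).2
      calc (cutoff m y * f y - cutoff n y * f y) ^ 2
          = (cutoff m y - cutoff n y) ^ 2 * f y ^ 2 := by ring
        _ ≤ (cutoff m y - cutoff n y) * B ^ 2 := by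
          gcongr
          nlinarith
        _ = _ := by ring
    · intro n
      rw [h.compactCalc_eq]
      apply re_inner_cfc_mono (hGc n) continuous_const
      intro x _
      simp only [resFun]
      split_ifs with h0
      · nlinarith [cutoff_le_one n (x⁻¹ - 1), sq_nonneg B]
      · positivity
  choose g hg using key
  refine ⟨continuousLinearMapOfTendsto (l := atTop)
    (fun n : ℕ => compactCalc A (fun y => cutoff n y * f y)) (f := g)
    (tendsto_pi_nhds.2 hg), fun u => ?_⟩
  exact mem_graph_funCalc.2 (hg u)

theorem norm_le_of_mem_graph_funCalc (h : IsNonnegResolvent A T) {f : ℝ → ℝ} {B : ℝ}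
    (hB : ∀ y, 0 ≤ y → |f y| ≤ B) {u v : E} (hv : (u, v) ∈ (funCalc A f).graph) :
    ‖v‖ ≤ B * ‖u‖ := by
  have hB0 : 0 ≤ B := (abs_nonneg _).trans (hB 0 le_rfl)
  refine le_of_tendsto (mem_graph_funCalc.1 hv).norm (Eventually.of_forall fun n => ?_)
  refine ContinuousLinearMap.le_of_opNorm_le _ ?_ u
  rw [h.compactCalc_eq]
  refine norm_cfc_le hB0 fun x hx => ?_
  simp only [resFun]
  split_ifs with h0
  · have h1 := hB _ (h.inv_sub_one_nonneg hx h0)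
    rw [norm_mul, Real.norm_of_nonneg (cutoff_nonneg _ _), Real.norm_eq_abs]
    nlinarith [cutoff_le_one n (x⁻¹ - 1), cutoff_nonneg n (x⁻¹ - 1), abs_nonneg (f (x⁻¹ - 1))]
  · simpa using hB0

/-- Pairing of `f(A) u` with a quasimode `w` of the resolvent at `(1 + l)⁻¹`. -/
theorem norm_inner_sub_le (h : IsNonnegResolvent A T) {f : ℝ → ℝ} (hf : Continuous f) {B k l : ℝ}
    (hB : ∀ y, 0 ≤ y → |f y| ≤ B) (hl0 : 0 ≤ l) (hl : l ≤ 1 / 2) (hk0 : 0 ≤ k)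
    (hk : ∀ y, 0 ≤ y → |f y - f l| ≤ k * |y - l|) (w : E) {u : E} {v : ℕ → E} {z : E}
    (hv : ∀ n, ⟪v n, z⟫_ℂ = ⟪u, compactCalc A (fun y => cutoff n y * f y) w⟫_ℂ) {v₀ : E}
    (hlim : Tendsto v atTop (𝓝 v₀)) :
    ‖⟪v₀, z⟫_ℂ - f l * ⟪u, w⟫_ℂ‖ ≤ ‖u‖ * ((4 * k + 12 * B) * ‖T w - ((1 + l)⁻¹ : ℝ) • w‖) := by
  have hB0 : 0 ≤ B := (abs_nonneg _).trans (hB 0 le_rfl)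
  have hm : (2 / 3 : ℝ) ≤ (1 + l)⁻¹ := by
    rw [le_inv_comm₀ (by norm_num) (by positivity)]; linarith
  have key : ∀ n, 1 ≤ n → ‖compactCalc A (fun y => cutoff n y * f y) w - f l • w‖ ≤
      (4 * k + 12 * B) * ‖T w - ((1 + l)⁻¹ : ℝ) • w‖ := by
    intro n hn
    have hn' : (1 : ℝ) ≤ n := by exact_mod_cast hn
    rw [h.compactCalc_eq]
    refine norm_cfc_apply_sub_le h.isSelfAdjoint (continuous_resFun_cutoff_mul hf n)
      (by positivity) ?_ w
    intro x hx
    have hx1 := h.spectrum_subset hx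
    -- Away from `1` the crude bound by `2 B` is enough, since `(1 + l)⁻¹ ≥ 2 / 3`.
    have hfl := hB l hl0
    have crude : x < 1 / 2 → ∀ a, |a| ≤ B → |a - f l| ≤ (4 * k + 12 * B) * |x - (1 + l)⁻¹| := by
      intro hx2 a ha
      have h1 : 1 / 6 ≤ |x - (1 + l)⁻¹| := by
        rw [abs_sub_comm]; exact le_trans (by linarith) (le_abs_self _)
      have h2 : |a - f l| ≤ 2 * B := (abs_sub _ _).trans (by linarith)
      nlinarith [mul_nonneg hk0 (abs_nonneg (x - (1 + l)⁻¹))]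
    simp only [resFun]
    split_ifs with h0
    · have hy := h.inv_sub_one_nonneg hx h0
      rcases lt_or_ge x (1 / 2) with hx2 | hx2
      · refine crude hx2 _ ?_
        rw [abs_mul, abs_of_nonneg (cutoff_nonneg _ _)]
        nlinarith [cutoff_le_one n (x⁻¹ - 1), cutoff_nonneg n (x⁻¹ - 1), hB _ hy,
          abs_nonneg (f (x⁻¹ - 1))]
      · have hxi : x⁻¹ ≤ 2 := by
          rw [inv_le_comm₀ h0 (by norm_num)]; linarith
        rw [cutoff_eq_one (by linarith), one_mul]
        refine (hk _ hy).trans ?_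
        have h1 : x⁻¹ - 1 - l = ((1 + l)⁻¹ - x) * (x⁻¹ * (1 + l)) := by field_simp; ring
        have h2 : x⁻¹ * (1 + l) ≤ 4 := by nlinarith [inv_pos.2 h0]
        rw [h1, abs_mul, abs_sub_comm, abs_of_nonneg (by positivity : 0 ≤ x⁻¹ * (1 + l))]
        have h3 := abs_nonneg (x - (1 + l)⁻¹)
        calc k * (|x - (1 + l)⁻¹| * (x⁻¹ * (1 + l))) ≤ k * (|x - (1 + l)⁻¹| * 4) := by gcongr
          _ ≤ _ := by nlinarith [mul_nonneg hB0 h3]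
    · exact crude (by linarith) 0 (by simpa using hB0)
  have hlim' : Tendsto (fun n => ‖⟪v n, z⟫_ℂ - f l * ⟪u, w⟫_ℂ‖) atTop
      (𝓝 ‖⟪v₀, z⟫_ℂ - f l * ⟪u, w⟫_ℂ‖) :=
    ((hlim.inner tendsto_const_nhds).sub tendsto_const_nhds).norm
  refine le_of_tendsto hlim' ?_
  filter_upwards [eventually_ge_atTop 1] with n hn
  have : ⟪v n, z⟫_ℂ - f l * ⟪u, w⟫_ℂ =
      ⟪u, compactCalc A (fun y => cutoff n y * f y) w - f l • w⟫_ℂ := by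
    rw [hv, inner_sub_right, ← Complex.coe_smul, inner_smul_right]
  rw [this]
  exact (norm_inner_le_norm _ _).trans (by gcongr; exact key n hn)

theorem compactCalc_inner_comm (h : IsNonnegResolvent A T) (φ : ℝ → ℝ) (u v : E) :
    ⟪compactCalc A φ u, v⟫_ℂ = ⟪u, compactCalc A φ v⟫_ℂ := by
  rw [h.compactCalc_eq, cfc_inner_comm]

theorem norm_inner_funCalc_sub_le (h : IsNonnegResolvent A T) {f : ℝ → ℝ} (hf : Continuous f)
    {B k l : ℝ} (hB : ∀ y, 0 ≤ y → |f y| ≤ B) (hl0 : 0 ≤ l) (hl : l ≤ 1 / 2) (hk0 : 0 ≤ k)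
    (hk : ∀ y, 0 ≤ y → |f y - f l| ≤ k * |y - l|) (w : E) {u v : E}
    (hv : (u, v) ∈ (funCalc A f).graph) :
    ‖⟪v, w⟫_ℂ - f l * ⟪u, w⟫_ℂ‖ ≤ ‖u‖ * ((4 * k + 12 * B) * ‖T w - ((1 + l)⁻¹ : ℝ) • w‖) :=
  h.norm_inner_sub_le hf hB hl0 hl hk0 hk w (fun _ => h.compactCalc_inner_comm _ _ _)
    (mem_graph_funCalc.1 hv)

/-- Pairing of `√A u` with `T w`, for a quasimode `w` of the resolvent `T` at `(1 + l)⁻¹`. -/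
theorem norm_inner_sqrt_sub_le (h : IsNonnegResolvent A T) {l : ℝ} (hl0 : 0 < l) (hl : l ≤ 1 / 2)
    (w : E) {u v : E} (hv : (u, v) ∈ (funCalc A Real.sqrt).graph) :
    ‖⟪v, T w⟫_ℂ - (√l / (1 + l) : ℝ) * ⟪u, w⟫_ℂ‖ ≤
      ‖u‖ * ((4 * (√l)⁻¹ + 12) * ‖T w - ((1 + l)⁻¹ : ℝ) • w‖) := by
  -- `√y / (1 + |y|)` is the continuous extension to the line of the relevant function.
  have hf : Continuous fun y : ℝ => √y / (1 + |y|) :=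
    Real.continuous_sqrt.div (by fun_prop) fun y => by positivity
  have hval : (fun y : ℝ => √y / (1 + |y|)) l = √l / (1 + l) := by simp [abs_of_pos hl0]
  rw [← hval, show (12 : ℝ) = 12 * 1 by norm_num]
  refine h.norm_inner_sub_le (z := T w) hf ?_ hl0.le hl (by positivity) ?_ w (fun n => ?_)
    (mem_graph_funCalc.1 hv)
  · intro y hy
    rw [abs_of_nonneg (by positivity), div_le_one (by positivity), abs_of_nonneg hy]
    exact Real.sqrt_le_iff.2 ⟨by positivity, by nlinarith⟩
  · intro y hy
    refine le_trans ?_ (abs_sqrt_sub_sqrt_le y hl0)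
    rw [abs_of_nonneg hy, abs_of_pos hl0]
    have h1 : √y / (1 + y) - √l / (1 + l) =
        (√y - √l) * ((1 - √y * √l) / ((1 + y) * (1 + l))) := by
      have hy2 := Real.sq_sqrt hy
      have hl2 := Real.sq_sqrt hl0.le
      rw [div_sub_div _ _ (by positivity) (by positivity), mul_div_assoc']
      congr 1
      linear_combination (√l) * hy2 - (√y) * hl2
    rw [h1, abs_mul]
    refine mul_le_of_le_one_right (abs_nonneg _) ?_
    rw [abs_div, abs_of_pos (by positivity : 0 < (1 + y) * (1 + l)), div_le_one (by positivity)]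
    have h3 : √y * √l ≤ y + l := by
      nlinarith [Real.sq_sqrt hy, Real.sq_sqrt hl0.le, sq_nonneg (√y - √l),
        Real.sqrt_nonneg y, Real.sqrt_nonneg l]
    have h4 : 0 ≤ √y * √l := by positivity
    rw [abs_le]
    constructor <;> nlinarith [mul_nonneg hy hl0.le]
  · rw [h.compactCalc_inner_comm]
    congr 1
    rw [h.compactCalc_eq, h.compactCalc_eq, ← mul_apply_eq_comp]
    congr 1
    have hid : cfc (fun x : ℝ => x) T = T := cfc_id' ℝ T h.isSelfAdjoint
    have hc := continuous_resFun_cutoff_mul Real.continuous_sqrt n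
    have hmul := cfc_mul (resFun fun y => cutoff n y * √y) (fun x => x) T hc.continuousOn
      continuousOn_id
    rw [hid] at hmul
    rw [← hmul]
    refine cfc_congr fun x hx => ?_
    simp only [resFun]
    split_ifs with h0
    · have hy := h.inv_sub_one_nonneg hx h0
      rw [abs_of_nonneg hy]
      field_simp
      ring_nf
    · simp

theorem compactCalc_mul (h : IsNonnegResolvent A T) {φ ψ : ℝ → ℝ} (hφ : Continuous (resFun φ))
    (hψ : Continuous (resFun ψ)) (u : E) :
    compactCalc A φ (compactCalc A ψ u) = compactCalc A (fun y => φ y * ψ y) u := by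
  simp only [h.compactCalc_eq]
  rw [← mul_apply_eq_comp, ← cfc_mul _ _ T hφ.continuousOn hψ.continuousOn]
  congr 1
  refine cfc_congr fun x _ => ?_
  simp only [resFun]
  split_ifs <;> simp

/-- `g(A) f(A) u = (g f)(A) u` whenever `f(A) u` and `(g f)(A) u` exist. -/
theorem mem_graph_funCalc_mul (h : IsNonnegResolvent A T) {f g : ℝ → ℝ} (hf : Continuous f)
    (hg : Continuous g) {u v w : E} (hv : (u, v) ∈ (funCalc A f).graph)
    (hw : (u, w) ∈ (funCalc A fun y => g y * f y).graph) : (v, w) ∈ (funCalc A g).graph := by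
  rw [mem_graph_funCalc] at hv hw ⊢
  refine hw.congr fun n => ?_
  have h1 := ((compactCalc A fun y => cutoff n y * g y).continuous.tendsto v).comp hv
  refine tendsto_nhds_unique_of_eventuallyEq tendsto_const_nhds h1 ?_
  filter_upwards [eventually_ge_atTop (n + 1)] with m hm
  change _ = compactCalc A (fun y => cutoff n y * g y) (compactCalc A (fun y => cutoff m y * f y) u)
  rw [h.compactCalc_mul (continuous_resFun_cutoff_mul hg n) (continuous_resFun_cutoff_mul hf m)]
  congr 2
  ext y
  linear_combination (-(g y * f y)) * cutoff_mul_cutoff hm y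

/-- `Dom X` is contained in the domain of `(X* X)^(1/2)`. -/
theorem exists_mem_graph_sqrt {F : Type*} [NormedAddCommGroup F] [InnerProductSpace ℂ F]
    [CompleteSpace F] {X : E →ₗ.[ℂ] F} (h : IsNonnegResolvent A T) (hT : IsFormResolvent X T)
    {u : E} {u' : F} (hu : (u, u') ∈ X.graph) : ∃ v, (u, v) ∈ (funCalc A Real.sqrt).graph := by
  have hG : ∀ n, Continuous (resFun fun y => cutoff n y * (cutoff n y * |y|)) :=
    fun n => continuous_resFun_cutoff_mul ((continuous_cutoff n).mul continuous_abs) n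
  have hlim := h.exists_tendsto (u := u) (b := ‖u‖ ^ 2 + ‖u'‖ ^ 2)
    (continuous_resFun_cutoff_mul Real.continuous_sqrt) hG ?_ ?_
  · obtain ⟨v, hv⟩ := hlim
    exact ⟨v, mem_graph_funCalc.2 hv⟩
  · intro n m hnm y hy
    have h1 := cutoff_mono hnm y
    have h2 := cutoff_nonneg n y
    rw [← sub_mul, mul_pow, Real.sq_sqrt hy, abs_of_nonneg hy]
    nlinarith [mul_nonneg hy (mul_nonneg h2 (sub_nonneg.2 h1))]
  · intro n
    set z := compactCalc A (fun y => cutoff n y * (cutoff n y * |y|)) u with hz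
    set a := (⟪u, z⟫_ℂ).re with ha
    have h1 := hT.norm_inner_sq_le hu z
    have h2 : a ^ 2 ≤ ‖⟪u, z⟫_ℂ‖ ^ 2 := by
      rw [← sq_abs]; exact pow_le_pow_left₀ (abs_nonneg _) (Complex.abs_re_le_norm _) 2
    -- `⟪z, T z⟫ ≤ a`, because `g² / (1 + y) ≤ g` for `g = χₙ² y`.
    have h3 : (⟪z, T z⟫_ℂ).re ≤ a := by
      have hid : cfc (fun x : ℝ => x) T = T := cfc_id' ℝ T h.isSelfAdjoint
      have hGn := hG n
      have hxG : Continuous fun x => x * resFun (fun y => cutoff n y * (cutoff n y * |y|)) x := by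
        fun_prop
      have h4 : ⟪z, T z⟫_ℂ = ⟪u, cfc (fun x => resFun (fun y => cutoff n y * (cutoff n y * |y|)) x *
          (x * resFun (fun y => cutoff n y * (cutoff n y * |y|)) x)) T u⟫_ℂ := by
        rw [cfc_mul _ _ T hGn.continuousOn hxG.continuousOn,
          cfc_mul (fun x => x) _ T continuousOn_id hGn.continuousOn, hid, mul_apply_eq_comp,
          mul_apply_eq_comp, ← h.compactCalc_eq, ← h.compactCalc_inner_comm]
      rw [h4, ha, hz, h.compactCalc_eq]
      refine re_inner_cfc_mono (by fun_prop) hGn (fun x hx => ?_) u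
      simp only [resFun]
      split_ifs with h0
      · have hy := h.inv_sub_one_nonneg hx h0
        have c0 := cutoff_nonneg n (x⁻¹ - 1)
        have c1 := cutoff_le_one n (x⁻¹ - 1)
        rw [abs_of_nonneg hy]
        have h5 : x * (x⁻¹ - 1) ≤ 1 := by
          rw [mul_sub, mul_inv_cancel₀ h0.ne']; linarith
        have h6 : 0 ≤ x * (x⁻¹ - 1) := mul_nonneg h0.le hy
        have h7 : cutoff n (x⁻¹ - 1) * (cutoff n (x⁻¹ - 1) * (x * (x⁻¹ - 1))) ≤ 1 := by
          refine mul_le_one₀ c1 (by positivity) (mul_le_one₀ c1 h6 h5)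
        have h8 : 0 ≤ cutoff n (x⁻¹ - 1) * (cutoff n (x⁻¹ - 1) * (x⁻¹ - 1)) := by positivity
        calc _ = cutoff n (x⁻¹ - 1) * (cutoff n (x⁻¹ - 1) * (x⁻¹ - 1)) *
              (cutoff n (x⁻¹ - 1) * (cutoff n (x⁻¹ - 1) * (x * (x⁻¹ - 1)))) := by ring
          _ ≤ _ := mul_le_of_le_one_right h8 h7
      · simp
    by_contra! hc
    have hQ : 0 ≤ ‖u‖ ^ 2 + ‖u'‖ ^ 2 := by positivity
    nlinarith

end IsNonnegResolvent

end FunCalc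

/-! ### The spectral gap and weak solutions -/

section SpectralGap

variable {E F : Type*}
  [NormedAddCommGroup E] [InnerProductSpace ℂ E] [CompleteSpace E]
  [NormedAddCommGroup F] [InnerProductSpace ℂ F] [CompleteSpace F]

/-- A nonzero `x` is in the resolvent set of `(A + 1)⁻¹` when `1 / x - 1` is in that of `A`. -/
theorem isUnit_sub_of_isResolventAt {A : E →ₗ.[ℂ] E} {T B : E →L[ℂ] E} {x : ℝ} (hx : x ≠ 0)
    (hT : IsResolventAt A (-1) T) (hB : IsResolventAt A ((x⁻¹ - 1 : ℝ) : ℂ) B) :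
    IsUnit (algebraMap ℝ (E →L[ℂ] E) x - T) := by
  have hxc : (x : ℂ) ≠ 0 := by exact_mod_cast hx
  -- the two forms of the resolvent identity
  have h1 : ∀ u, T (B u) = (x : ℂ) • (B u - T u) := fun u => by
    have h := hT.apply_of_mem_graph (hB.mem_graph u)
    have h' : u + ((x⁻¹ - 1 : ℝ) : ℂ) • B u - (-1 : ℂ) • B u = u + (x : ℂ)⁻¹ • B u := by
      push_cast; module
    rw [h', map_add, map_smul] at h
    rw [← eq_sub_of_add_eq' h, smul_smul, mul_inv_cancel₀ hxc, one_smul]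
  have h2 : ∀ u, B (T u) = (x : ℂ) • (B u - T u) := fun u => by
    have h := hB.apply_of_mem_graph (hT.mem_graph u)
    have h' : u + (-1 : ℂ) • T u - ((x⁻¹ - 1 : ℝ) : ℂ) • T u = u - (x : ℂ)⁻¹ • T u := by
      push_cast; module
    rw [h', map_sub, map_smul] at h
    have h3 : (x : ℂ)⁻¹ • B (T u) = B u - T u :=
      eq_sub_of_add_eq (sub_eq_iff_eq_add'.1 h).symm
    rw [← h3, smul_smul, mul_inv_cancel₀ hxc, one_smul]
  have hx1 : (x : ℂ)⁻¹ * x = 1 := inv_mul_cancel₀ hxc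
  have halg : algebraMap ℝ (E →L[ℂ] E) x = (x : ℂ) • 1 := by
    rw [Algebra.algebraMap_eq_smul_one, Complex.coe_smul]
  refine ⟨⟨_, (x : ℂ)⁻¹ • (1 + (x : ℂ)⁻¹ • B), ?_, ?_⟩, rfl⟩
  · ext u
    simp only [halg, mul_apply_eq_comp, _root_.sub_apply, _root_.smul_apply, _root_.add_apply,
      one_apply_eq_self, map_smul, map_add, h1]
    match_scalars <;> field_simp <;> simp
  · ext u
    simp only [halg, mul_apply_eq_comp, _root_.sub_apply, _root_.smul_apply, _root_.add_apply,
      one_apply_eq_self, map_smul, map_sub, h2]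
    match_scalars <;> field_simp <;> simp

/-- If `0` is an isolated point of the spectrum of `X* X`, then the form `‖X v‖²` is coercive on the
orthogonal complement of `Ker X`. -/
theorem exists_gap [Nontrivial E] {X : E →ₗ.[ℂ] F} (hd : Dense (X.domain : Set E))
    (hc : X.IsClosed) {d : ℝ} (hd0 : 0 < d)
    (hiso : ∀ z ∈ pspectrum (pcomp X† X), ‖z‖ < d → z = 0) :
    ∃ δ > 0, ∀ v v', (v, v') ∈ X.graph → v ∈ (pker X)ᗮ → δ * ‖v‖ ^ 2 ≤ ‖v'‖ ^ 2 := by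
  obtain ⟨T, hT⟩ := exists_isResolventAt X hd hc
  have hF := hT.isFormResolvent hd
  have hsa := hF.isSelfAdjoint
  set δ : ℝ := d / (1 + d) with hδ
  have hδ0 : 0 < δ := by positivity
  have hδ1 : δ < 1 := by rw [hδ, div_lt_one (by positivity)]; linarith
  have hspec : ∀ x ∈ spectrum ℝ T, x ≤ 1 - δ ∨ x = 1 := by
    intro x hx
    have hx1 := (hF.spectrum_subset hx).2
    by_contra! hcon
    have hlt : x < 1 := lt_of_le_of_ne hx1 hcon.2
    have h1 : 1 - δ = (1 + d)⁻¹ := by rw [hδ]; field_simp; ring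
    have hxp : 0 < x := by linarith [hcon.1]
    have h2 : x⁻¹ < 1 + d := by
      rw [inv_lt_comm₀ hxp (by positivity), ← h1]; exact hcon.1
    have h3 : 1 < x⁻¹ := (one_lt_inv₀ hxp).2 hlt
    have h4 : ((x⁻¹ - 1 : ℝ) : ℂ) ∉ pspectrum (pcomp X† X) := by
      intro hmem
      have := hiso _ hmem (by
        rw [Complex.norm_real, Real.norm_of_nonneg (by linarith)]; linarith)
      have h5 : x⁻¹ - 1 = 0 := by exact_mod_cast this
      linarith
    obtain ⟨B, hB⟩ := not_not.1 h4
    exact hx (isUnit_sub_of_isResolventAt hxp.ne' hT hB)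
  have hQ : cfc (fun x : ℝ => 1 - x) T = 1 - T := by
    rw [cfc_sub (fun _ => (1 : ℝ)) (fun x => x) T, cfc_const 1 T, cfc_id' ℝ T, map_one]
  have hcomm : ∀ a b, ⟪(1 - T) a, b⟫_ℂ = ⟪a, (1 - T) b⟫_ℂ := by
    rw [← hQ]; exact cfc_inner_comm _ T
  -- `Q = 1 - T` satisfies `Q³ ≥ δ Q²`, which is the claim for vectors in the range of `Q`.
  have hrange : ∀ u, δ * ‖(1 - T) u‖ ^ 2 ≤ (⟪(1 - T) u, (1 - T) ((1 - T) u)⟫_ℂ).re := by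
    intro u
    have h1 : δ * ‖(1 - T) u‖ ^ 2 =
        (⟪u, cfc (fun x : ℝ => δ * ((1 - x) * (1 - x))) T u⟫_ℂ).re := by
      rw [cfc_const_mul δ _ T, ← hQ, norm_cfc_apply_sq (by fun_prop),
        _root_.smul_apply, ← Complex.coe_smul, inner_smul_right, Complex.re_ofReal_mul]
    have h2 : (⟪(1 - T) u, (1 - T) ((1 - T) u)⟫_ℂ).re =
        (⟪u, cfc (fun x : ℝ => (1 - x) * ((1 - x) * (1 - x))) T u⟫_ℂ).re := by
      rw [cfc_mul (fun x : ℝ => 1 - x) _ T, cfc_mul (fun x : ℝ => 1 - x) _ T, hQ,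
        mul_apply_eq_comp, mul_apply_eq_comp, hcomm]
    rw [h1, h2]
    refine re_inner_cfc_mono (by fun_prop) (by fun_prop) (fun x hx => ?_) u
    rcases hspec x hx with h | h
    · have := sq_nonneg (1 - x)
      nlinarith
    · simp [h]
  have hQsa : (1 - T).adjoint = 1 - T := by
    rw [← hQ]; exact IsSelfAdjoint.cfc (f := fun x : ℝ => 1 - x) (a := T)
  have hker : (1 - T).ker ≤ pker X := by
    intro u hu
    have hu' : T u = u := by
      have : u - T u = 0 := hu
      exact (sub_eq_zero.1 this).symm
    obtain ⟨w, hw, h, -⟩ := hF.exists_re_inner u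
    rw [hu'] at h hw
    have h3 : (⟪u, u⟫_ℂ).re = ‖u‖ ^ 2 := inner_self_eq_norm_sq (𝕜 := ℂ) u
    have h4 : w = 0 := by
      rw [← norm_eq_zero]
      have : ‖w‖ ^ 2 = 0 := by linarith
      exact pow_eq_zero_iff two_ne_zero |>.1 this
    rw [h4] at hw
    exact mem_pker.2 hw
  have hperp : ∀ v ∈ (pker X)ᗮ, δ * ‖v‖ ^ 2 ≤ (⟪v, (1 - T) v⟫_ℂ).re := by
    intro v hv
    have h1 : v ∈ ((1 - T).range).topologicalClosure := by
      have := Submodule.orthogonal_le hker hv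
      rwa [ContinuousLinearMap.orthogonal_ker, hQsa] at this
    have hcl : IsClosed {v : E | δ * ‖v‖ ^ 2 ≤ (⟪v, (1 - T) v⟫_ℂ).re} :=
      isClosed_le (by fun_prop) (Complex.continuous_re.comp (by fun_prop))
    refine closure_minimal ?_ hcl h1
    rintro _ ⟨u, rfl⟩
    exact hrange u
  refine ⟨δ, hδ0, fun v v' hv hvk => ?_⟩
  have h1 := hF.norm_inner_sq_le hv v
  have h2 := hperp v hvk
  have h3 : (⟪v, v⟫_ℂ).re = ‖v‖ ^ 2 := inner_self_eq_norm_sq (𝕜 := ℂ) v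
  have h4 : (⟪v, (1 - T) v⟫_ℂ).re = ‖v‖ ^ 2 - (⟪v, T v⟫_ℂ).re := by
    rw [_root_.sub_apply, inner_sub_right, Complex.sub_re, one_apply_eq_self, h3]
  have h5 : ‖⟪v, v⟫_ℂ‖ = ‖v‖ ^ 2 := by
    rw [inner_self_eq_norm_sq_to_K]; simp
  rw [h5] at h1
  rcases (sq_nonneg ‖v‖).eq_or_lt with h0 | h0
  · rw [← h0, mul_zero]; positivity
  · have h6 : ‖v‖ ^ 2 ≤ (‖v‖ ^ 2 + ‖v'‖ ^ 2) * (1 - δ) := by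
      have h7 : (⟪v, T v⟫_ℂ).re ≤ (1 - δ) * ‖v‖ ^ 2 := by linarith
      have h8 : (‖v‖ ^ 2) ^ 2 ≤ ((‖v‖ ^ 2 + ‖v'‖ ^ 2) * (1 - δ)) * ‖v‖ ^ 2 := by
        refine h1.trans ?_
        rw [mul_assoc]; gcongr
      nlinarith
    nlinarith [sq_nonneg ‖v'‖]

/-- A pseudo-inverse `G` of `X` together with the orthogonal projection `Q` onto the range of `X`,
when `X` is bounded below on the orthogonal complement of its kernel. -/
theorem exists_pseudoinverse {X : E →ₗ.[ℂ] F} (hc : X.IsClosed) {δ : ℝ} (hδ : 0 < δ)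
    (hgap : ∀ v v', (v, v') ∈ X.graph → v ∈ (pker X)ᗮ → δ * ‖v‖ ^ 2 ≤ ‖v'‖ ^ 2) :
    ∃ (G : F →L[ℂ] E) (Q : F →L[ℂ] F), (∀ g, (G g, Q g) ∈ X.graph ∧ G g ∈ (pker X)ᗮ) ∧
      ∀ v v', (v, v') ∈ X.graph → (∀ g, ⟪v', Q g⟫_ℂ = ⟪v', g⟫_ℂ) ∧
        ∀ h ∈ (pker X)ᗮ, ⟪G v', h⟫_ℂ = ⟪v, h⟫_ℂ := by
  have hcp : CompleteSpace (pker X) := (isClosed_pker hc).completeSpace_coe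
  let Y : Submodule ℂ (E × F) := X.graph ⊓ ((pker X)ᗮ).comap (LinearMap.fst ℂ E F)
  have hYc : IsClosed (Y : Set (E × F)) :=
    IsClosed.inter hc ((Submodule.isClosed_orthogonal _).preimage continuous_fst)
  have : CompleteSpace Y := hYc.completeSpace_coe
  let q : Y →L[ℂ] F := (ContinuousLinearMap.snd ℂ E F) ∘L Y.subtypeL
  let C : NNReal := ⟨(√δ)⁻¹ + 1, by positivity⟩
  have hanti : AntilipschitzWith C q := by
    refine ContinuousLinearMap.antilipschitz_of_bound _ fun y => ?_
    have h1 := hgap y.1.1 y.1.2 y.2.1 y.2.2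
    have hs : 0 < √δ := Real.sqrt_pos.2 hδ
    have h2 : √δ * ‖y.1.1‖ ≤ ‖y.1.2‖ := by
      apply le_of_sq_le_sq _ (norm_nonneg _)
      rw [mul_pow, Real.sq_sqrt hδ.le]; exact h1
    have h3 : ‖y.1.1‖ ≤ (√δ)⁻¹ * ‖y.1.2‖ := by
      rw [inv_mul_eq_div, le_div_iff₀ hs, mul_comm]; exact h2
    change max ‖y.1.1‖ ‖y.1.2‖ ≤ ((√δ)⁻¹ + 1) * ‖y.1.2‖
    have h4 : 0 ≤ (√δ)⁻¹ * ‖y.1.2‖ := by positivity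
    refine max_le ?_ ?_ <;> nlinarith [norm_nonneg y.1.2]
  have hcl : IsClosed (Set.range q) := hanti.isClosed_range q.uniformContinuous
  let e := q.equivRange hanti.injective hcl
  have : CompleteSpace q.range := hcl.completeSpace_coe
  have hq : ∀ y : q.range, q (e.symm y) = y := fun y => by
    have h1 : e (e.symm y) = y := e.apply_symm_apply y
    exact congrArg Subtype.val h1
  refine ⟨(ContinuousLinearMap.fst ℂ E F) ∘L Y.subtypeL ∘L (e.symm : q.range →L[ℂ] Y) ∘L
    q.range.orthogonalProjectionOnto, q.range.starProjection, fun g => ?_, fun v v' hv => ?_⟩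
  · have h1 := hq (q.range.orthogonalProjectionOnto g)
    have h2 := (e.symm (q.range.orthogonalProjectionOnto g)).2
    refine ⟨?_, h2.2⟩
    have h3 := h2.1
    rw [Submodule.starProjection_apply, ← h1]
    exact h3
  · set u := v - (pker X).starProjection v with hu
    have huk : u ∈ (pker X)ᗮ := Submodule.sub_starProjection_mem_orthogonal v
    have hug : (u, v') ∈ X.graph := by
      have := X.graph.sub_mem hv (mem_pker.1 (Submodule.starProjection_apply_mem (pker X) v))
      simpa using this
    let y : Y := ⟨(u, v'), hug, huk⟩
    have hv' : v' ∈ q.range := ⟨y, rfl⟩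
    refine ⟨fun g => ?_, fun h hh => ?_⟩
    · rw [← Submodule.inner_starProjection_left_eq_right, Submodule.starProjection_eq_self_iff.2 hv']
    · have h1 : e.symm (q.range.orthogonalProjectionOnto v') = y := by
        rw [ContinuousLinearEquiv.symm_apply_eq]
        refine Subtype.ext ?_
        change q.range.starProjection v' = v'
        exact Submodule.starProjection_eq_self_iff.2 hv'
      change ⟪(e.symm (q.range.orthogonalProjectionOnto v')).1.1, h⟫_ℂ = _
      rw [h1]
      change ⟪u, h⟫_ℂ = _
      rw [hu, inner_sub_left, sub_eq_self]
      exact hh _ (Submodule.starProjection_apply_mem (pker X) v)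

end SpectralGap

/-! ### The pencil and its correctors -/

namespace Pencil

variable {H K : Type*} [NormedAddCommGroup H] [InnerProductSpace ℂ H] [CompleteSpace H]
  [NormedAddCommGroup K] [InnerProductSpace ℂ K] [CompleteSpace K] {p : Pencil H K}

section Basic

theorem mem_graph_X {t : ℝ} {u : H} {w : K} :
    (u, w) ∈ (p.X t).graph ↔ (u, w - (t : ℂ) • p.X₁ u) ∈ p.X₀.graph := by
  simp only [LinearPMap.mem_graph_iff]
  constructor
  · rintro ⟨y, rfl, rfl⟩
    exact ⟨y, rfl, by rw [eq_sub_iff_add_eq']; rfl⟩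
  · rintro ⟨y, rfl, h⟩
    exact ⟨y, rfl, by rw [eq_sub_iff_add_eq'] at h; exact h⟩

theorem X_zero (p : Pencil H K) : p.X 0 = p.X₀ := by
  apply LinearPMap.eq_of_eq_graph
  ext ⟨u, w⟩
  rw [mem_graph_X]
  simp

theorem dense_X (p : Pencil H K) (t : ℝ) : Dense ((p.X t).domain : Set H) := p.dense_domain

theorem isClosed_X (p : Pencil H K) (t : ℝ) : (p.X t).IsClosed := by
  have h : ((p.X t).graph : Set (H × K)) =
      (fun x : H × K => (x.1, x.2 - (t : ℂ) • p.X₁ x.1)) ⁻¹' (p.X₀.graph : Set (H × K)) := by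
    ext ⟨u, w⟩; exact mem_graph_X
  change IsClosed ((p.X t).graph : Set (H × K))
  rw [h]
  exact IsClosed.preimage (by fun_prop) p.isClosed

theorem exists_resolvent [Nontrivial H] (p : Pencil H K) (t : ℝ) :
    ∃ T : H →L[ℂ] H, IsFormResolvent (p.X t) T ∧ IsNonnegResolvent (p.A t) T := by
  obtain ⟨T, hT⟩ := exists_isResolventAt (p.X t) (p.dense_X t) (p.isClosed_X t)
  have hF := hT.isFormResolvent (p.dense_X t)
  exact ⟨T, hF, presolvent_eq hT, hF.isSelfAdjoint, hF.spectrum_subset⟩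

theorem Admissible.nontrivial (hp : p.Admissible) : Nontrivial H := by
  obtain ⟨u, -, hu⟩ := Submodule.exists_mem_ne_zero_of_ne_bot hp.ker_ne_bot
  exact ⟨u, 0, hu⟩

theorem mem_kerX {u : H} : u ∈ p.kerX ↔ (u, (0 : K)) ∈ p.X₀.graph := mem_pker

theorem isWeakSol_iff {g : K} {h φ : H} : p.IsWeakSol g h φ ↔ φ ∈ p.kerXᗮ ∧
    ∃ f, (φ, f) ∈ p.X₀.graph ∧ ∀ v v', (v, v') ∈ p.X₀.graph → ⟪v', f + g⟫_ℂ = ⟪v, h⟫_ℂ := by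
  refine and_congr_right fun _ => ⟨?_, ?_⟩
  · rintro ⟨hφ, h1⟩
    refine ⟨_, p.X₀.mem_graph ⟨φ, hφ⟩, fun v v' hv => ?_⟩
    obtain ⟨x, rfl, rfl⟩ := (LinearPMap.mem_graph_iff _).1 hv
    exact h1 x
  · rintro ⟨f, hf, h1⟩
    obtain ⟨x, rfl, rfl⟩ := (LinearPMap.mem_graph_iff _).1 hf
    exact ⟨x.2, fun v => h1 _ _ (p.X₀.mem_graph v)⟩

theorem IsWeakSol.unique {g : K} {h φ φ' : H} (h1 : p.IsWeakSol g h φ) (h2 : p.IsWeakSol g h φ') :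
    φ = φ' := by
  obtain ⟨hφ, f, hf, e⟩ := isWeakSol_iff.1 h1
  obtain ⟨hφ', f', hf', e'⟩ := isWeakSol_iff.1 h2
  have hd := p.X₀.graph.sub_mem hf hf'
  have h3 : ⟪f - f', f - f'⟫_ℂ = 0 := by
    have h4 := e _ _ hd
    have h5 := e' _ _ hd
    rw [← h5, ← sub_eq_zero, ← inner_sub_right, add_sub_add_right_eq_sub] at h4
    exact h4
  rw [inner_self_eq_zero] at h3
  have h4 : φ - φ' ∈ p.kerX := by
    rw [mem_kerX, ← h3]; exact hd
  have h5 : ⟪φ - φ', φ - φ'⟫_ℂ = 0 := p.kerXᗮ.sub_mem hφ hφ' _ h4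
  exact sub_eq_zero.1 (inner_self_eq_zero.1 h5)

/-- Bounded solution operators of the weak problem `X₀* (X₀ φ + B u) = D u`. -/
theorem Admissible.exists_solution (hp : p.Admissible) (B : H →L[ℂ] K) (D : H →L[ℂ] H)
    (hD : ∀ u, D u ∈ p.kerXᗮ) : ∃ (L : H →L[ℂ] H) (M : H →L[ℂ] K), ∀ u,
      (L u, M u) ∈ p.X₀.graph ∧ L u ∈ p.kerXᗮ ∧
        ∀ v v', (v, v') ∈ p.X₀.graph → ⟪v', M u + B u⟫_ℂ = ⟪v, D u⟫_ℂ := by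
  have := hp.nontrivial
  obtain ⟨-, d, hd, hiso⟩ := hp.zero_isolated
  unfold A at hiso
  rw [X_zero] at hiso
  obtain ⟨δ, hδ, hgap⟩ := exists_gap p.dense_domain p.isClosed hd hiso
  obtain ⟨G, Q, h1, h2⟩ := exists_pseudoinverse p.isClosed hδ hgap
  refine ⟨G ∘L (G.adjoint ∘L D - B), Q ∘L (G.adjoint ∘L D - B),
    fun u => ⟨(h1 _).1, (h1 _).2, fun v v' hv => ?_⟩⟩
  obtain ⟨h3, h4⟩ := h2 v v' hv
  rw [inner_add_right, ContinuousLinearMap.comp_apply, h3, ← inner_add_right, _root_.sub_apply,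
    sub_add_cancel, ContinuousLinearMap.comp_apply, ContinuousLinearMap.adjoint_inner_right,
    h4 _ (hD u)]

theorem Admissible.exists_isWeakSol (hp : p.Admissible) (g : K) {h : H} (hh : h ∈ p.kerXᗮ) :
    ∃ φ f, φ ∈ p.kerXᗮ ∧ (φ, f) ∈ p.X₀.graph ∧
      ∀ v v', (v, v') ∈ p.X₀.graph → ⟪v', f + g⟫_ℂ = ⟪v, h⟫_ℂ := by
  have := hp.nontrivial
  obtain ⟨-, d, hd, hiso⟩ := hp.zero_isolated
  unfold A at hiso
  rw [X_zero] at hiso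
  obtain ⟨δ, hδ, hgap⟩ := exists_gap p.dense_domain p.isClosed hd hiso
  obtain ⟨G, Q, h1, h2⟩ := exists_pseudoinverse p.isClosed hδ hgap
  refine ⟨G (G.adjoint h - g), Q (G.adjoint h - g), (h1 _).2, (h1 _).1, fun v v' hv => ?_⟩
  obtain ⟨h3, h4⟩ := h2 v v' hv
  rw [inner_add_right, h3, ← inner_add_right, sub_add_cancel,
    ContinuousLinearMap.adjoint_inner_right, h4 _ hh]

theorem Admissible.isWeakSol_solve (hp : p.Admissible) (B : H →L[ℂ] K) (D : H →L[ℂ] H)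
    (hD : ∀ u, D u ∈ p.kerXᗮ) (u : H) : p.IsWeakSol (B u) (D u) (p.solve B D u) := by
  obtain ⟨L, M, h⟩ := hp.exists_solution B D hD
  have hex : ∃ L : H →L[ℂ] H, ∀ u, p.IsWeakSol (B u) (D u) (L u) :=
    ⟨L, fun u => isWeakSol_iff.2 ⟨(h u).2.1, M u, (h u).1, (h u).2.2⟩⟩
  rw [solve, dif_pos hex]
  exact hex.choose_spec u

theorem Admissible.solve_spec (hp : p.Admissible) (B : H →L[ℂ] K) (D : H →L[ℂ] H)
    (hD : ∀ u, D u ∈ p.kerXᗮ) (u : H) :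
    (p.solve B D u, bcomp p.X₀ (p.solve B D) u) ∈ p.X₀.graph ∧ p.solve B D u ∈ p.kerXᗮ ∧
      ∀ v v', (v, v') ∈ p.X₀.graph → ⟪v', bcomp p.X₀ (p.solve B D) u + B u⟫_ℂ = ⟪v, D u⟫_ℂ := by
  obtain ⟨L, M, h⟩ := hp.exists_solution B D hD
  have hL : p.solve B D = L := by
    ext u
    exact (hp.isWeakSol_solve B D hD u).unique
      (isWeakSol_iff.2 ⟨(h u).2.1, M u, (h u).1, (h u).2.2⟩)
  have hM : bcomp p.X₀ (p.solve B D) = M := bcomp_eq fun u => by rw [hL]; exact (h u).1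
  rw [hM, hL]
  exact h u

end Basic

section Correctors

theorem P_of_mem {u : H} (hu : u ∈ p.kerX) : p.P u = u := Submodule.starProjection_eq_self_iff.2 hu

theorem P_mem (u : H) : p.P u ∈ p.kerX := Submodule.starProjection_apply_mem _ u

theorem P_P (u : H) : p.P (p.P u) = p.P u := P_of_mem (P_mem u)

theorem inner_P (u v : H) : ⟪p.P u, v⟫_ℂ = ⟪u, p.P v⟫_ℂ :=
  Submodule.inner_starProjection_left_eq_right _ u v

theorem sub_P_mem (u : H) : u - p.P u ∈ p.kerXᗮ := Submodule.sub_starProjection_mem_orthogonal u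

theorem Admissible.Z_spec (hp : p.Admissible) (u : H) :
    (p.Z u, p.R u - p.X₁ (p.P u)) ∈ p.X₀.graph ∧ p.Z u ∈ p.kerXᗮ ∧
      ∀ v v', (v, v') ∈ p.X₀.graph → ⟪v', p.R u⟫_ℂ = 0 := by
  have h := hp.solve_spec (p.X₁ ∘L p.P) 0 (fun _ => p.kerXᗮ.zero_mem) u
  have hR : p.R u = bcomp p.X₀ p.Z u + (p.X₁ ∘L p.P) u := rfl
  rw [hR]
  refine ⟨?_, h.2.1, fun v v' hv => ?_⟩
  · rw [ContinuousLinearMap.comp_apply, add_sub_cancel_right]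
    exact h.1
  · exact (h.2.2 v v' hv).trans (inner_zero_right _)

theorem Admissible.Z_P (hp : p.Admissible) (u : H) : p.Z (p.P u) = p.Z u := by
  have h1 := hp.isWeakSol_solve (p.X₁ ∘L p.P) 0 (fun _ => p.kerXᗮ.zero_mem) (p.P u)
  have h2 := hp.isWeakSol_solve (p.X₁ ∘L p.P) 0 (fun _ => p.kerXᗮ.zero_mem) u
  simp only [ContinuousLinearMap.comp_apply, P_P] at h1 h2
  exact h1.unique h2

theorem Admissible.R_P (hp : p.Admissible) (u : H) : p.R (p.P u) = p.R u := by
  have h1 := (hp.Z_spec (p.P u)).1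
  have h2 := (hp.Z_spec u).1
  rw [hp.Z_P, P_P] at h1
  exact sub_left_injective (LinearPMap.mem_graph_snd_inj p.X₀ h1 h2 rfl)

theorem Admissible.Z₂_spec (hp : p.Admissible) (u : H) :
    (p.Z₂ u, p.R₂ u - p.X₁ (p.Z u)) ∈ p.X₀.graph ∧
    p.Z₂ u ∈ p.kerXᗮ ∧ ∀ v v', (v, v') ∈ p.X₀.graph →
      ⟪v', p.R₂ u⟫_ℂ = ⟪v, p.P (p.X₁.adjoint (p.R u)) - p.X₁.adjoint (p.R u)⟫_ℂ := by
  have hD : ∀ u, (-((1 - p.P) ∘L p.X₁.adjoint ∘L p.R)) u ∈ p.kerXᗮ := fun u => by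
    change -(p.X₁.adjoint (p.R u) - p.P (p.X₁.adjoint (p.R u))) ∈ _
    exact p.kerXᗮ.neg_mem (sub_P_mem _)
  have h := hp.solve_spec (p.X₁ ∘L p.Z) _ hD u
  have hR : p.R₂ u = bcomp p.X₀ p.Z₂ u + (p.X₁ ∘L p.Z) u := rfl
  rw [hR]
  refine ⟨?_, h.2.1, fun v v' hv => ?_⟩
  · rw [ContinuousLinearMap.comp_apply, add_sub_cancel_right]
    exact h.1
  · have := h.2.2 v v' hv
    rw [show p.P (p.X₁.adjoint (p.R u)) - p.X₁.adjoint (p.R u) =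
      -(p.X₁.adjoint (p.R u) - p.P (p.X₁.adjoint (p.R u))) by abel]
    exact this

theorem Admissible.Z₂_P (hp : p.Admissible) (u : H) : p.Z₂ (p.P u) = p.Z₂ u := by
  have hD : ∀ u, (-((1 - p.P) ∘L p.X₁.adjoint ∘L p.R)) u ∈ p.kerXᗮ := fun u => by
    change -(p.X₁.adjoint (p.R u) - p.P (p.X₁.adjoint (p.R u))) ∈ _
    exact p.kerXᗮ.neg_mem (sub_P_mem _)
  have h1 := hp.isWeakSol_solve (p.X₁ ∘L p.Z) _ hD (p.P u)
  have h2 := hp.isWeakSol_solve (p.X₁ ∘L p.Z) _ hD u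
  simp only [ContinuousLinearMap.comp_apply, _root_.neg_apply, hp.Z_P, hp.R_P] at h1 h2
  exact h1.unique h2

theorem Admissible.R₂_P (hp : p.Admissible) (u : H) : p.R₂ (p.P u) = p.R₂ u := by
  have h1 := (hp.Z₂_spec (p.P u)).1
  have h2 := (hp.Z₂_spec u).1
  rw [hp.Z₂_P, hp.Z_P] at h1
  exact sub_left_injective (LinearPMap.mem_graph_snd_inj p.X₀ h1 h2 rfl)

end Correctors

end Pencil

/-! ### The spectral germ and its perturbation `𝒩^(q)` -/

namespace Pencil

variable {H K : Type*} [NormedAddCommGroup H] [InnerProductSpace ℂ H] [CompleteSpace H]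
  [NormedAddCommGroup K] [InnerProductSpace ℂ K] [CompleteSpace K] {p : Pencil H K}

section Germ

theorem mem_kerX_of_inner_P {w : H} (h : ∀ u, ⟪p.P u, w⟫_ℂ = ⟪u, w⟫_ℂ) : w ∈ p.kerX := by
  have : p.P w = w := ext_inner_left ℂ fun u => by rw [← inner_P, h]
  rw [← this]; exact P_mem w

theorem inner_S (u w : H) : ⟪u, p.S w⟫_ℂ = ⟪p.R u, p.R w⟫_ℂ := by
  rw [S, ContinuousLinearMap.comp_apply, ContinuousLinearMap.adjoint_inner_right]

theorem inner_N (u w : H) :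
    ⟪u, p.N w⟫_ℂ = ⟪p.X₁ (p.Z u), p.R w⟫_ℂ + ⟪p.R u, p.X₁ (p.Z w)⟫_ℂ := by
  simp only [N, _root_.add_apply, ContinuousLinearMap.comp_apply, inner_add_right,
    ContinuousLinearMap.adjoint_inner_right]

theorem inner_N₁ (u w : H) : ⟪u, p.N₁ w⟫_ℂ =
    ⟪p.X₁ (p.Z₂ u), p.R w⟫_ℂ + ⟪p.R u, p.X₁ (p.Z₂ w)⟫_ℂ + ⟪p.R₂ u, p.R₂ w⟫_ℂ := by
  simp only [N₁, _root_.add_apply, ContinuousLinearMap.comp_apply, inner_add_right,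
    ContinuousLinearMap.adjoint_inner_right]

theorem isSelfAdjoint_S (p : Pencil H K) : IsSelfAdjoint p.S :=
  (ContinuousLinearMap.isPositive_adjoint_comp_self p.R).isSelfAdjoint

theorem inner_S_comm (u w : H) : ⟪p.S u, w⟫_ℂ = ⟪u, p.S w⟫_ℂ :=
  ContinuousLinearMap.isSelfAdjoint_iff_isSymmetric.1 p.isSelfAdjoint_S u w

theorem inner_N_comm (u w : H) : ⟪p.N u, w⟫_ℂ = ⟪u, p.N w⟫_ℂ := by
  rw [← inner_conj_symm, inner_N, inner_N, map_add, inner_conj_symm, inner_conj_symm, add_comm]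

theorem inner_N₁_comm (u w : H) : ⟪p.N₁ u, w⟫_ℂ = ⟪u, p.N₁ w⟫_ℂ := by
  rw [← inner_conj_symm, inner_N₁, inner_N₁, map_add, map_add, inner_conj_symm, inner_conj_symm,
    inner_conj_symm]
  ring

theorem Admissible.S_mem (hp : p.Admissible) (u : H) : p.S u ∈ p.kerX :=
  mem_kerX_of_inner_P fun v => by rw [inner_S, inner_S, hp.R_P]

theorem Admissible.N_mem (hp : p.Admissible) (u : H) : p.N u ∈ p.kerX :=
  mem_kerX_of_inner_P fun v => by rw [inner_N, inner_N, hp.R_P, hp.Z_P]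

theorem Admissible.N₁_mem (hp : p.Admissible) (u : H) : p.N₁ u ∈ p.kerX :=
  mem_kerX_of_inner_P fun v => by rw [inner_N₁, inner_N₁, hp.R_P, hp.Z₂_P, hp.R₂_P]

theorem mem_germEigenspace {γ : ℝ} {u : H} :
    u ∈ p.germEigenspace γ ↔ u ∈ p.kerX ∧ p.S u = (γ : ℂ) • u := by
  simp only [germEigenspace, Submodule.mem_inf, and_congr_right_iff]
  intro _
  change p.S u - (γ : ℂ) • u = 0 ↔ _
  exact sub_eq_zero

theorem eigProj_mem (γ : ℝ) (u : H) : p.eigProj γ u ∈ p.germEigenspace γ :=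
  Submodule.starProjection_apply_mem _ u

theorem eigProj_mem_kerX (γ : ℝ) (u : H) : p.eigProj γ u ∈ p.kerX :=
  (mem_germEigenspace.1 (eigProj_mem γ u)).1

theorem S_eigProj (γ : ℝ) (u : H) : p.S (p.eigProj γ u) = (γ : ℂ) • p.eigProj γ u :=
  (mem_germEigenspace.1 (eigProj_mem γ u)).2

theorem eigProj_of_mem {γ : ℝ} {u : H} (hu : u ∈ p.germEigenspace γ) : p.eigProj γ u = u :=
  Submodule.starProjection_eq_self_iff.2 hu

theorem inner_eigProj (γ : ℝ) (u v : H) : ⟪p.eigProj γ u, v⟫_ℂ = ⟪u, p.eigProj γ v⟫_ℂ :=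
  Submodule.inner_starProjection_left_eq_right _ u v

theorem inner_germEigenspace {γ γ' : ℝ} (h : γ ≠ γ') {u v : H} (hu : u ∈ p.germEigenspace γ)
    (hv : v ∈ p.germEigenspace γ') : ⟪u, v⟫_ℂ = 0 := by
  have h1 := inner_S_comm (p := p) u v
  rw [(mem_germEigenspace.1 hu).2, (mem_germEigenspace.1 hv).2, inner_smul_left, inner_smul_right,
    Complex.conj_ofReal, ← sub_eq_zero, ← sub_mul] at h1
  refine (mul_eq_zero.1 h1).resolve_left ?_
  rw [sub_eq_zero]
  exact_mod_cast h

theorem eigProj_of_mem_of_ne {γ γ' : ℝ} (h : γ ≠ γ') {u : H} (hu : u ∈ p.germEigenspace γ') :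
    p.eigProj γ u = 0 :=
  ext_inner_left ℂ fun v => by
    rw [← inner_eigProj, inner_germEigenspace h (eigProj_mem γ v) hu, inner_zero_right]

/-- The germ as an operator in the finite-dimensional space `𝔑`. -/
def Admissible.germ (hp : p.Admissible) : p.kerX →ₗ[ℂ] p.kerX :=
  (p.S : H →ₗ[ℂ] H).restrict fun u _ => hp.S_mem u

theorem Admissible.germ_isSymmetric (hp : p.Admissible) : hp.germ.IsSymmetric :=
  fun u v => inner_S_comm (p := p) (u : H) (v : H)

theorem Admissible.finite_germEigenvalues (hp : p.Admissible) : p.germEigenvalues.Finite := by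
  have := hp.finite_ker
  have h : ((fun γ : ℝ => (γ : ℂ)) '' p.germEigenvalues).Finite := by
    refine (Module.End.finite_hasEigenvalue hp.germ).subset ?_
    rintro _ ⟨γ, hγ, rfl⟩
    obtain ⟨u, hu, hu0⟩ := Submodule.exists_mem_ne_zero_of_ne_bot hγ
    obtain ⟨h1, h2⟩ := mem_germEigenspace.1 hu
    refine Module.End.hasEigenvalue_of_hasEigenvector (x := ⟨u, h1⟩)
      ⟨Module.End.mem_eigenspace_iff.2 (Subtype.ext h2), fun h => hu0 (congrArg Subtype.val h)⟩
  exact h.of_finite_image fun a _ b _ hab => Complex.ofReal_injective hab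

/-- The spectral decomposition of the germ. -/
theorem Admissible.sum_eigProj (hp : p.Admissible) {u : H} (hu : u ∈ p.kerX) :
    ∑ γ ∈ hp.finite_germEigenvalues.toFinset, p.eigProj γ u = u := by
  have := hp.finite_ker
  set d := u - ∑ γ ∈ hp.finite_germEigenvalues.toFinset, p.eigProj γ u with hd
  have hdk : d ∈ p.kerX :=
    p.kerX.sub_mem hu (Submodule.sum_mem _ fun γ _ => eigProj_mem_kerX γ u)
  have hperp : ∀ γ ∈ p.germEigenvalues, p.eigProj γ d = 0 := by
    intro γ hγ
    rw [hd, map_sub, map_sum, Finset.sum_eq_single γ, eigProj_of_mem (eigProj_mem γ u), sub_self]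
    · intro γ' _ hne
      exact eigProj_of_mem_of_ne hne.symm (eigProj_mem γ' u)
    · intro h
      exact absurd ((Set.Finite.mem_toFinset _).2 hγ) h
  have h0 : (⟨d, hdk⟩ : p.kerX) ∈ (⨆ μ, Module.End.eigenspace hp.germ μ)ᗮ := by
    rw [Submodule.mem_orthogonal]
    intro v hv
    refine Submodule.iSup_induction _ (motive := fun v => ⟪v, (⟨d, hdk⟩ : p.kerX)⟫_ℂ = 0) hv
      ?_ (inner_zero_left _) (fun x y hx hy => by rw [inner_add_left, hx, hy, add_zero])
    intro μ v hv
    rcases eq_or_ne v 0 with rfl | hv0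
    · exact inner_zero_left _
    have hev : Module.End.HasEigenvalue hp.germ μ :=
      Module.End.hasEigenvalue_of_hasEigenvector ⟨hv, hv0⟩
    have hμ : ((μ.re : ℝ) : ℂ) = μ :=
      Complex.conj_eq_iff_re.1 (hp.germ_isSymmetric.conj_eigenvalue_eq_self hev)
    have hvm : (v : H) ∈ p.germEigenspace μ.re := by
      refine mem_germEigenspace.2 ⟨v.2, ?_⟩
      rw [hμ]
      exact congrArg Subtype.val (Module.End.mem_eigenspace_iff.1 hv)
    have hγ : μ.re ∈ p.germEigenvalues := by
      intro hbot
      rw [hbot, Submodule.mem_bot] at hvm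
      exact hv0 (Subtype.ext hvm)
    change ⟪(v : H), d⟫_ℂ = 0
    rw [← eigProj_of_mem hvm, inner_eigProj, hperp _ hγ, inner_zero_right]
  rw [hp.germ_isSymmetric.orthogonalComplement_iSup_eigenspaces_eq_bot, Submodule.mem_bot] at h0
  exact (sub_eq_zero.1 (congrArg Subtype.val h0)).symm

theorem Admissible.eigProj_N_eigProj (hp : p.Admissible) (hN₀ : p.N₀ = 0) {γ : ℝ}
    (hγ : γ ∈ p.germEigenvalues) {u : H} (hu : u ∈ p.germEigenspace γ) :
    p.eigProj γ (p.N u) = 0 := by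
  have h1 : p.eigProj γ (p.N₀ u) = 0 := by rw [hN₀]; simp
  rw [N₀, finsum_mem_eq_finite_toFinset_sum _ hp.finite_germEigenvalues] at h1
  simp only [_root_.sum_apply, ContinuousLinearMap.comp_apply] at h1
  rw [Finset.sum_eq_single γ, eigProj_of_mem hu, eigProj_of_mem (eigProj_mem _ _)] at h1
  · exact h1
  · intro γ' _ hne
    rw [eigProj_of_mem_of_ne hne hu, map_zero, map_zero]
  · intro h
    exact absurd ((Set.Finite.mem_toFinset _).2 hγ) h

/-- The reduced resolvent `∑_{γ' ≠ γ} (γ - γ')⁻¹ P_{γ'}` of the germ at `γ`. -/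
def Admissible.redRes (hp : p.Admissible) (γ : ℝ) : H →L[ℂ] H :=
  ∑ γ' ∈ hp.finite_germEigenvalues.toFinset.erase γ, ((γ - γ' : ℝ) : ℂ)⁻¹ • p.eigProj γ'

theorem Admissible.redRes_mem (hp : p.Admissible) (γ : ℝ) (u : H) : hp.redRes γ u ∈ p.kerX := by
  rw [redRes, _root_.sum_apply]
  exact Submodule.sum_mem _ fun γ' _ => p.kerX.smul_mem _ (eigProj_mem_kerX γ' u)

theorem Admissible.inner_redRes (hp : p.Admissible) (γ : ℝ) (u v : H) :
    ⟪hp.redRes γ u, v⟫_ℂ = ⟪u, hp.redRes γ v⟫_ℂ := by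
  simp only [redRes, _root_.sum_apply, _root_.smul_apply, sum_inner, inner_sum, inner_smul_left,
    inner_smul_right, inner_eigProj, map_inv₀, Complex.conj_ofReal]

theorem Admissible.S_redRes (hp : p.Admissible) {γ : ℝ} (hγ : γ ∈ p.germEigenvalues) {u : H}
    (hu : u ∈ p.kerX) (h0 : p.eigProj γ u = 0) :
    (γ : ℂ) • hp.redRes γ u - p.S (hp.redRes γ u) = u := by
  have h1 := hp.sum_eigProj hu
  rw [← Finset.add_sum_erase _ _ ((Set.Finite.mem_toFinset _).2 hγ), h0, zero_add] at h1
  conv_rhs => rw [← h1]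
  simp only [redRes, _root_.sum_apply, _root_.smul_apply, map_sum, map_smul, Finset.smul_sum]
  rw [← Finset.sum_sub_distrib]
  refine Finset.sum_congr rfl fun γ' hγ' => ?_
  have hne : ((γ - γ' : ℝ) : ℂ) ≠ 0 := by
    have := (Finset.mem_erase.1 hγ').1
    exact_mod_cast sub_ne_zero.2 this.symm
  rw [S_eigProj, smul_smul, smul_smul, ← sub_smul, mul_comm, ← mul_sub]
  have h2 : (γ : ℂ) - γ' = ((γ - γ' : ℝ) : ℂ) := by push_cast; rfl
  rw [h2, inv_mul_cancel₀ hne, one_smul]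

theorem Admissible.germN_apply (hp : p.Admissible) (γ : ℝ) (u : H) : p.germN γ u =
    p.eigProj γ (p.N₁ (p.eigProj γ u)
      - (1 / 2 : ℂ) • p.Z.adjoint (p.Z (p.S (p.eigProj γ u)))
      - (1 / 2 : ℂ) • p.S (p.Z.adjoint (p.Z (p.eigProj γ u)))
      + p.N (hp.redRes γ (p.N (p.eigProj γ u)))) := by
  have hfin := hp.finite_germEigenvalues.subset (Set.sdiff_subset (t := {γ}))
  have hset : hfin.toFinset = hp.finite_germEigenvalues.toFinset.erase γ := by
    ext γ'
    simp [and_comm]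
  rw [germN, finsum_mem_eq_finite_toFinset_sum _ hfin, hset]
  simp only [redRes, _root_.add_apply, _root_.sub_apply, _root_.smul_apply, _root_.sum_apply,
    ContinuousLinearMap.comp_apply, map_add, map_sum, map_smul]

theorem Admissible.germN_of_mem (hp : p.Admissible) {γ : ℝ} {u : H}
    (hu : u ∈ p.germEigenspace γ) : p.germN γ u =
      p.eigProj γ (p.N₁ u - (γ : ℂ) • p.Z.adjoint (p.Z u) + p.N (hp.redRes γ (p.N u))) := by
  rw [hp.germN_apply, eigProj_of_mem hu, (mem_germEigenspace.1 hu).2]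
  have h1 : p.eigProj γ (p.S (p.Z.adjoint (p.Z u))) =
      (γ : ℂ) • p.eigProj γ (p.Z.adjoint (p.Z u)) := by
    refine ext_inner_left ℂ fun v => ?_
    rw [← inner_eigProj, ← inner_S_comm, S_eigProj, inner_smul_left, Complex.conj_ofReal,
      inner_smul_right, inner_eigProj]
  simp only [map_add, map_sub, map_smul, h1]
  module

theorem Admissible.inner_germN_comm (hp : p.Admissible) (γ : ℝ) (u v : H) :
    ⟪p.germN γ u, v⟫_ℂ = ⟪u, p.germN γ v⟫_ℂ := by
  rw [hp.germN_apply, hp.germN_apply, inner_eigProj, ← inner_eigProj γ u]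
  simp only [inner_add_left, inner_add_right, inner_sub_left, inner_sub_right, inner_smul_left,
    inner_smul_right, inner_N₁_comm, inner_N_comm, hp.inner_redRes, inner_S_comm,
    ContinuousLinearMap.adjoint_inner_left, ContinuousLinearMap.adjoint_inner_right]
  rw [← inner_S_comm (p.eigProj γ u), ContinuousLinearMap.adjoint_inner_right]
  simp only [map_div₀, map_one, map_ofNat]
  ring

/-- The nonzero self-adjoint operator `𝒩^(q)` has an eigenvector with a nonzero eigenvalue. -/
theorem Admissible.exists_eigenvector_germN (hp : p.Admissible) {γ : ℝ} (h : p.germN γ ≠ 0) :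
    ∃ (ν : ℝ) (ω : H), ν ≠ 0 ∧ ω ≠ 0 ∧ ω ∈ p.germEigenspace γ ∧ p.germN γ ω = (ν : ℂ) • ω := by
  have := hp.finite_ker
  have hle : p.germEigenspace γ ≤ p.kerX := inf_le_left
  have hfd : FiniteDimensional ℂ (p.germEigenspace γ) := Submodule.finiteDimensional_of_le hle
  let B : p.germEigenspace γ →ₗ[ℂ] p.germEigenspace γ :=
    (p.germN γ : H →ₗ[ℂ] H).restrict fun u _ => by
      change p.germN γ u ∈ _
      rw [hp.germN_apply]; exact eigProj_mem _ _
  have hB : B.IsSymmetric := fun u v => hp.inner_germN_comm γ (u : H) (v : H)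
  by_contra! hcon
  refine h ?_
  have hB0 : B = 0 := by
    refine (hB.eigenvectorBasis rfl).toBasis.ext fun i => ?_
    rw [OrthonormalBasis.coe_toBasis, hB.apply_eigenvectorBasis, LinearMap.zero_apply]
    by_cases h0 : hB.eigenvalues rfl i = 0
    · rw [h0]; simp
    · exfalso
      refine hcon _ (hB.eigenvectorBasis rfl i : p.germEigenspace γ) h0 ?_ (Subtype.coe_prop _)
        (congrArg Subtype.val (hB.apply_eigenvectorBasis rfl i))
      intro hz
      exact (hB.eigenvectorBasis rfl).toBasis.ne_zero i (by simpa using hz)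
  ext u
  have h1 : p.germN γ u = p.germN γ (p.eigProj γ u) := by
    rw [hp.germN_apply, hp.germN_apply γ (p.eigProj γ u), eigProj_of_mem (eigProj_mem γ u)]
  rw [h1]
  exact congrArg Subtype.val (LinearMap.congr_fun hB0 ⟨_, eigProj_mem γ u⟩)

end Germ

end Pencil

/-! ### Coefficients of the quasimode -/

namespace Pencil

variable {H K : Type*} [NormedAddCommGroup H] [InnerProductSpace ℂ H] [CompleteSpace H]
  [NormedAddCommGroup K] [InnerProductSpace ℂ K] [CompleteSpace K] {p : Pencil H K}

section Quasimode

theorem Admissible.inner_Z (hp : p.Admissible) {u : H} (hu : u ∈ p.kerX) (w : H) :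
    ⟪u, p.Z w⟫_ℂ = 0 := (hp.Z_spec w).2.1 u hu

theorem Admissible.inner_Z_left (hp : p.Admissible) {u : H} (hu : u ∈ p.kerX) (w : H) :
    ⟪p.Z w, u⟫_ℂ = 0 := by rw [← inner_conj_symm, hp.inner_Z hu, map_zero]

theorem Admissible.inner_R_of_mem_graph (hp : p.Admissible) (u : H) {v : H} {v' : K}
    (hv : (v, v') ∈ p.X₀.graph) : ⟪p.R u, v'⟫_ℂ = 0 := by
  rw [← inner_conj_symm, (hp.Z_spec u).2.2 v v' hv, map_zero]

theorem Admissible.Z_mem_graph (hp : p.Admissible) {u : H} (hu : u ∈ p.kerX) :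
    (p.Z u, p.R u - p.X₁ u) ∈ p.X₀.graph := by
  have := (hp.Z_spec u).1
  rwa [P_of_mem hu] at this

theorem Admissible.Z_adjoint_mem (hp : p.Admissible) (u : H) : p.Z.adjoint u ∈ p.kerX :=
  mem_kerX_of_inner_P fun v => by
    rw [ContinuousLinearMap.adjoint_inner_right, ContinuousLinearMap.adjoint_inner_right, hp.Z_P]

/-- On `𝔑` the operator `R* X₁` is the germ. -/
theorem Admissible.inner_R_X₁ (hp : p.Admissible) (u : H) {w : H} (hw : w ∈ p.kerX) :
    ⟪p.R u, p.X₁ w⟫_ℂ = ⟪u, p.S w⟫_ℂ := by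
  have h := hp.inner_R_of_mem_graph u (hp.Z_mem_graph hw)
  rw [inner_sub_right, sub_eq_zero] at h
  rw [inner_S, h]

/-- If `X₀* g = b` in the weak sense, then `⟪u, X₁* g⟫ = ⟪R u, g⟫ - ⟪Z u, b⟫` for `u ∈ 𝔑`. -/
theorem Admissible.inner_X₁_of_weak (hp : p.Admissible) {g : K} {b : H}
    (h : ∀ v v', (v, v') ∈ p.X₀.graph → ⟪v', g⟫_ℂ = ⟪v, b⟫_ℂ) {u : H} (hu : u ∈ p.kerX) :
    ⟪p.X₁ u, g⟫_ℂ = ⟪p.R u, g⟫_ℂ - ⟪p.Z u, b⟫_ℂ := by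
  rw [← h _ _ (hp.Z_mem_graph hu), inner_sub_left]
  ring

theorem Admissible.P_adjoint_X₁_R (hp : p.Admissible) (u : H) :
    p.P (p.X₁.adjoint (p.R u)) = p.S u := by
  refine ext_inner_right ℂ fun w => ?_
  rw [inner_P, ContinuousLinearMap.adjoint_inner_left, hp.inner_R_X₁ u (P_mem w), ← inner_S_comm,
    ← inner_P, P_of_mem (hp.S_mem u)]

/-- Dividing `‖X(t) u‖² ≥ c t² ‖u‖²` by `t²` on the vectors `u = ω + t Z ω`, `ω ∈ 𝔑`, and letting
`t → 0`, one gets `S ≥ c I`. -/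
theorem Admissible.germEigenvalue_pos (hp : p.Admissible) {γ : ℝ} (hγ : γ ∈ p.germEigenvalues) :
    0 < γ := by
  obtain ⟨ω, hω, hω0⟩ := Submodule.exists_mem_ne_zero_of_ne_bot hγ
  obtain ⟨hk, hS⟩ := mem_germEigenspace.1 hω
  obtain ⟨c, hc, t₀, ht₀, hnd⟩ := hp.nondegenerate
  have hpos : 0 < ‖ω‖ := norm_pos_iff.2 hω0
  have key : ∀ t : ℝ, 0 < t → t ≤ t₀ → √c * ‖ω‖ ≤ ‖p.R ω‖ + t * ‖p.X₁ (p.Z ω)‖ := by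
    intro t ht htt
    set w : K := (t : ℂ) • (p.R ω + (t : ℂ) • p.X₁ (p.Z ω)) with hw
    have hg : (ω + (t : ℂ) • p.Z ω, w) ∈ (p.X t).graph := by
      rw [mem_graph_X]
      have h1 := p.X₀.graph.add_mem (mem_kerX.1 hk)
        (p.X₀.graph.smul_mem (t : ℂ) (hp.Z_mem_graph hk))
      have h2 : w - (t : ℂ) • p.X₁ (ω + (t : ℂ) • p.Z ω) =
          0 + (t : ℂ) • (p.R ω - p.X₁ ω) := by
        rw [hw, map_add, map_smul]; module
      rw [h2]; exact h1
    obtain ⟨x, hx1, hx2⟩ := (LinearPMap.mem_graph_iff _).1 hg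
    have h1 := hnd t (by rwa [abs_of_pos ht]) x
    rw [hx1, hx2] at h1
    have h2 : ‖ω‖ ^ 2 ≤ ‖ω + (t : ℂ) • p.Z ω‖ ^ 2 := by
      have h3 : ⟪ω, (t : ℂ) • p.Z ω⟫_ℂ = 0 := by
        rw [inner_smul_right, hp.inner_Z hk, mul_zero]
      have h4 := norm_add_sq_eq_norm_sq_add_norm_sq_of_inner_eq_zero ω ((t : ℂ) • p.Z ω) h3
      rw [sq, sq, h4]
      nlinarith [norm_nonneg ((t : ℂ) • p.Z ω)]
    have h3 : ‖w‖ ≤ t * (‖p.R ω‖ + t * ‖p.X₁ (p.Z ω)‖) := by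
      rw [hw, norm_smul, Complex.norm_real, Real.norm_of_nonneg ht.le]
      gcongr
      refine (norm_add_le _ _).trans ?_
      rw [norm_smul, Complex.norm_real, Real.norm_of_nonneg ht.le]
    have h4 : (t * (√c * ‖ω‖)) ^ 2 ≤ (t * (‖p.R ω‖ + t * ‖p.X₁ (p.Z ω)‖)) ^ 2 := by
      calc (t * (√c * ‖ω‖)) ^ 2 = c * t ^ 2 * ‖ω‖ ^ 2 := by
            rw [mul_pow, mul_pow, Real.sq_sqrt hc.le]; ring
        _ ≤ c * t ^ 2 * ‖ω + (t : ℂ) • p.Z ω‖ ^ 2 := by gcongr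
        _ ≤ ‖w‖ ^ 2 := h1
        _ ≤ _ := by gcongr
    have h5 := le_of_sq_le_sq h4 (by positivity)
    exact le_of_mul_le_mul_left h5 ht
  have h1 : √c * ‖ω‖ ≤ ‖p.R ω‖ := by
    have hlim : Tendsto (fun t : ℝ => ‖p.R ω‖ + t * ‖p.X₁ (p.Z ω)‖) (𝓝[>] 0) (𝓝 ‖p.R ω‖) := by
      have : Tendsto (fun t : ℝ => ‖p.R ω‖ + t * ‖p.X₁ (p.Z ω)‖) (𝓝 0)
          (𝓝 (‖p.R ω‖ + 0 * ‖p.X₁ (p.Z ω)‖)) := Continuous.tendsto (by fun_prop) 0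
      rw [zero_mul, add_zero] at this
      exact this.mono_left nhdsWithin_le_nhds
    refine ge_of_tendsto hlim ?_
    filter_upwards [Ioc_mem_nhdsGT ht₀] with t ht
    exact key t ht.1 ht.2
  have h2 : γ * ‖ω‖ ^ 2 = ‖p.R ω‖ ^ 2 := by
    have h3 : (⟪p.R ω, p.R ω⟫_ℂ).re = ‖p.R ω‖ ^ 2 := inner_self_eq_norm_sq (𝕜 := ℂ) _
    have h4 : (⟪ω, ω⟫_ℂ).re = ‖ω‖ ^ 2 := inner_self_eq_norm_sq (𝕜 := ℂ) _
    rw [← h3, ← inner_S, hS, inner_smul_right, Complex.re_ofReal_mul, h4]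
  have h3 : 0 < ‖p.R ω‖ := lt_of_lt_of_le (by positivity) h1
  have h4 : 0 < γ * ‖ω‖ ^ 2 := by rw [h2]; positivity
  exact pos_of_mul_pos_left h4 (by positivity)

/-- The coefficients of a formal eigenvector `ω + t φ₁ + t² φ₂ + t³ φ₃ + t⁴ φ₄` of `A(t)` for the
formal eigenvalue `γ t² + ν t⁴`, in the weak sense and up to order `t⁴`. Here
`gₖ = X₀ φₖ + X₁ φₖ₋₁`. The equations for `φ₃` and `φ₄` are solvable by the choice of the components
of `φ₁` and `φ₂` in `𝔑`, which rests on `P_q N P_q = 0` and on `𝒩^(q) ω = ν ω`. -/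
theorem Admissible.exists_quasimode_coeffs (hp : p.Admissible) (hN₀ : p.N₀ = 0) {γ ν : ℝ}
    (hγ : γ ∈ p.germEigenvalues) {ω : H} (hω : ω ∈ p.germEigenspace γ)
    (hν : p.germN γ ω = (ν : ℂ) • ω) :
    ∃ (φ₁ φ₂ φ₃ φ₄ : H) (g₁ g₂ g₃ g₄ : K),
      (φ₁, g₁ - p.X₁ ω) ∈ p.X₀.graph ∧ (φ₂, g₂ - p.X₁ φ₁) ∈ p.X₀.graph ∧
      (φ₃, g₃ - p.X₁ φ₂) ∈ p.X₀.graph ∧ (φ₄, g₄ - p.X₁ φ₃) ∈ p.X₀.graph ∧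
      ∀ v v', (v, v') ∈ p.X₀.graph → ⟪v', g₁⟫_ℂ = 0 ∧
        ⟪v', g₂⟫_ℂ + ⟪p.X₁ v, g₁⟫_ℂ = γ * ⟪v, ω⟫_ℂ ∧
        ⟪v', g₃⟫_ℂ + ⟪p.X₁ v, g₂⟫_ℂ = γ * ⟪v, φ₁⟫_ℂ ∧
        ⟪v', g₄⟫_ℂ + ⟪p.X₁ v, g₃⟫_ℂ = γ * ⟪v, φ₂⟫_ℂ + ν * ⟪v, ω⟫_ℂ := by
  obtain ⟨hk, hS⟩ := mem_germEigenspace.1 hω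
  set a := hp.redRes γ (p.N ω) with ha
  have hak : a ∈ p.kerX := hp.redRes_mem γ _
  have ha1 : (γ : ℂ) • a - p.S a = p.N ω :=
    hp.S_redRes hγ (hp.N_mem ω) (hp.eigProj_N_eigProj hN₀ hγ hω)
  set y := p.N₁ ω - (γ : ℂ) • p.Z.adjoint (p.Z ω) + p.N a - (ν : ℂ) • ω with hy
  have hyk : y ∈ p.kerX := p.kerX.sub_mem (p.kerX.add_mem (p.kerX.sub_mem (hp.N₁_mem _)
    (p.kerX.smul_mem _ (hp.Z_adjoint_mem _))) (hp.N_mem _)) (p.kerX.smul_mem _ hk)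
  have hy0 : p.eigProj γ y = 0 := by
    rw [hy, map_sub, ha, ← hp.germN_of_mem hω, hν, map_smul, eigProj_of_mem hω, sub_self]
  set b := hp.redRes γ y with hb
  have hbk : b ∈ p.kerX := hp.redRes_mem γ _
  have hb1 : (γ : ℂ) • b - p.S b = y := hp.S_redRes hγ hyk hy0
  set φ₁ := p.Z ω + a with hφ₁
  set φ₂ := p.Z₂ ω + p.Z a + b with hφ₂
  set g₂ := p.R₂ ω + p.R a with hg₂
  have hgr₁ : (φ₁, p.R ω - p.X₁ ω) ∈ p.X₀.graph := by
    have := p.X₀.graph.add_mem (hp.Z_mem_graph hk) (mem_kerX.1 hak)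
    simpa only [Prod.mk_add_mk, add_zero] using this
  have hgr₂ : (φ₂, g₂ - p.X₁ φ₁) ∈ p.X₀.graph := by
    have := p.X₀.graph.add_mem (p.X₀.graph.add_mem (hp.Z₂_spec ω).1 (hp.Z_mem_graph hak))
      (mem_kerX.1 hbk)
    simp only [Prod.mk_add_mk, add_zero] at this
    rw [show g₂ - p.X₁ φ₁ = p.R₂ ω - p.X₁ (p.Z ω) + (p.R a - p.X₁ a) by
      rw [hg₂, hφ₁, map_add]; abel]
    exact this
  have hw₁ : ∀ v v', (v, v') ∈ p.X₀.graph → ⟪v', p.R ω⟫_ℂ = 0 := (hp.Z_spec ω).2.2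
  have hw₂ : ∀ v v', (v, v') ∈ p.X₀.graph →
      ⟪v', g₂⟫_ℂ = ⟪v, (γ : ℂ) • ω - p.X₁.adjoint (p.R ω)⟫_ℂ := by
    intro v v' hv
    rw [hg₂, inner_add_right, (hp.Z_spec a).2.2 v v' hv, add_zero, (hp.Z₂_spec ω).2.2 v v' hv,
      hp.P_adjoint_X₁_R, hS]
  -- solvability of the equation of order `t³`
  have hb₃ : (γ : ℂ) • φ₁ - p.X₁.adjoint g₂ ∈ p.kerXᗮ := by
    rw [Submodule.mem_orthogonal]
    intro u hu
    have h1 := hp.inner_X₁_of_weak hw₂ hu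
    have h2 := hp.inner_R_of_mem_graph u hgr₂
    have h3 : ⟪u, (γ : ℂ) • a - p.S a⟫_ℂ = ⟪u, p.N ω⟫_ℂ := by rw [ha1]
    rw [inner_N] at h3
    rw [hφ₁, map_add] at h2
    simp only [inner_sub_right, inner_add_right, inner_smul_right,
      ContinuousLinearMap.adjoint_inner_right, hp.inner_Z hu, hp.inner_Z_left hk,
      hp.inner_R_X₁ u hak, hφ₁] at h1 h2 h3 ⊢
    linear_combination h3 - h1 - h2
  obtain ⟨φ₃, f₃, -, hgr₃, hw₃⟩ := hp.exists_isWeakSol (p.X₁ φ₂) hb₃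
  set g₃ := f₃ + p.X₁ φ₂ with hg₃
  have hgr₃' : (φ₃, g₃ - p.X₁ φ₂) ∈ p.X₀.graph := by rw [hg₃, add_sub_cancel_right]; exact hgr₃
  -- solvability of the equation of order `t⁴`
  have hb₄ : (γ : ℂ) • φ₂ + (ν : ℂ) • ω - p.X₁.adjoint g₃ ∈ p.kerXᗮ := by
    rw [Submodule.mem_orthogonal]
    intro u hu
    have h1 := hp.inner_X₁_of_weak hw₃ hu
    have h2 := hp.inner_R_of_mem_graph u hgr₃'
    have h3 : ⟪u, (γ : ℂ) • b - p.S b⟫_ℂ = ⟪u, y⟫_ℂ := by rw [hb1]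
    have h4 : ⟪u, p.Z₂ ω⟫_ℂ = 0 := (hp.Z₂_spec ω).2.1 u hu
    have h5 : ⟪p.Z₂ u, p.S ω⟫_ℂ = 0 := by
      rw [← inner_conj_symm, (hp.Z₂_spec u).2.1 _ (hp.S_mem ω), map_zero]
    have h6 := (hp.Z₂_spec ω).2.2 _ _ (hp.Z₂_spec u).1
    have h7 : ⟪p.X₁ (p.Z u), p.R a⟫_ℂ + ⟪p.R u, p.X₁ (p.Z a)⟫_ℂ = ⟪u, p.N a⟫_ℂ := (inner_N u a).symm
    rw [hp.P_adjoint_X₁_R] at h6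
    simp only [hy, hφ₁, hφ₂, hg₂, map_add, inner_sub_left, inner_sub_right, inner_add_right,
      inner_smul_right, ContinuousLinearMap.adjoint_inner_right, hp.inner_Z hu,
      hp.inner_Z_left hak, hp.inner_R_X₁ u hbk, inner_N₁, h4, h5] at h1 h2 h3 h6 ⊢
    linear_combination h3 - h1 - h2 - h7 + h6
  obtain ⟨φ₄, f₄, -, hgr₄, hw₄⟩ := hp.exists_isWeakSol (p.X₁ φ₃) hb₄
  refine ⟨φ₁, φ₂, φ₃, φ₄, p.R ω, g₂, g₃, f₄ + p.X₁ φ₃, hgr₁, hgr₂, hgr₃', ?_, ?_⟩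
  · rw [add_sub_cancel_right]; exact hgr₄
  · intro v v' hv
    have h2 := hw₂ v v' hv
    have h3 := hw₃ v v' hv
    have h4 := hw₄ v v' hv
    simp only [inner_sub_right, inner_add_right _ ((γ : ℂ) • φ₂), inner_smul_right,
      ContinuousLinearMap.adjoint_inner_right] at h2 h3 h4
    exact ⟨hw₁ v v' hv, by rw [h2]; ring, by rw [hg₃, h3]; ring, by rw [h4]; ring⟩

end Quasimode

end Pencil

/-! ### The quasimode and lower bounds for the propagators -/

section Functions

theorem mul_sinc (x : ℝ) : x * Real.sinc x = Real.sin x := by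
  rcases eq_or_ne x 0 with rfl | hx
  · simp
  · rw [Real.sinc_of_ne_zero hx]; field_simp

theorem continuous_cosSqrt (τ : ℝ) : Continuous (cosSqrt τ) := by unfold cosSqrt; fun_prop

theorem continuous_sinSqrtDiv (τ : ℝ) : Continuous (sinSqrtDiv τ) := by
  unfold sinSqrtDiv
  exact continuous_const.mul (Real.continuous_sinc.comp (by fun_prop))

theorem abs_cosSqrt_le (τ y : ℝ) : |cosSqrt τ y| ≤ 1 := Real.abs_cos_le_one _

theorem abs_sinSqrtDiv_le (τ y : ℝ) : |sinSqrtDiv τ y| ≤ |τ| := by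
  rw [sinSqrtDiv, abs_mul]
  exact mul_le_of_le_one_right (abs_nonneg _) (Real.abs_sinc_le_one _)

theorem sqrt_mul_sinSqrtDiv (τ y : ℝ) : √y * sinSqrtDiv τ y = Real.sin (τ * √y) := by
  rw [sinSqrtDiv, ← mul_sinc]; ring

theorem abs_cosSqrt_sub_le (τ y : ℝ) {l : ℝ} (hl : 0 < l) :
    |cosSqrt τ y - cosSqrt τ l| ≤ |τ| * (√l)⁻¹ * |y - l| := by
  refine (Real.abs_cos_sub_cos_le _ _).trans ?_
  rw [← mul_sub, abs_mul, mul_assoc]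
  gcongr
  exact abs_sqrt_sub_sqrt_le y hl

theorem abs_sinSqrtDiv_sub_le (τ y : ℝ) {l : ℝ} (hl : 0 < l) :
    |sinSqrtDiv τ y - sinSqrtDiv τ l| ≤ 2 * |τ| * l⁻¹ * |y - l| := by
  have h2 := Real.sqrt_pos.2 hl
  have h1 : √l * |sinSqrtDiv τ y - sinSqrtDiv τ l| ≤ 2 * |τ| * |√y - √l| := by
    rw [← abs_of_pos h2, ← abs_mul, abs_of_pos h2, mul_sub, sqrt_mul_sinSqrtDiv]
    have h3 : √l * sinSqrtDiv τ y - Real.sin (τ * √l) =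
        (√l - √y) * sinSqrtDiv τ y + (Real.sin (τ * √y) - Real.sin (τ * √l)) := by
      rw [← sqrt_mul_sinSqrtDiv τ y]; ring
    rw [h3]
    refine (abs_add_le _ _).trans ?_
    have h4 : |(√l - √y) * sinSqrtDiv τ y| ≤ |τ| * |√y - √l| := by
      rw [abs_mul, abs_sub_comm (√l)]
      exact (mul_le_mul_of_nonneg_left (abs_sinSqrtDiv_le τ y) (abs_nonneg _)).trans_eq
        (mul_comm _ _)
    have h5 : |Real.sin (τ * √y) - Real.sin (τ * √l)| ≤ |τ| * |√y - √l| := by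
      refine (Real.abs_sin_sub_sin_le _ _).trans ?_
      rw [← mul_sub, abs_mul]
    linarith
  have h3 := abs_sqrt_sub_sqrt_le y hl
  have h4 : |sinSqrtDiv τ y - sinSqrtDiv τ l| ≤ (√l)⁻¹ * (2 * |τ| * ((√l)⁻¹ * |y - l|)) := by
    rw [le_inv_mul_iff₀ h2]
    exact h1.trans (by gcongr)
  refine h4.trans_eq ?_
  have h5 : l⁻¹ = (√l)⁻¹ * (√l)⁻¹ := by rw [← mul_inv, Real.mul_self_sqrt hl.le]
  rw [h5]; ring

end Functions

namespace Pencil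

variable {H K : Type*} [NormedAddCommGroup H] [InnerProductSpace ℂ H] [CompleteSpace H]
  [NormedAddCommGroup K] [InnerProductSpace ℂ K] [CompleteSpace K] {p : Pencil H K}

section Quasimode

/-- The quasimode of `A(t)` at `γ t² + ν t⁴`, with residual of order `t⁵`. -/
theorem Admissible.exists_quasimode (hp : p.Admissible) (hN₀ : p.N₀ = 0) {γ ν : ℝ}
    (hγ : γ ∈ p.germEigenvalues) {ω : H} (hω : ω ∈ p.germEigenspace γ)
    (hν : p.germN γ ω = (ν : ℂ) • ω) :
    ∃ (φ : ℝ → H) (C : ℝ), 0 ≤ C ∧ ∀ t, 0 < t → t ≤ 1 → ‖φ t - ω‖ ≤ C * t ∧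
      ∃ Φ, (φ t, Φ) ∈ (p.X t).graph ∧ ∀ v v', (v, v') ∈ (p.X t).graph →
        ‖⟪v', Φ⟫_ℂ - ((γ * t ^ 2 + ν * t ^ 4 : ℝ) : ℂ) * ⟪v, φ t⟫_ℂ‖ ≤
          C * t ^ 5 * (‖v‖ + ‖v'‖) := by
  obtain ⟨φ₁, φ₂, φ₃, φ₄, g₁, g₂, g₃, g₄, h1, h2, h3, h4, hw⟩ :=
    hp.exists_quasimode_coeffs hN₀ hγ hω hν
  have hk := (mem_germEigenspace.1 hω).1
  set C₁ := ‖φ₁‖ + ‖φ₂‖ + ‖φ₃‖ + ‖φ₄‖ with hC₁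
  set C₂ := ‖p.X₁ φ₄‖ + ‖p.X₁.adjoint g₄‖ + |γ| * (‖φ₃‖ + ‖φ₄‖) +
    |ν| * (‖φ₁‖ + ‖φ₂‖ + ‖φ₃‖ + ‖φ₄‖) with hC₂
  have hC₁0 : 0 ≤ C₁ := by positivity
  have hC₂0 : 0 ≤ C₂ := by positivity
  refine ⟨fun t => ω + (t : ℂ) • φ₁ + (t : ℂ) ^ 2 • φ₂ + (t : ℂ) ^ 3 • φ₃ + (t : ℂ) ^ 4 • φ₄,
    C₁ + C₂, by positivity, fun t ht0 ht1 => ⟨?_, ?_⟩⟩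
  · have e : ω + (t : ℂ) • φ₁ + (t : ℂ) ^ 2 • φ₂ + (t : ℂ) ^ 3 • φ₃ + (t : ℂ) ^ 4 • φ₄ - ω =
        (t : ℂ) • (φ₁ + (t : ℂ) • φ₂ + (t : ℂ) ^ 2 • φ₃ + (t : ℂ) ^ 3 • φ₄) := by module
    have ht : ‖(t : ℂ)‖ ≤ 1 := by rwa [Complex.norm_real, Real.norm_of_nonneg ht0.le]
    have hsm : ∀ (n : ℕ) (x : H), ‖(t : ℂ) ^ n • x‖ ≤ ‖x‖ := fun n x => by
      rw [norm_smul, norm_pow]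
      exact mul_le_of_le_one_left (norm_nonneg _) (pow_le_one₀ (norm_nonneg _) ht)
    rw [e, norm_smul, Complex.norm_real, Real.norm_of_nonneg ht0.le, mul_comm]
    gcongr
    have hb : ‖φ₁ + (t : ℂ) • φ₂ + (t : ℂ) ^ 2 • φ₃ + (t : ℂ) ^ 3 • φ₄‖ ≤ C₁ := by
      refine norm_add₄_le.trans ?_
      have := hsm 1 φ₂
      rw [pow_one] at this
      linarith [hsm 2 φ₃, hsm 3 φ₄]
    linarith
  · refine ⟨(t : ℂ) • g₁ + (t : ℂ) ^ 2 • g₂ + (t : ℂ) ^ 3 • g₃ + (t : ℂ) ^ 4 • g₄ +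
      (t : ℂ) ^ 5 • p.X₁ φ₄, ?_, ?_⟩
    · rw [mem_graph_X]
      have hg := p.X₀.graph.add_mem (p.X₀.graph.add_mem (p.X₀.graph.add_mem (p.X₀.graph.add_mem
        (mem_kerX.1 hk) (p.X₀.graph.smul_mem (t : ℂ) h1)) (p.X₀.graph.smul_mem ((t : ℂ) ^ 2) h2))
        (p.X₀.graph.smul_mem ((t : ℂ) ^ 3) h3)) (p.X₀.graph.smul_mem ((t : ℂ) ^ 4) h4)
      have e : (t : ℂ) • g₁ + (t : ℂ) ^ 2 • g₂ + (t : ℂ) ^ 3 • g₃ + (t : ℂ) ^ 4 • g₄ +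
          (t : ℂ) ^ 5 • p.X₁ φ₄ - (t : ℂ) • p.X₁ (ω + (t : ℂ) • φ₁ + (t : ℂ) ^ 2 • φ₂ +
            (t : ℂ) ^ 3 • φ₃ + (t : ℂ) ^ 4 • φ₄) =
          0 + (t : ℂ) • (g₁ - p.X₁ ω) + (t : ℂ) ^ 2 • (g₂ - p.X₁ φ₁) +
            (t : ℂ) ^ 3 • (g₃ - p.X₁ φ₂) + (t : ℂ) ^ 4 • (g₄ - p.X₁ φ₃) := by
        simp only [map_add, map_smul]
        module
      rw [e]
      exact hg
    · intro v v' hv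
      have hv0 := mem_graph_X.1 hv
      obtain ⟨e1, e2, e3, e4⟩ := hw _ _ hv0
      simp only [inner_sub_left, inner_smul_left, Complex.conj_ofReal] at e1 e2 e3 e4
      set r : H := p.X₁.adjoint g₄ - ((γ : ℂ) • φ₃ + (ν : ℂ) • φ₁ +
        (t : ℂ) • ((γ : ℂ) • φ₄ + (ν : ℂ) • φ₂) + (t : ℂ) ^ 2 • (ν : ℂ) • φ₃ +
        (t : ℂ) ^ 3 • (ν : ℂ) • φ₄) with hr
      have key : ⟪v', (t : ℂ) • g₁ + (t : ℂ) ^ 2 • g₂ + (t : ℂ) ^ 3 • g₃ + (t : ℂ) ^ 4 • g₄ +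
          (t : ℂ) ^ 5 • p.X₁ φ₄⟫_ℂ - ((γ * t ^ 2 + ν * t ^ 4 : ℝ) : ℂ) *
          ⟪v, ω + (t : ℂ) • φ₁ + (t : ℂ) ^ 2 • φ₂ + (t : ℂ) ^ 3 • φ₃ + (t : ℂ) ^ 4 • φ₄⟫_ℂ =
          (t : ℂ) ^ 5 * (⟪v', p.X₁ φ₄⟫_ℂ + ⟪v, r⟫_ℂ) := by
        rw [hr]
        simp only [inner_add_right, inner_sub_right, inner_smul_right,
          ContinuousLinearMap.adjoint_inner_right]
        push_cast
        linear_combination (t : ℂ) * e1 + (t : ℂ) ^ 2 * e2 + (t : ℂ) ^ 3 * e3 + (t : ℂ) ^ 4 * e4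
      have ht : ‖(t : ℂ)‖ ≤ 1 := by rwa [Complex.norm_real, Real.norm_of_nonneg ht0.le]
      have hsm : ∀ (n : ℕ) (x : H), ‖(t : ℂ) ^ n • x‖ ≤ ‖x‖ := fun n x => by
        rw [norm_smul, norm_pow]
        exact mul_le_of_le_one_left (norm_nonneg _) (pow_le_one₀ (norm_nonneg _) ht)
      have hsc : ∀ (c : ℝ) (x : H), ‖(c : ℂ) • x‖ = |c| * ‖x‖ := fun c x => by
        rw [norm_smul, Complex.norm_real, Real.norm_eq_abs]
      have hrb : ‖p.X₁ φ₄‖ + ‖r‖ ≤ C₂ := by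
        have b1 : ‖r‖ ≤ ‖p.X₁.adjoint g₄‖ + ‖(γ : ℂ) • φ₃ + (ν : ℂ) • φ₁ +
            (t : ℂ) • ((γ : ℂ) • φ₄ + (ν : ℂ) • φ₂) + (t : ℂ) ^ 2 • (ν : ℂ) • φ₃ +
            (t : ℂ) ^ 3 • (ν : ℂ) • φ₄‖ := norm_sub_le _ _
        have b2 := norm_add₄_le (a := (γ : ℂ) • φ₃ + (ν : ℂ) • φ₁)
          (b := (t : ℂ) • ((γ : ℂ) • φ₄ + (ν : ℂ) • φ₂)) (c := (t : ℂ) ^ 2 • (ν : ℂ) • φ₃)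
          (d := (t : ℂ) ^ 3 • (ν : ℂ) • φ₄)
        have b3 := norm_add_le ((γ : ℂ) • φ₃) ((ν : ℂ) • φ₁)
        have b4 := norm_add_le ((γ : ℂ) • φ₄) ((ν : ℂ) • φ₂)
        have b5 := hsm 1 ((γ : ℂ) • φ₄ + (ν : ℂ) • φ₂)
        have b6 := hsm 2 ((ν : ℂ) • φ₃)
        have b7 := hsm 3 ((ν : ℂ) • φ₄)
        rw [pow_one] at b5
        simp only [hsc] at b3 b4 b6 b7
        rw [hC₂]
        linarith
      rw [key, norm_mul, norm_pow, Complex.norm_real, Real.norm_of_nonneg ht0.le]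
      have b1 : ‖⟪v', p.X₁ φ₄⟫_ℂ + ⟪v, r⟫_ℂ‖ ≤ ‖v'‖ * ‖p.X₁ φ₄‖ + ‖v‖ * ‖r‖ :=
        (norm_add_le _ _).trans (add_le_add (norm_inner_le_norm _ _) (norm_inner_le_norm _ _))
      have b2 : ‖v'‖ * ‖p.X₁ φ₄‖ + ‖v‖ * ‖r‖ ≤ (C₁ + C₂) * (‖v‖ + ‖v'‖) := by
        have n1 := norm_nonneg v
        have n2 := norm_nonneg v'
        have n3 := norm_nonneg (p.X₁ φ₄)
        have n4 := norm_nonneg r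
        nlinarith [mul_nonneg n1 n3, mul_nonneg n2 n4, mul_nonneg hC₁0 (add_nonneg n1 n2)]
      calc t ^ 5 * ‖⟪v', p.X₁ φ₄⟫_ℂ + ⟪v, r⟫_ℂ‖ ≤ t ^ 5 * ((C₁ + C₂) * (‖v‖ + ‖v'‖)) := by
            gcongr; exact b1.trans b2
        _ = _ := by ring

end Quasimode

section Propagators

theorem cfc_germ_apply {f : ℝ → ℝ} (hf : Continuous f) {γ t k : ℝ}
    (hk0 : 0 ≤ k) (hk : ∀ y, |f y - f (t ^ 2 * γ)| ≤ k * |y - t ^ 2 * γ|) {ω : H}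
    (hω : ω ∈ p.germEigenspace γ) :
    (cfc f ((t : ℂ) ^ 2 • p.S) ∘L p.P) ω = f (t ^ 2 * γ) • ω := by
  obtain ⟨h1, h2⟩ := mem_germEigenspace.1 hω
  rw [ContinuousLinearMap.comp_apply, P_of_mem h1]
  have hsa : IsSelfAdjoint ((t : ℂ) ^ 2 • p.S) := by
    refine IsSelfAdjoint.smul ?_ p.isSelfAdjoint_S
    rw [← Complex.ofReal_pow]
    exact Complex.conj_ofReal _
  refine cfc_apply_of_eigenvector hsa hf hk0 (fun x _ => hk x) ?_
  rw [_root_.smul_apply, h2, smul_smul, ← Complex.coe_smul]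
  push_cast; rfl

theorem Admissible.P_cfc_germ (hp : p.Admissible) (f : ℝ → ℝ) (c : ℂ) (u : H) :
    cfc f (c • p.S) (p.P u) ∈ p.kerX := by
  have hSP : Commute (c • p.S) p.P := by
    refine Commute.smul_left ?_ c
    ext u
    rw [mul_apply_eq_comp, mul_apply_eq_comp, P_of_mem (hp.S_mem u), S,
      ContinuousLinearMap.comp_apply, ContinuousLinearMap.comp_apply, hp.R_P]
  have h := (hSP.cfc_real f).eq
  have h1 := DFunLike.congr_fun h (p.P u)
  rw [mul_apply_eq_comp, mul_apply_eq_comp, P_P] at h1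
  rw [h1]
  exact P_mem _

/-- `‖J₁‖` is bounded below by the difference of the two cosines at a quasimode. -/
theorem norm_J₁_ge {t γ l : ℝ} (ht : 0 < t)
    (hγ : 0 < γ) (hl0 : 0 < l) (hl : l ≤ 1 / 2) {T : H →L[ℂ] H} (hT : IsNonnegResolvent (p.A t) T)
    {ω : H} (hω : ω ∈ p.germEigenspace γ) (w : H) (τ : ℝ) :
    |cosSqrt τ l - cosSqrt τ (t ^ 2 * γ)| * ‖⟪ω, w⟫_ℂ‖ ≤ ‖p.J₁ t τ‖ * ‖ω‖ * ‖w‖ +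
      ‖ω‖ * ((4 * (|τ| * (√l)⁻¹) + 12 * 1) * ‖T w - ((1 + l)⁻¹ : ℝ) • w‖) := by
  have hf := continuous_cosSqrt τ
  obtain ⟨M, hM⟩ := hT.exists_mem_graph_funCalc hf fun y _ => abs_cosSqrt_le τ y
  have hJ : p.J₁ t τ ω = M ω - cosSqrt τ (t ^ 2 * γ) • ω := by
    have hb : bcomp (funCalc (p.A t) (cosSqrt τ)) p.P = M ∘L p.P := bcomp_eq fun u => hM (p.P u)
    rw [J₁, hb, _root_.sub_apply, cfc_germ_apply hf (by positivity)
      (fun y => abs_cosSqrt_sub_le τ y (by positivity : 0 < t ^ 2 * γ)) hω,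
      ContinuousLinearMap.comp_apply, P_of_mem (mem_germEigenspace.1 hω).1]
  have h1 := hT.norm_inner_funCalc_sub_le hf (fun y _ => abs_cosSqrt_le τ y) hl0.le hl
    (by positivity) (fun y _ => abs_cosSqrt_sub_le τ y hl0) w (hM ω)
  have h2 : ((cosSqrt τ l - cosSqrt τ (t ^ 2 * γ) : ℝ) : ℂ) * ⟪ω, w⟫_ℂ =
      ⟪p.J₁ t τ ω, w⟫_ℂ - (⟪M ω, w⟫_ℂ - cosSqrt τ l * ⟪ω, w⟫_ℂ) := by
    rw [hJ, inner_sub_left, ← Complex.coe_smul, inner_smul_left, Complex.conj_ofReal]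
    push_cast; ring
  rw [← Real.norm_eq_abs, ← Complex.norm_real, ← norm_mul, h2]
  refine (norm_sub_le _ _).trans (add_le_add ?_ h1)
  refine (norm_inner_le_norm _ _).trans ?_
  gcongr
  exact ContinuousLinearMap.le_opNorm _ _

/-- `‖J₂‖` is bounded below by the difference of the two sines at a quasimode. -/
theorem norm_J₂_ge {t γ l : ℝ} (ht : 0 < t)
    (hγ : 0 < γ) (hl0 : 0 < l) (hl : l ≤ 1 / 2) {T : H →L[ℂ] H} (hT : IsNonnegResolvent (p.A t) T)
    {ω : H} (hω : ω ∈ p.germEigenspace γ) (w : H) (τ : ℝ) :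
    |sinSqrtDiv τ l - sinSqrtDiv τ (t ^ 2 * γ)| * ‖⟪ω, w⟫_ℂ‖ ≤ ‖p.J₂ t τ‖ * ‖ω‖ * ‖w‖ +
      ‖ω‖ * ((4 * (2 * |τ| * l⁻¹) + 12 * |τ|) * ‖T w - ((1 + l)⁻¹ : ℝ) • w‖) := by
  have hf := continuous_sinSqrtDiv τ
  obtain ⟨M, hM⟩ := hT.exists_mem_graph_funCalc hf fun y _ => abs_sinSqrtDiv_le τ y
  have hJ : p.J₂ t τ ω = M ω - sinSqrtDiv τ (t ^ 2 * γ) • ω := by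
    have hb : bcomp (funCalc (p.A t) (sinSqrtDiv τ)) p.P = M ∘L p.P :=
      bcomp_eq fun u => hM (p.P u)
    rw [J₂, hb, _root_.sub_apply, cfc_germ_apply hf (by positivity)
      (fun y => abs_sinSqrtDiv_sub_le τ y (by positivity : 0 < t ^ 2 * γ)) hω,
      ContinuousLinearMap.comp_apply, P_of_mem (mem_germEigenspace.1 hω).1]
  have h1 := hT.norm_inner_funCalc_sub_le hf (fun y _ => abs_sinSqrtDiv_le τ y) hl0.le hl
    (by positivity) (fun y _ => abs_sinSqrtDiv_sub_le τ y hl0) w (hM ω)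
  have h2 : ((sinSqrtDiv τ l - sinSqrtDiv τ (t ^ 2 * γ) : ℝ) : ℂ) * ⟪ω, w⟫_ℂ =
      ⟪p.J₂ t τ ω, w⟫_ℂ - (⟪M ω, w⟫_ℂ - sinSqrtDiv τ l * ⟪ω, w⟫_ℂ) := by
    rw [hJ, inner_sub_left, ← Complex.coe_smul, inner_smul_left, Complex.conj_ofReal]
    push_cast; ring
  rw [← Real.norm_eq_abs, ← Complex.norm_real, ← norm_mul, h2]
  refine (norm_sub_le _ _).trans (add_le_add ?_ h1)
  refine (norm_inner_le_norm _ _).trans ?_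
  gcongr
  exact ContinuousLinearMap.le_opNorm _ _

/-- `A(t)^(1/2) Σ(t, τ)` is a bounded operator. -/
theorem Admissible.mem_graph_sqrtASig (hp : p.Admissible) {t : ℝ} {T : H →L[ℂ] H}
    (hF : IsFormResolvent (p.X t) T) (hT : IsNonnegResolvent (p.A t) T) (τ : ℝ) (u : H) :
    (p.Sig t τ u, p.sqrtASig t τ u) ∈ (funCalc (p.A t) Real.sqrt).graph := by
  have := hp.finite_ker
  have hf := continuous_sinSqrtDiv τ
  obtain ⟨M, hM⟩ := hT.exists_mem_graph_funCalc hf fun y _ => abs_sinSqrtDiv_le τ y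
  obtain ⟨M', hM'⟩ := hT.exists_mem_graph_funCalc (f := fun y => √y * sinSqrtDiv τ y)
    (Real.continuous_sqrt.mul hf) (B := 1)
    fun y _ => by rw [sqrt_mul_sinSqrtDiv]; exact Real.abs_sin_le_one _
  have hdom : ∀ ω : p.kerX, (ω : H) + (t : ℂ) • p.Z ω ∈ (funCalc (p.A t) Real.sqrt).domain := by
    intro ω
    have hg : ((ω : H) + (t : ℂ) • p.Z ω,
        0 + (t : ℂ) • (p.R ω - p.X₁ ω) + (t : ℂ) • p.X₁ ((ω : H) + (t : ℂ) • p.Z ω)) ∈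
        (p.X t).graph := by
      rw [mem_graph_X, add_sub_cancel_right]
      exact p.X₀.graph.add_mem (mem_kerX.1 ω.2) (p.X₀.graph.smul_mem (t : ℂ) (hp.Z_mem_graph ω.2))
    obtain ⟨v, hv⟩ := hT.exists_mem_graph_sqrt hF hg
    exact LinearPMap.mem_domain_of_mem_graph hv
  -- `A(t)^(1/2) (I + t Z)` is bounded on `𝔑`, since `dim 𝔑 < ∞`.
  let L : p.kerX →L[ℂ] H := LinearMap.toContinuousLinearMap
    ((funCalc (p.A t) Real.sqrt).toFun ∘ₗ LinearMap.codRestrict _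
      ((1 + (t : ℂ) • p.Z : H →L[ℂ] H) ∘ₗ p.kerX.subtype) hdom)
  have hL : ∀ ω : p.kerX, ((ω : H) + (t : ℂ) • p.Z ω, L ω) ∈ (funCalc (p.A t) Real.sqrt).graph :=
    fun ω => (funCalc (p.A t) Real.sqrt).mem_graph ⟨_, hdom ω⟩
  let B : H →L[ℂ] p.kerX := (cfc (sinSqrtDiv τ) ((t : ℂ) ^ 2 • p.S) ∘L p.P).codRestrict p.kerX
    fun u => hp.P_cfc_germ _ _ u
  have hb : bcomp (funCalc (p.A t) (sinSqrtDiv τ)) p.P = M ∘L p.P := bcomp_eq fun u => hM (p.P u)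
  have key : ∀ u, (p.Sig t τ u, (M' ∘L p.P - L ∘L B) u) ∈ (funCalc (p.A t) Real.sqrt).graph := by
    intro u
    have h1 := hT.mem_graph_funCalc_mul hf Real.continuous_sqrt (hM (p.P u)) (hM' (p.P u))
    have h2 := (funCalc (p.A t) Real.sqrt).graph.sub_mem h1 (hL (B u))
    rw [Sig, hb]
    exact h2
  rw [sqrtASig, bcomp_eq key]
  exact key u

/-- `‖A(t)^(1/2) Σ‖` is bounded below by the difference of the two sines at a quasimode `w`. The
square root is moved to the quasimode. -/
theorem Admissible.norm_sqrtASig_ge (hp : p.Admissible) {t γ l : ℝ} (ht : 0 < t)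
    (hγ : 0 < γ) (hl0 : 0 < l) (hl : l ≤ 1 / 2) {T : H →L[ℂ] H} (hF : IsFormResolvent (p.X t) T)
    (hT : IsNonnegResolvent (p.A t) T) {ω : H} (hω : ω ∈ p.germEigenspace γ) (w : H) (τ : ℝ) :
    √l / (1 + l) * (|sinSqrtDiv τ l - sinSqrtDiv τ (t ^ 2 * γ)| * ‖⟪ω, w⟫_ℂ‖ -
        |sinSqrtDiv τ (t ^ 2 * γ)| * t * ‖⟪p.Z ω, w⟫_ℂ‖ -
        ‖ω‖ * ((4 * (2 * |τ| * l⁻¹) + 12 * |τ|) * ‖T w - ((1 + l)⁻¹ : ℝ) • w‖)) ≤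
      ‖p.sqrtASig t τ‖ * ‖ω‖ * ‖w‖ + |τ| * (2 * ‖ω‖ + t * ‖p.Z ω‖) *
        ((4 * (√l)⁻¹ + 12) * ‖T w - ((1 + l)⁻¹ : ℝ) • w‖) := by
  have hf := continuous_sinSqrtDiv τ
  obtain ⟨M, hM⟩ := hT.exists_mem_graph_funCalc hf fun y _ => abs_sinSqrtDiv_le τ y
  set σ := sinSqrtDiv τ (t ^ 2 * γ) with hσ
  have hσb : |σ| ≤ |τ| := abs_sinSqrtDiv_le _ _
  have hS : p.Sig t τ ω = M ω - σ • (ω + (t : ℂ) • p.Z ω) := by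
    have hb : bcomp (funCalc (p.A t) (sinSqrtDiv τ)) p.P = M ∘L p.P :=
      bcomp_eq fun u => hM (p.P u)
    rw [Sig, hb, _root_.sub_apply, ContinuousLinearMap.comp_apply (1 + (t : ℂ) • p.Z),
      cfc_germ_apply hf (by positivity)
      (fun y => abs_sinSqrtDiv_sub_le τ y (by positivity : 0 < t ^ 2 * γ)) hω,
      ContinuousLinearMap.comp_apply, P_of_mem (mem_germEigenspace.1 hω).1, ← Complex.coe_smul,
      ← Complex.coe_smul, map_smul]
    rfl
  have h1 := hT.norm_inner_funCalc_sub_le hf (fun y _ => abs_sinSqrtDiv_le τ y) hl0.le hl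
    (by positivity) (fun y _ => abs_sinSqrtDiv_sub_le τ y hl0) w (hM ω)
  have h2 : ((sinSqrtDiv τ l - σ : ℝ) : ℂ) * ⟪ω, w⟫_ℂ =
      ⟪p.Sig t τ ω, w⟫_ℂ + (σ : ℂ) * (t : ℂ) * ⟪p.Z ω, w⟫_ℂ -
        (⟪M ω, w⟫_ℂ - sinSqrtDiv τ l * ⟪ω, w⟫_ℂ) := by
    rw [hS, inner_sub_left, ← Complex.coe_smul, inner_smul_left, inner_add_left, inner_smul_left,
      Complex.conj_ofReal, Complex.conj_ofReal]
    push_cast; ring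
  have h3 : |sinSqrtDiv τ l - σ| * ‖⟪ω, w⟫_ℂ‖ ≤ ‖⟪p.Sig t τ ω, w⟫_ℂ‖ + |σ| * t * ‖⟪p.Z ω, w⟫_ℂ‖ +
      ‖ω‖ * ((4 * (2 * |τ| * l⁻¹) + 12 * |τ|) * ‖T w - ((1 + l)⁻¹ : ℝ) • w‖) := by
    rw [← Real.norm_eq_abs, ← Complex.norm_real, ← norm_mul, h2]
    refine (norm_sub_le _ _).trans (add_le_add ((norm_add_le _ _).trans (add_le_add le_rfl ?_)) h1)
    rw [norm_mul, norm_mul, Complex.norm_real, Complex.norm_real, Real.norm_of_nonneg ht.le,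
      Real.norm_eq_abs]
  have h4 : ‖p.Sig t τ ω‖ ≤ |τ| * (2 * ‖ω‖ + t * ‖p.Z ω‖) := by
    have h5 := hT.norm_le_of_mem_graph_funCalc (fun y _ => abs_sinSqrtDiv_le τ y) (hM ω)
    have h6 : ‖σ • (ω + (t : ℂ) • p.Z ω)‖ ≤ |τ| * (‖ω‖ + t * ‖p.Z ω‖) := by
      rw [norm_smul, Real.norm_eq_abs]
      gcongr
      refine (norm_add_le _ _).trans ?_
      rw [norm_smul, Complex.norm_real, Real.norm_of_nonneg ht.le]
    rw [hS]
    refine (norm_sub_le _ _).trans ?_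
    linarith
  have h5 := hT.norm_inner_sqrt_sub_le hl0 hl w (hp.mem_graph_sqrtASig hF hT τ ω)
  have h6 : ‖⟪p.sqrtASig t τ ω, T w⟫_ℂ‖ ≤ ‖p.sqrtASig t τ‖ * ‖ω‖ * ‖w‖ := by
    refine (norm_inner_le_norm _ _).trans ?_
    gcongr
    · exact ContinuousLinearMap.le_opNorm _ _
    · exact hF.norm_apply_le w
  have h7 : √l / (1 + l) * ‖⟪p.Sig t τ ω, w⟫_ℂ‖ ≤ ‖⟪p.sqrtASig t τ ω, T w⟫_ℂ‖ +
      ‖p.Sig t τ ω‖ * ((4 * (√l)⁻¹ + 12) * ‖T w - ((1 + l)⁻¹ : ℝ) • w‖) := by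
    have h8 : √l / (1 + l) * ‖⟪p.Sig t τ ω, w⟫_ℂ‖ =
        ‖((√l / (1 + l) : ℝ) : ℂ) * ⟪p.Sig t τ ω, w⟫_ℂ‖ := by
      rw [norm_mul, Complex.norm_real, Real.norm_of_nonneg (by positivity)]
    rw [h8]
    have h9 := norm_sub_norm_le (((√l / (1 + l) : ℝ) : ℂ) * ⟪p.Sig t τ ω, w⟫_ℂ)
      ⟪p.sqrtASig t τ ω, T w⟫_ℂ
    rw [norm_sub_rev] at h9
    linarith
  have h10 : ‖p.Sig t τ ω‖ * ((4 * (√l)⁻¹ + 12) * ‖T w - ((1 + l)⁻¹ : ℝ) • w‖) ≤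
      |τ| * (2 * ‖ω‖ + t * ‖p.Z ω‖) *
        ((4 * (√l)⁻¹ + 12) * ‖T w - ((1 + l)⁻¹ : ℝ) • w‖) := by gcongr
  refine le_trans ?_ (h7.trans (add_le_add h6 h10))
  gcongr
  linarith

end Propagators

end Pencil

/-! ### Resonant times -/

section Resonance

/-- Two close frequencies `a ≠ b` admit a time, comparable to `1 / |a - b|`, at which both the cosines
and the sines are far apart: in `cos (T a) - cos (T b) = -2 sin (T (a + b) / 2) sin (T (a - b) / 2)`
the phase `T (a + b) / 2` is taken in `π / 4 + ℤ π`. -/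
theorem exists_separating_time {a b : ℝ} (hab : a ≠ b) (h : 3 * |a - b| ≤ a + b) :
    ∃ T > 0, Real.pi / 4 ≤ T * (|a - b| / 2) ∧ T * (|a - b| / 2) ≤ 3 * Real.pi / 4 ∧
      1 ≤ |Real.cos (T * a) - Real.cos (T * b)| ∧ 1 ≤ |Real.sin (T * a) - Real.sin (T * b)| := by
  have hπ := Real.pi_pos
  set d := |a - b| / 2 with hd
  set s := (a + b) / 2 with hs
  have hd0 : 0 < d := by
    have := abs_pos.2 (sub_ne_zero.2 hab); positivity
  have hsd : 3 * d ≤ s := by rw [hd, hs]; linarith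
  have hs0 : 0 < s := by linarith
  set k := ⌊s / (2 * d)⌋₊ with hk
  have hk1 : (k : ℝ) * (2 * d) ≤ s := by
    rw [← le_div_iff₀ (by positivity)]; exact Nat.floor_le (by positivity)
  have hk2 : s < (k + 1) * (2 * d) := by
    rw [← div_lt_iff₀ (by positivity)]; exact Nat.lt_floor_add_one _
  set T := (Real.pi / 4 + k * Real.pi) / s with hT
  have hTs : T * s = Real.pi / 4 + k * Real.pi := by rw [hT]; field_simp
  have hT0 : 0 < T := by positivity
  have hTd : T * d = (Real.pi / 4 + k * Real.pi) * d / s := by rw [hT]; ring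
  have h1 : Real.pi / 4 ≤ T * d := by
    rw [hTd, le_div_iff₀ hs0]; nlinarith
  have h2 : T * d ≤ 3 * Real.pi / 4 := by
    rw [hTd, div_le_iff₀ hs0]; nlinarith
  have hsin : √2 / 2 ≤ |Real.sin (T * ((a - b) / 2))| := by
    have e : |Real.sin (T * ((a - b) / 2))| = |Real.sin (T * d)| := by
      rcases abs_choice (a - b) with h | h
      · rw [hd, h]
      · rw [hd, h, neg_div, mul_neg, Real.sin_neg, abs_neg]
    rw [e]
    refine le_trans ?_ (le_abs_self _)
    rw [← Real.cos_pi_div_four, ← Real.cos_sub_pi_div_two, ← Real.cos_abs (T * d - _)]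
    refine Real.cos_le_cos_of_nonneg_of_le_pi (abs_nonneg _) (by linarith) ?_
    rw [abs_le]; constructor <;> linarith
  have h22 : √2 / 2 * (√2 / 2) = 1 / 2 := by
    have := Real.mul_self_sqrt (show (0 : ℝ) ≤ 2 by norm_num)
    linarith
  refine ⟨T, hT0, h1, h2, ?_, ?_⟩
  · have hsum : |Real.sin (T * s)| = √2 / 2 := by
      rw [hTs, Real.sin_add_nat_mul_pi, abs_mul, abs_pow, abs_neg, abs_one, one_pow, one_mul,
        Real.sin_pi_div_four, abs_of_pos (by positivity)]
    rw [Real.cos_sub_cos, ← mul_add, ← mul_sub, mul_div_assoc, mul_div_assoc, abs_mul, abs_mul, hsum]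
    norm_num
    nlinarith [Real.sqrt_nonneg 2]
  · have hsum : |Real.cos (T * s)| = √2 / 2 := by
      rw [hTs, Real.cos_add_nat_mul_pi, abs_mul, abs_pow, abs_neg, abs_one, one_pow, one_mul,
        Real.cos_pi_div_four, abs_of_pos (by positivity)]
    rw [Real.sin_sub_sin, ← mul_add, ← mul_sub, mul_div_assoc, mul_div_assoc, abs_mul, abs_mul, hsum]
    norm_num
    nlinarith [Real.sqrt_nonneg 2]

/-- `F(t, ±T)` is bounded away from zero for all small `t > 0` and suitable times `T`, of exact order
`t⁻³`. -/
def IsResonant (F : ℝ → ℝ → ℝ) : Prop :=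
  ∃ c₀ > 0, ∃ c₁ > 0, ∃ c₂ > 0, ∀ᶠ t in 𝓝[>] (0 : ℝ), ∃ T > 0, c₁ ≤ T * t ^ 3 ∧ T * t ^ 3 ≤ c₂ ∧
    ∀ τ, |τ| = T → c₀ ≤ F t τ

theorem smoothing_eq {s t ε : ℝ} (ht : 0 < t) (hε : 0 < ε) :
    smoothing s t ε = (ε ^ 2 / (t ^ 2 + ε ^ 2)) ^ (s / 2) := by
  rw [smoothing, Real.div_rpow (by positivity) (by positivity), neg_div,
    Real.rpow_neg (by positivity), div_eq_mul_inv]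
  congr 1
  rw [← Real.rpow_natCast, ← Real.rpow_mul hε.le]
  congr 1
  push_cast; ring

/-- On the curve `ε ~ t³` the smoothing factor is bounded below by a multiple of `t ^ (2 s)`, for any
upper bound `s ≥ 0` of its exponent. -/
theorem exists_smoothing_ge {m M s s' : ℝ} (hm : 0 < m) (hM : 0 < M) (hs : s ≤ s') (hs' : 0 ≤ s') :
    ∃ k > 0, ∀ t ε, 0 < t → t ≤ 1 → m * t ^ 3 ≤ ε → ε ≤ M * t ^ 3 →
      k * t ^ (2 * s') ≤ smoothing s t ε := by
  refine ⟨(m ^ 2 / (1 + M ^ 2)) ^ (s' / 2), by positivity, fun t ε ht ht1 h1 h2 => ?_⟩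
  have hε : 0 < ε := lt_of_lt_of_le (by positivity) h1
  rw [smoothing_eq ht hε]
  have hq1 : ε ^ 2 / (t ^ 2 + ε ^ 2) ≤ 1 := by
    rw [div_le_one (by positivity)]; nlinarith
  have hq : m ^ 2 / (1 + M ^ 2) * t ^ 4 ≤ ε ^ 2 / (t ^ 2 + ε ^ 2) := by
    rw [div_mul_eq_mul_div, div_le_div_iff₀ (by positivity) (by positivity)]
    have e1 : (m * t ^ 3) ^ 2 ≤ ε ^ 2 := by gcongr
    have e2 : ε ^ 2 ≤ (M * t ^ 3) ^ 2 := by gcongr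
    have e3 : (M * t ^ 3) ^ 2 ≤ M ^ 2 * t ^ 2 := by
      have : t ^ 6 ≤ t ^ 2 := pow_le_pow_of_le_one ht.le ht1 (by norm_num)
      calc (M * t ^ 3) ^ 2 = M ^ 2 * t ^ 6 := by ring
        _ ≤ _ := by gcongr
    calc m ^ 2 * t ^ 4 * (t ^ 2 + ε ^ 2) ≤ m ^ 2 * t ^ 4 * (t ^ 2 + M ^ 2 * t ^ 2) := by
          gcongr; exact e2.trans e3
      _ = (m * t ^ 3) ^ 2 * (1 + M ^ 2) := by ring
      _ ≤ _ := by gcongr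
  calc (m ^ 2 / (1 + M ^ 2)) ^ (s' / 2) * t ^ (2 * s')
      = (m ^ 2 / (1 + M ^ 2) * t ^ 4) ^ (s' / 2) := by
        rw [Real.mul_rpow (by positivity) (by positivity)]
        congr 1
        rw [← Real.rpow_natCast t, ← Real.rpow_mul ht.le]
        congr 1
        push_cast; ring
    _ ≤ (ε ^ 2 / (t ^ 2 + ε ^ 2)) ^ (s' / 2) :=
        Real.rpow_le_rpow (by positivity) hq (by positivity)
    _ ≤ _ := Real.rpow_le_rpow_of_exponent_ge (by positivity) hq1 (by linarith)

/-- Sharpness with respect to the smoothing factor, tested with `ε = |τ| / T ~ t³`. -/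
theorem IsResonant.not_smoothing_bound {F : ℝ → ℝ → ℝ} (hF : IsResonant F) {τ : ℝ} (hτ : τ ≠ 0)
    {s β : ℝ} (hβ : 0 < β) (hs : 2 * s < β) {g : ℝ → ℝ → ℝ}
    (hg : ∀ M > 0, ∃ D, ∀ t ε, 0 < t → 0 < ε → ε ≤ M * t ^ 3 → g t ε ≤ D * t ^ β) {η : ℝ} (hη : 0 < η)
    (h : ∀ t ε, 0 < t → t < η → 0 < ε → ε < η → F t (ε⁻¹ * τ) * smoothing s t ε ≤ g t ε) :
    False := by
  obtain ⟨c₀, hc₀, c₁, hc₁, c₂, hc₂, hev⟩ := hF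
  have hτ0 : 0 < |τ| := abs_pos.2 hτ
  obtain ⟨k, hk, hsm⟩ := exists_smoothing_ge (m := |τ| / c₂) (M := |τ| / c₁) (by positivity)
    (by positivity) (le_max_left s 0) (le_max_right s 0)
  obtain ⟨D, hD⟩ := hg (|τ| / c₁) (by positivity)
  set α := β - 2 * max s 0 with hα
  have hα0 : 0 < α := by
    rcases max_choice s 0 with h' | h' <;> rw [hα, h'] <;> linarith
  have hlim : Tendsto (fun t : ℝ => D * t ^ α) (𝓝[>] 0) (𝓝 0) := by
    have h1 : Tendsto (fun t : ℝ => t ^ α) (𝓝[>] 0) (𝓝 0) := by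
      have := (Real.continuousAt_rpow_const 0 α (Or.inr hα0.le)).tendsto
      rw [Real.zero_rpow hα0.ne'] at this
      exact this.mono_left nhdsWithin_le_nhds
    simpa using h1.const_mul D
  have hlim3 : Tendsto (fun t : ℝ => |τ| / c₁ * t ^ 3) (𝓝[>] 0) (𝓝 0) := by
    have : Tendsto (fun t : ℝ => |τ| / c₁ * t ^ 3) (𝓝 0) (𝓝 (|τ| / c₁ * 0 ^ 3)) :=
      Continuous.tendsto (by fun_prop) 0
    simp only [ne_eq, OfNat.ofNat_ne_zero, not_false_eq_true, zero_pow, mul_zero] at this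
    exact this.mono_left nhdsWithin_le_nhds
  have hfin : ∀ᶠ t in 𝓝[>] (0 : ℝ), c₀ * k ≤ D * t ^ α := by
    filter_upwards [hev, Ioo_mem_nhdsGT hη, Ioo_mem_nhdsGT one_pos, hlim3.eventually_lt_const hη]
      with t ht htη ht1 ht3
    obtain ⟨T, hT, h1, h2, h3⟩ := ht
    have t0 := htη.1
    have e1 : |τ| / T ≤ |τ| / c₁ * t ^ 3 := by
      rw [div_mul_eq_mul_div, div_le_div_iff₀ hT hc₁]; nlinarith
    have e2 : |τ| / c₂ * t ^ 3 ≤ |τ| / T := by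
      rw [div_mul_eq_mul_div, div_le_div_iff₀ hc₂ hT]; nlinarith
    have hε : 0 < |τ| / T := by positivity
    have e3 : |(|τ| / T)⁻¹ * τ| = T := by
      rw [abs_mul, abs_inv, abs_of_pos hε]; field_simp
    have e4 := h t (|τ| / T) t0 htη.2 hε (e1.trans_lt ht3)
    have e5 := hsm t (|τ| / T) t0 ht1.2.le e2 e1
    have e6 : c₀ * (k * t ^ (2 * max s 0)) ≤ D * t ^ β :=
      calc c₀ * (k * t ^ (2 * max s 0))
          ≤ F t ((|τ| / T)⁻¹ * τ) * smoothing s t (|τ| / T) :=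
            mul_le_mul (h3 _ e3) e5 (by positivity) (hc₀.le.trans (h3 _ e3))
        _ ≤ _ := e4.trans (hD t _ t0 hε e1)
    have e7 : t ^ β = t ^ α * t ^ (2 * max s 0) := by
      rw [← Real.rpow_add t0]; congr 1; rw [hα]; ring
    rw [e7, ← mul_assoc, ← mul_assoc] at e6
    exact le_of_mul_le_mul_right e6 (by positivity)
  have := ge_of_tendsto hlim hfin
  nlinarith [mul_pos hc₀ hk]

/-- Sharpness with respect to time, tested with `ε = t` and `τ = t T ~ t⁻²`. -/
theorem IsResonant.not_time_bound {F : ℝ → ℝ → ℝ} (hF : IsResonant F) {s : ℝ} {C : ℝ → ℝ}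
    (hC : Tendsto (fun τ => C τ / |τ| ^ (1 / 2 : ℝ)) atTop (𝓝 0)) {η : ℝ} (hη : 0 < η)
    (h : ∀ τ t, 0 < t → t < η → F t (t⁻¹ * τ) * smoothing s t t ≤ C τ * t) : False := by
  obtain ⟨c₀, hc₀, c₁, hc₁, c₂, hc₂, hev⟩ := hF
  have hκ : 0 < c₀ * (1 / 2 : ℝ) ^ (s / 2) / √c₂ := by positivity
  obtain ⟨τ₀, hτ₀⟩ := eventually_atTop.1 (hC.eventually_lt_const hκ)
  have hinv : Tendsto (fun t : ℝ => c₁ * (t⁻¹ * t⁻¹)) (𝓝[>] 0) atTop :=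
    (tendsto_inv_nhdsGT_zero.atTop_mul_atTop₀ tendsto_inv_nhdsGT_zero).const_mul_atTop hc₁
  have hIoo : ∀ᶠ t in 𝓝[>] (0 : ℝ), t ∈ Set.Ioo 0 η := Ioo_mem_nhdsGT hη
  obtain ⟨t, ⟨T, hT, h1, h2, h3⟩, htη, ht⟩ :=
    (hev.and (hIoo.and (hinv.eventually_ge_atTop τ₀))).exists
  have t0 := htη.1
  have hge : c₁ * (t⁻¹ * t⁻¹) ≤ t * T := by
    rw [← mul_inv, ← div_eq_mul_inv, div_le_iff₀ (by positivity)]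
    nlinarith
  have e1 := hτ₀ (t * T) (ht.trans hge)
  have hpos : 0 < t * T := by positivity
  rw [abs_of_pos hpos, ← Real.sqrt_eq_rpow, div_lt_div_iff₀ (Real.sqrt_pos.2 hpos)
    (Real.sqrt_pos.2 hc₂)] at e1
  have e2 := h (t * T) t t0 htη.2
  have e3 : t⁻¹ * (t * T) = T := by field_simp
  have e4 : smoothing s t t = (1 / 2 : ℝ) ^ (s / 2) := by
    rw [smoothing_eq t0 t0]; congr 1; field_simp; norm_num
  rw [e3, e4] at e2
  have e5 : c₀ * (1 / 2 : ℝ) ^ (s / 2) ≤ C (t * T) * t :=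
    le_trans (by gcongr; exact h3 T (abs_of_pos hT)) e2
  have e6 : t * √(t * T) ≤ √c₂ := by
    apply Real.le_sqrt_of_sq_le
    rw [mul_pow, Real.sq_sqrt hpos.le]
    nlinarith
  have hCpos : 0 < C (t * T) := by
    have : 0 < C (t * T) * t := lt_of_lt_of_le (by positivity) e5
    exact pos_of_mul_pos_left this t0.le
  have e7 : c₀ * (1 / 2 : ℝ) ^ (s / 2) * √(t * T) ≤ C (t * T) * √c₂ :=
    calc c₀ * (1 / 2 : ℝ) ^ (s / 2) * √(t * T) ≤ C (t * T) * t * √(t * T) := by gcongr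
      _ = C (t * T) * (t * √(t * T)) := by ring
      _ ≤ _ := by gcongr
  linarith

end Resonance

section Resonance

/-- The frequency `√(γ t² + ν t⁴)` is close to `t √γ`, but differs from it by a quantity of exact
order `t³`. -/
theorem sqrt_perturbed {γ ν t : ℝ} (hγ : 0 < γ) (hν : ν ≠ 0) (ht : 0 < t) (hνt : |ν| * t ^ 2 ≤ γ / 4) :
    0 < γ * t ^ 2 + ν * t ^ 4 ∧ γ * t ^ 2 + ν * t ^ 4 ≤ 2 * γ * t ^ 2 ∧
      t * √γ / 2 ≤ √(γ * t ^ 2 + ν * t ^ 4) ∧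
      √(γ * t ^ 2 + ν * t ^ 4) ≠ t * √γ ∧
      3 * |√(γ * t ^ 2 + ν * t ^ 4) - t * √γ| ≤ √(γ * t ^ 2 + ν * t ^ 4) + t * √γ ∧
      |√(γ * t ^ 2 + ν * t ^ 4) - t * √γ| * √γ ≤ |ν| * t ^ 3 ∧
      |ν| * t ^ 3 ≤ 3 * √γ * |√(γ * t ^ 2 + ν * t ^ 4) - t * √γ| := by
  set g := √γ with hg
  have hg0 : 0 < g := Real.sqrt_pos.2 hγ
  have hgg : g ^ 2 = γ := Real.sq_sqrt hγ.le
  have ht2 : 0 < t ^ 2 := by positivity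
  have hν4 : |ν * t ^ 4| ≤ γ / 4 * t ^ 2 := by
    rw [abs_mul, abs_of_pos (by positivity : 0 < t ^ 4)]
    nlinarith
  obtain ⟨h1, h2⟩ := abs_le.1 hν4
  set l := γ * t ^ 2 + ν * t ^ 4 with hl
  have hl0 : 0 < l := by nlinarith
  have hl2 : l ≤ 2 * γ * t ^ 2 := by nlinarith
  set a := √l with ha
  have haa : a ^ 2 = l := Real.sq_sqrt hl0.le
  have ha0 : 0 < a := Real.sqrt_pos.2 hl0
  have hb0 : 0 < t * g := by positivity
  have hlow : t * g / 2 ≤ a := by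
    apply Real.le_sqrt_of_sq_le
    have : (t * g / 2) ^ 2 = γ * t ^ 2 / 4 := by rw [div_pow, mul_pow, hgg]; ring
    rw [this]; nlinarith
  have hup : a ≤ 2 * (t * g) := by
    rw [ha, Real.sqrt_le_left (by positivity)]
    have : (2 * (t * g)) ^ 2 = 4 * γ * t ^ 2 := by rw [mul_pow, mul_pow, hgg]; ring
    rw [this]; nlinarith
  have hdiff : (a - t * g) * (a + t * g) = ν * t ^ 4 := by
    have : (a - t * g) * (a + t * g) = a ^ 2 - g ^ 2 * t ^ 2 := by ring
    rw [this, haa, hgg]; ring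
  have habs : |a - t * g| * (a + t * g) = |ν| * t ^ 4 := by
    rw [← abs_of_pos (by positivity : 0 < a + t * g), ← abs_mul, hdiff, abs_mul,
      abs_of_pos (by positivity : 0 < t ^ 4)]
  refine ⟨hl0, hl2, hlow, ?_, ?_, ?_, ?_⟩
  · intro h
    rw [h, sub_self, zero_mul] at hdiff
    exact mul_ne_zero hν (by positivity) hdiff.symm
  · have h3 : 3 * |a - t * g| * (a + t * g) ≤ (a + t * g) * (a + t * g) := by
      have e1 : 3 * (|ν| * t ^ 4) ≤ γ * t ^ 2 := by nlinarith
      have e2 : γ * t ^ 2 ≤ (a + t * g) * (a + t * g) := by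
        have : γ * t ^ 2 = (t * g) * (t * g) := by rw [← hgg]; ring
        rw [this]; gcongr <;> linarith
      rw [mul_assoc, habs]; linarith
    exact le_of_mul_le_mul_right h3 (by positivity)
  · have h3 : (|a - t * g| * g) * t ≤ (|ν| * t ^ 3) * t := by
      have e1 : |a - t * g| * (t * g) ≤ |a - t * g| * (a + t * g) := by gcongr; linarith
      rw [habs] at e1
      linarith
    exact le_of_mul_le_mul_right h3 ht
  · have h3 : (|ν| * t ^ 3) * t ≤ (3 * g * |a - t * g|) * t := by
      have e1 : |a - t * g| * (a + t * g) ≤ |a - t * g| * (3 * (t * g)) := by gcongr; linarith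
      rw [habs] at e1
      linarith
    exact le_of_mul_le_mul_right h3 ht

theorem abs_sinSqrtDiv_le_inv (τ : ℝ) {y : ℝ} (hy : 0 < y) : |sinSqrtDiv τ y| ≤ (√y)⁻¹ := by
  rw [sinSqrtDiv_of_pos hy, abs_mul, abs_of_pos (inv_pos.2 (Real.sqrt_pos.2 hy))]
  exact mul_le_of_le_one_right (by positivity) (Real.abs_sin_le_one _)

/-- The separating times of the frequencies `√(γ t² + ν t⁴)` and `t √γ` are of exact order `t⁻³`. -/
theorem exists_resonant_time {γ ν t : ℝ} (hγ : 0 < γ) (hν : ν ≠ 0) (ht : 0 < t)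
    (hνt : |ν| * t ^ 2 ≤ γ / 4) :
    ∃ T > 0, √γ / |ν| ≤ T * t ^ 3 ∧ T * t ^ 3 ≤ 18 * √γ / |ν| ∧ ∀ τ, |τ| = T →
      1 ≤ |cosSqrt τ (γ * t ^ 2 + ν * t ^ 4) - cosSqrt τ (t ^ 2 * γ)| ∧
      (2 * √γ * t)⁻¹ ≤ |sinSqrtDiv τ (γ * t ^ 2 + ν * t ^ 4) - sinSqrtDiv τ (t ^ 2 * γ)| := by
  obtain ⟨hl0, -, hlow, hne, h3, hd1, hd2⟩ := sqrt_perturbed hγ hν ht hνt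
  have hg0 : 0 < √γ := Real.sqrt_pos.2 hγ
  have hν0 : 0 < |ν| := abs_pos.2 hν
  have hgg : √γ ^ 2 = γ := Real.sq_sqrt hγ.le
  set g := √γ with hg
  set l := γ * t ^ 2 + ν * t ^ 4 with hl
  obtain ⟨T, hT, h4, h5, h6, h7⟩ := exists_separating_time hne h3
  have hb0 : 0 < t * g := by positivity
  have hb : √(t ^ 2 * γ) = t * g := by
    rw [Real.sqrt_mul (by positivity), Real.sqrt_sq ht.le]
  have hπ := Real.pi_gt_three
  have hπ4 := Real.pi_le_four
  have hcos : ∀ y, cosSqrt T y = Real.cos (T * √y) := fun _ => rfl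
  have key : 1 ≤ |cosSqrt T l - cosSqrt T (t ^ 2 * γ)| ∧
      (2 * g * t)⁻¹ ≤ |sinSqrtDiv T l - sinSqrtDiv T (t ^ 2 * γ)| := by
    refine ⟨by rw [hcos, hcos, hb]; exact h6, ?_⟩
    have e1 : Real.sin (T * √l) - Real.sin (T * (t * g)) = (√l - t * g) * sinSqrtDiv T l +
        t * g * (sinSqrtDiv T l - sinSqrtDiv T (t ^ 2 * γ)) := by
      have e2 := sqrt_mul_sinSqrtDiv T l
      have e3 := sqrt_mul_sinSqrtDiv T (t ^ 2 * γ)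
      rw [hb] at e3
      rw [← e2, ← e3]; ring
    rw [e1] at h7
    have e4 : |√l - t * g| * |sinSqrtDiv T l| ≤ 1 / 2 := by
      have e5 : |√l - t * g| ≤ √l / 2 := by
        have e6 : |√l - t * g| * g ≤ t * g / 4 * g := by
          have : |ν| * t ^ 3 ≤ t * g / 4 * g := by
            calc |ν| * t ^ 3 = |ν| * t ^ 2 * t := by ring
              _ ≤ γ / 4 * t := by gcongr
              _ = _ := by rw [← hgg]; ring
          exact hd1.trans this
        have e7 := le_of_mul_le_mul_right e6 hg0
        linarith
      have e8 := abs_sinSqrtDiv_le_inv T hl0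
      have hs : 0 < √l := Real.sqrt_pos.2 hl0
      calc |√l - t * g| * |sinSqrtDiv T l| ≤ √l / 2 * (√l)⁻¹ := by gcongr
        _ = 1 / 2 := by field_simp
    have e9 := h7.trans (abs_add_le _ _)
    rw [abs_mul, abs_mul (t * g), abs_of_pos hb0] at e9
    rw [inv_le_iff_one_le_mul₀ (by positivity)]
    nlinarith
  refine ⟨T, hT, ?_, ?_, ?_⟩
  · rw [div_le_iff₀ hν0]
    have : g ≤ T * (|√l - t * g| / 2) * g * 2 := by nlinarith
    nlinarith
  · rw [le_div_iff₀ hν0]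
    have e1 : T * (|ν| * t ^ 3) ≤ T * (3 * g * |√l - t * g|) := by gcongr
    have e2 : T * (3 * g * |√l - t * g|) = T * (|√l - t * g| / 2) * (6 * g) := by ring
    have e3 : T * (|√l - t * g| / 2) * (6 * g) ≤ 3 * (6 * g) := by gcongr; linarith
    nlinarith
  · intro τ hτ
    rcases abs_choice τ with h | h
    · rw [← h, hτ]; exact key
    · have hτ' : τ = -T := by rw [← hτ, h, neg_neg]
      have c1 : ∀ y, cosSqrt (-T) y = cosSqrt T y := fun y => by
        rw [cosSqrt, cosSqrt, neg_mul, Real.cos_neg]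
      have c2 : ∀ y, sinSqrtDiv (-T) y = -sinSqrtDiv T y := fun y => by
        rw [sinSqrtDiv, sinSqrtDiv, neg_mul T (√y), Real.sinc_neg]; ring
      rw [hτ', c1, c1, c2, c2, neg_sub_neg, abs_sub_comm (sinSqrtDiv T _)]
      exact key

/-- The errors of the quasimode pairings, along times `T = O(t⁻³)` and with a resolvent defect
`δ = O(t⁵)` of the quasimode: `l ~ g² t²` is its approximate eigenvalue. -/
theorem quasimode_errors_le {t g γ l T c C δ z : ℝ} (ht0 : 0 < t) (ht1 : t ≤ 1) (hγ : 0 < γ)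
    (hg : 0 < g) (hc : 0 ≤ c) (hC : 0 ≤ C) (hz : 0 ≤ z) (hδ : 0 ≤ δ) 
    (hl : 0 < l) (hsli : (√l)⁻¹ ≤ 2 / (g * t)) (hli : l⁻¹ ≤ 2 / (γ * t ^ 2)) (hT : T ≤ c / t ^ 3)
    (hδC : δ ≤ 2 * C * t ^ 5) :
    (4 * (T * (√l)⁻¹) + 12 * 1) * δ ≤ (8 * c / g + 12) * (2 * C) * t ∧
      (4 * (2 * T * l⁻¹) + 12 * T) * δ ≤ (16 * c / γ + 12 * c) * (2 * C) ∧
      T * (2 + t * z) * ((4 * (√l)⁻¹ + 12) * δ) ≤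
        c * (2 + z) * ((8 / g + 12) * (2 * C)) * t := by
  refine ⟨?_, ?_, ?_⟩
  · calc (4 * (T * (√l)⁻¹) + 12 * 1) * δ
        ≤ (4 * (c / t ^ 3 * (2 / (g * t))) + 12 * 1) * (2 * C * t ^ 5) := by gcongr
      _ = (8 * c / g + 12 * t ^ 4) * (2 * C) * t := by field_simp; ring
      _ ≤ (8 * c / g + 12 * 1) * (2 * C) * t := by gcongr; exact pow_le_one₀ ht0.le ht1
      _ = _ := by ring
  · calc (4 * (2 * T * l⁻¹) + 12 * T) * δ
        ≤ (4 * (2 * (c / t ^ 3) * (2 / (γ * t ^ 2))) + 12 * (c / t ^ 3)) * (2 * C * t ^ 5) := by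
          gcongr
      _ = (16 * c / γ + 12 * c * t ^ 2) * (2 * C) := by field_simp; ring
      _ ≤ (16 * c / γ + 12 * c * 1) * (2 * C) := by gcongr; exact pow_le_one₀ ht0.le ht1
      _ = _ := by ring
  · calc T * (2 + t * z) * ((4 * (√l)⁻¹ + 12) * δ)
        ≤ c / t ^ 3 * (2 + 1 * z) * ((4 * (2 / (g * t)) + 12) * (2 * C * t ^ 5)) := by gcongr
      _ = c * (2 + z) * ((8 / g + 12 * t) * (2 * C)) * t := by field_simp; ring
      _ ≤ c * (2 + z) * ((8 / g + 12 * 1) * (2 * C)) * t := by gcongr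
      _ = _ := by ring

/-- The main term `a ~ t⁻¹` survives the errors `b = O(t)` and `c = O(1)` after multiplication by
`q ~ t`. -/
theorem le_mul_sub_sub {t g q a b c D B : ℝ} (ht0 : 0 < t) (ht1 : t ≤ 1) (hg : 0 < g) (hD : 0 ≤ D)
    (hq : t * g / 3 ≤ q) (ha : (4 * g * t)⁻¹ ≤ a) (hb : b ≤ D * t) (hc : c ≤ B)
    (hpos : 0 ≤ 1 / 12 - g / 3 * (D + B) * t) :
    1 / 12 - g / 3 * (D + B) * t ≤ q * (a - b - c) := by
  have h1 : D * t ≤ D := mul_le_of_le_one_right hD ht1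
  have h2 : (4 * g * t)⁻¹ - (D + B) ≤ a - b - c := by linarith
  have h3 : t * g / 3 * ((4 * g * t)⁻¹ - (D + B)) = 1 / 12 - g / 3 * (D + B) * t := by
    field_simp
    ring
  have h0 : 0 < t * g / 3 := by positivity
  rw [← h3] at hpos ⊢
  exact mul_le_mul hq h2 (nonneg_of_mul_nonneg_right hpos h0) (h0.le.trans hq)

theorem perturbed_bounds {γ ν t : ℝ} (hγ : 0 < γ) (hν : ν ≠ 0) (ht0 : 0 < t) (ht1 : t ≤ 1)
    (hνt : |ν| * t ^ 2 ≤ γ / 4) (hγt : 4 * γ * t ≤ 1) :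
    γ * t ^ 2 + ν * t ^ 4 ≤ 1 / 2 ∧ (√(γ * t ^ 2 + ν * t ^ 4))⁻¹ ≤ 2 / (√γ * t) ∧
      (γ * t ^ 2 + ν * t ^ 4)⁻¹ ≤ 2 / (γ * t ^ 2) ∧
      t * √γ / 3 ≤ √(γ * t ^ 2 + ν * t ^ 4) / (1 + (γ * t ^ 2 + ν * t ^ 4)) := by
  obtain ⟨hl0, hl2, hlow, -⟩ := sqrt_perturbed hγ hν ht0 hνt
  have hg0 : 0 < √γ := Real.sqrt_pos.2 hγ
  have ht2 : t ^ 2 ≤ t := pow_le_of_le_one ht0.le ht1 two_ne_zero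
  have h1 := (abs_le.1 (show |ν * t ^ 4| ≤ γ / 4 * t ^ 2 by
    rw [abs_mul, abs_of_pos (by positivity : 0 < t ^ 4)]
    calc |ν| * t ^ 4 = |ν| * t ^ 2 * t ^ 2 := by ring
      _ ≤ γ / 4 * t ^ 2 := by gcongr)).1
  have h2 : 0 < γ * t ^ 2 := by positivity
  have h3 : γ * t ^ 2 / 2 ≤ γ * t ^ 2 + ν * t ^ 4 := by linarith
  generalize γ * t ^ 2 + ν * t ^ 4 = l at *
  have hl : l ≤ 1 / 2 := by
    have : 2 * γ * t ^ 2 ≤ 2 * γ * t := by gcongr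
    linarith
  have hsl : 0 < √l := Real.sqrt_pos.2 hl0
  refine ⟨hl, ?_, ?_, ?_⟩
  · rw [inv_le_comm₀ hsl (by positivity), inv_div]
    linarith
  · rw [inv_le_comm₀ hl0 (by positivity), inv_div]
    linarith
  · rw [div_le_div_iff₀ (by norm_num) (by positivity)]
    have h3 : t * √γ * (1 + l) ≤ t * √γ * (3 / 2) := by gcongr; linarith
    linarith

end Resonance

namespace Pencil

variable {H K : Type*} [NormedAddCommGroup H] [InnerProductSpace ℂ H] [CompleteSpace H]
  [NormedAddCommGroup K] [InnerProductSpace ℂ K] [CompleteSpace K] {p : Pencil H K}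

/-- `‖J₁‖`, `t ‖J₂‖` and `‖A^(1/2) Σ‖` do not become small along times of order `t⁻³`. -/
theorem Admissible.isResonant (hp : p.Admissible) (hN₀ : p.N₀ = 0)
    (hN : ∃ γ ∈ p.germEigenvalues, p.germN γ ≠ 0) :
    IsResonant (fun t τ => ‖p.J₁ t τ‖) ∧ IsResonant (fun t τ => t * ‖p.J₂ t τ‖) ∧
      IsResonant (fun t τ => ‖p.sqrtASig t τ‖) := by
  have := hp.nontrivial
  obtain ⟨γ, hγe, hγN⟩ := hN
  have hγ := hp.germEigenvalue_pos hγe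
  obtain ⟨ν, ω₀, hν, hω₀, hω₀m, hω₀ν⟩ := hp.exists_eigenvector_germN hγN
  -- normalization of the eigenvector
  obtain ⟨ω, hω1, hωm, hων⟩ : ∃ ω : H, ‖ω‖ = 1 ∧ ω ∈ p.germEigenspace γ ∧
      p.germN γ ω = (ν : ℂ) • ω := by
    refine ⟨((‖ω₀‖⁻¹ : ℝ) : ℂ) • ω₀, ?_, Submodule.smul_mem _ _ hω₀m, ?_⟩
    · rw [norm_smul, Complex.norm_real, norm_inv, norm_norm,
        inv_mul_cancel₀ (norm_ne_zero_iff.2 hω₀)]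
    · rw [map_smul, hω₀ν, smul_comm]
  obtain ⟨φ, C, hC, hφ⟩ := hp.exists_quasimode hN₀ hγe hωm hων
  have hk := (mem_germEigenspace.1 hωm).1
  have hg0 : 0 < √γ := Real.sqrt_pos.2 hγ
  have hgg : √γ * √γ = γ := Real.mul_self_sqrt hγ.le
  set g := √γ with hg
  have hν0 : 0 < |ν| := abs_pos.2 hν
  set c₂ := 18 * g / |ν| with hc₂
  have hc₂0 : 0 < c₂ := by positivity
  set Ca := (8 * c₂ / g + 12) * (2 * C) with hCa
  set Cb := (16 * c₂ / γ + 12 * c₂) * (2 * C) with hCb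
  set z := ‖p.Z ω‖ with hz
  set Cc := c₂ * (2 + z) * ((8 / g + 12) * (2 * C)) with hCc
  have hCa0 : 0 ≤ Ca := by positivity
  have hCb0 : 0 ≤ Cb := by positivity
  have hCc0 : 0 ≤ Cc := by positivity
  have small : ∀ D κ : ℝ, 0 < κ → ∀ᶠ t in 𝓝[>] (0 : ℝ), D * t ≤ κ := by
    intro D κ hκ
    have h1 : Tendsto (fun t : ℝ => D * t) (𝓝[>] 0) (𝓝 0) := by
      have : Tendsto (fun t : ℝ => D * t) (𝓝 0) (𝓝 (D * 0)) := Continuous.tendsto (by fun_prop) 0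
      rw [mul_zero] at this
      exact this.mono_left nhdsWithin_le_nhds
    exact h1.eventually_le_const hκ
  have core : ∀ᶠ t in 𝓝[>] (0 : ℝ), 0 < t ∧ ∃ T > 0, g / |ν| ≤ T * t ^ 3 ∧ T * t ^ 3 ≤ c₂ ∧
      ∀ τ, |τ| = T → 1 / 8 ≤ ‖p.J₁ t τ‖ ∧ 1 / (16 * g) ≤ t * ‖p.J₂ t τ‖ ∧
        1 / 48 ≤ ‖p.sqrtASig t τ‖ := by
    filter_upwards [self_mem_nhdsWithin, small 1 1 one_pos, small |ν| (γ / 4) (by positivity),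
      small (4 * γ) 1 one_pos, small C (1 / 2) (by norm_num), small Ca (1 / 4) (by norm_num),
      small Cb (1 / (8 * g)) (by positivity),
      small (g / 3 * (z * C / g + Cb) + Cc) (1 / 24) (by norm_num)]
      with t ht0 ht1 htν htγ htC hta htb htc
    rw [Set.mem_Ioi] at ht0
    rw [one_mul] at ht1
    have hνt : |ν| * t ^ 2 ≤ γ / 4 :=
      le_trans (mul_le_mul_of_nonneg_left (pow_le_of_le_one ht0.le ht1 two_ne_zero) hν0.le) htν
    obtain ⟨hl0, -⟩ := sqrt_perturbed hγ hν ht0 hνt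
    obtain ⟨hl, hsli, hli, hq⟩ := perturbed_bounds hγ hν ht0 ht1 hνt htγ
    obtain ⟨T, hT, hT1, hT2, hτ⟩ := exists_resonant_time hγ hν ht0 hνt
    refine ⟨ht0, T, hT, hT1, hT2, fun τ hτT => ?_⟩
    obtain ⟨hcos, hsin⟩ := hτ τ hτT
    obtain ⟨R, hRF, hR⟩ := p.exists_resolvent t
    obtain ⟨hφω, Φ, hΦ, hres⟩ := hφ t ht0 ht1
    set l := γ * t ^ 2 + ν * t ^ 4
    set w := φ t with hw
    set δ := ‖R w - ((1 + l)⁻¹ : ℝ) • w‖ with hδ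
    have hδ0 : 0 ≤ δ := norm_nonneg _
    have hδC : δ ≤ 2 * C * t ^ 5 := by
      have := hRF.norm_quasimode_le hΦ hl0.le (by positivity) hres
      linarith
    -- the quasimode is close to `ω`
    have hwn : ‖w‖ ≤ 2 := by
      have h1 := norm_add_le ω (w - ω)
      rw [add_sub_cancel, hω1] at h1
      linarith
    have hωw : 1 / 2 ≤ ‖⟪ω, w⟫_ℂ‖ := by
      have h1 : ⟪ω, ω⟫_ℂ = ⟪ω, w⟫_ℂ - ⟪ω, w - ω⟫_ℂ := by rw [inner_sub_right]; ring
      have h2 : ‖⟪ω, ω⟫_ℂ‖ = 1 := by rw [inner_self_eq_norm_sq_to_K, hω1]; simp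
      have h3 := norm_sub_le ⟪ω, w⟫_ℂ ⟪ω, w - ω⟫_ℂ
      have h4 := norm_inner_le_norm (𝕜 := ℂ) ω (w - ω)
      rw [← h1, h2] at h3
      rw [hω1, one_mul] at h4
      linarith
    have hZw : ‖⟪p.Z ω, w⟫_ℂ‖ ≤ z * (C * t) := by
      have h1 : ⟪p.Z ω, w⟫_ℂ = ⟪p.Z ω, w - ω⟫_ℂ := by
        rw [inner_sub_right, hp.inner_Z_left hk, sub_zero]
      rw [h1]
      exact (norm_inner_le_norm _ _).trans (by gcongr)
    have hTb : T ≤ c₂ / t ^ 3 := by rw [le_div_iff₀ (by positivity)]; exact hT2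
    have hz0 : 0 ≤ z := norm_nonneg _
    obtain ⟨errA, errB, errC⟩ :=
      quasimode_errors_le ht0 ht1 hγ hg0 hc₂0.le hC hz0 hδ0 hl0 hsli hli hTb hδC
    have hJ₁ := norm_J₁_ge ht0 hγ hl0 hl hR hωm w τ
    have hJ₂ := norm_J₂_ge ht0 hγ hl0 hl hR hωm w τ
    have hJ₃ := hp.norm_sqrtASig_ge ht0 hγ hl0 hl hRF hR hωm w τ
    rw [hω1, hτT] at hJ₁ hJ₂ hJ₃
    rw [one_mul (_ * δ)] at hJ₁ hJ₂ hJ₃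
    rw [mul_one 2, ← hz] at hJ₃
    have hsinω : (4 * g * t)⁻¹ ≤
        |sinSqrtDiv τ l - sinSqrtDiv τ (t ^ 2 * γ)| * ‖⟪ω, w⟫_ℂ‖ := by
      calc (4 * g * t)⁻¹ = (2 * g * t)⁻¹ * (1 / 2) := by field_simp; norm_num
        _ ≤ _ := by gcongr
    refine ⟨?_, ?_, ?_⟩
    · have h1 : 1 * (1 / 2) ≤ |cosSqrt τ l - cosSqrt τ (t ^ 2 * γ)| * ‖⟪ω, w⟫_ℂ‖ := by gcongr
      have h2 : ‖p.J₁ t τ‖ * 1 * ‖w‖ ≤ ‖p.J₁ t τ‖ * 1 * 2 := by gcongr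
      linarith
    · have h2 : ‖p.J₂ t τ‖ * 1 * ‖w‖ ≤ ‖p.J₂ t τ‖ * 1 * 2 := by gcongr
      have h3 : (4 * g * t)⁻¹ ≤ 2 * ‖p.J₂ t τ‖ + Cb := by linarith
      have h4 : t * (4 * g * t)⁻¹ ≤ t * (2 * ‖p.J₂ t τ‖ + Cb) := by gcongr
      have h5 : t * (4 * g * t)⁻¹ = 2 * (1 / (8 * g)) := by field_simp; norm_num
      have h6 : 1 / (8 * g) = 2 * (1 / (16 * g)) := by field_simp; norm_num
      rw [h5] at h4
      linarith
    · have hσ : |sinSqrtDiv τ (t ^ 2 * γ)| ≤ (t * g)⁻¹ := by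
        have := abs_sinSqrtDiv_le_inv τ (by positivity : 0 < t ^ 2 * γ)
        rwa [Real.sqrt_mul (by positivity), Real.sqrt_sq ht0.le] at this
      have h1 : |sinSqrtDiv τ (t ^ 2 * γ)| * t * ‖⟪p.Z ω, w⟫_ℂ‖ ≤ z * C / g * t := by
        calc |sinSqrtDiv τ (t ^ 2 * γ)| * t * ‖⟪p.Z ω, w⟫_ℂ‖
            ≤ (t * g)⁻¹ * t * (z * (C * t)) := by gcongr
          _ = _ := by field_simp
      have h2 : ‖p.sqrtASig t τ‖ * 1 * ‖w‖ ≤ ‖p.sqrtASig t τ‖ * 1 * 2 := by gcongr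
      have h3 := le_mul_sub_sub ht0 ht1 hg0 (by positivity) hq hsinω h1 errB (by
        have := mul_nonneg hCc0 ht0.le
        linarith)
      linarith
  refine ⟨⟨1 / 8, by norm_num, g / |ν|, by positivity, c₂, hc₂0, ?_⟩,
    ⟨1 / (16 * g), by positivity, g / |ν|, by positivity, c₂, hc₂0, ?_⟩,
    ⟨1 / 48, by norm_num, g / |ν|, by positivity, c₂, hc₂0, ?_⟩⟩
  · filter_upwards [core] with t ⟨_, T, hT, h1, h2, h3⟩
    exact ⟨T, hT, h1, h2, fun τ hτ => (h3 τ hτ).1⟩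
  · filter_upwards [core] with t ⟨_, T, hT, h1, h2, h3⟩
    exact ⟨T, hT, h1, h2, fun τ hτ => (h3 τ hτ).2.1⟩
  · filter_upwards [core] with t ⟨_, T, hT, h1, h2, h3⟩
    exact ⟨T, hT, h1, h2, fun τ hτ => (h3 τ hτ).2.2⟩

end Pencil

section Resonance

/-- The case of the right-hand side `C ε ~ t³`. -/
theorem IsResonant.not_smoothing_bound_mul {F : ℝ → ℝ → ℝ} (hF : IsResonant F) {τ : ℝ} (hτ : τ ≠ 0)
    {s : ℝ} (hs : s < 3 / 2) {C η : ℝ} (hC : 0 < C) (hη : 0 < η)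
    (h : ∀ t ε, 0 < |t| → |t| < η → 0 < ε → ε < η → F t (ε⁻¹ * τ) * smoothing s t ε ≤ C * ε) :
    False := by
  refine hF.not_smoothing_bound hτ (s := s) (β := 3) (by norm_num) (by linarith) (g := fun _ ε => C * ε)
    (fun M _ => ⟨C * M, fun t ε _ _ hε => ?_⟩) hη fun t ε ht htη hε hεη =>
      h t ε (abs_pos.2 ht.ne') (by rwa [abs_of_pos ht]) hε hεη
  have h3 : t ^ (3 : ℝ) = t ^ 3 := by exact_mod_cast Real.rpow_natCast t 3
  rw [h3, mul_assoc]
  gcongr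

/-- The case of a constant right-hand side, for a quantity resonant after multiplication by `t`. -/
theorem IsResonant.not_smoothing_bound_of_mul {F : ℝ → ℝ → ℝ}
    (hF : IsResonant fun t τ => t * F t τ) {τ : ℝ} (hτ : τ ≠ 0)
    {s : ℝ} (hs : s < 1 / 2) {C η : ℝ} (hη : 0 < η)
    (h : ∀ t ε, 0 < |t| → |t| < η → 0 < ε → ε < η → F t (ε⁻¹ * τ) * smoothing s t ε ≤ C) :
    False := by
  refine hF.not_smoothing_bound hτ (s := s) (β := 1) one_pos (by linarith) (g := fun t _ => C * t)
    (fun M _ => ⟨C, fun t ε _ _ _ => by rw [Real.rpow_one]⟩) hη fun t ε ht htη hε hεη => ?_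
  have := mul_le_mul_of_nonneg_left
    (h t ε (abs_pos.2 ht.ne') (by rwa [abs_of_pos ht]) hε hεη) ht.le
  linarith

end Resonance

end AbstractScheme

end

theorem theorem4p3 {H K : Type*}
    [NormedAddCommGroup H] [InnerProductSpace ℂ H] [CompleteSpace H]
    [TopologicalSpace.SeparableSpace H]
    [NormedAddCommGroup K] [InnerProductSpace ℂ K] [CompleteSpace K]
    [TopologicalSpace.SeparableSpace K]
    (p : AbstractScheme.Pencil H K) (hp : p.Admissible)
    (hN₀ : p.N₀ = 0) (hN : ∃ γ ∈ p.germEigenvalues, p.germN γ ≠ 0) :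
    -- sharpness with respect to the smoothing factor
    (∀ τ : ℝ, τ ≠ 0 → ∀ s : ℝ, s < 3 / 2 →
      ¬ ∃ C > 0, ∃ η > 0, ∀ t ε : ℝ, 0 < |t| → |t| < η → 0 < ε → ε < η →
        ‖p.J₁ t (ε⁻¹ * τ)‖ * AbstractScheme.smoothing s t ε ≤ C * ε) ∧
    (∀ τ : ℝ, τ ≠ 0 → ∀ r : ℝ, r < 1 / 2 →
      ¬ ∃ C > 0, ∃ η > 0, ∀ t ε : ℝ, 0 < |t| → |t| < η → 0 < ε → ε < η →
        ‖p.J₂ t (ε⁻¹ * τ)‖ * AbstractScheme.smoothing r t ε ≤ C) ∧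
    (∀ τ : ℝ, τ ≠ 0 → ∀ s : ℝ, s < 3 / 2 →
      ¬ ∃ C > 0, ∃ η > 0, ∀ t ε : ℝ, 0 < |t| → |t| < η → 0 < ε → ε < η →
        ‖p.sqrtASig t (ε⁻¹ * τ)‖ * AbstractScheme.smoothing s t ε ≤ C * ε) ∧
    -- sharpness with respect to time
    (∀ s : ℝ, 3 / 2 ≤ s →
      ¬ ∃ C : ℝ → ℝ, (∀ τ, 0 < C τ) ∧
        Filter.Tendsto (fun τ => C τ / |τ| ^ (1 / 2 : ℝ)) Filter.atTop (nhds 0) ∧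
        ∃ η > 0, ∀ τ t ε : ℝ, 0 < |t| → |t| < η → 0 < ε → ε < η →
          ‖p.J₁ t (ε⁻¹ * τ)‖ * AbstractScheme.smoothing s t ε ≤ C τ * ε) ∧
    (∀ r : ℝ, 1 / 2 ≤ r →
      ¬ ∃ C : ℝ → ℝ, (∀ τ, 0 < C τ) ∧
        Filter.Tendsto (fun τ => C τ / |τ| ^ (1 / 2 : ℝ)) Filter.atTop (nhds 0) ∧
        ∃ η > 0, ∀ τ t ε : ℝ, 0 < |t| → |t| < η → 0 < ε → ε < η →
          ‖p.J₂ t (ε⁻¹ * τ)‖ * AbstractScheme.smoothing r t ε ≤ C τ) ∧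
    (∀ s : ℝ, 3 / 2 ≤ s →
      ¬ ∃ C : ℝ → ℝ, (∀ τ, 0 < C τ) ∧
        Filter.Tendsto (fun τ => C τ / |τ| ^ (1 / 2 : ℝ)) Filter.atTop (nhds 0) ∧
        ∃ η > 0, ∀ τ t ε : ℝ, 0 < |t| → |t| < η → 0 < ε → ε < η →
          ‖p.sqrtASig t (ε⁻¹ * τ)‖ * AbstractScheme.smoothing s t ε ≤ C τ * ε) := by
  obtain ⟨h₁, h₂, h₃⟩ := hp.isResonant hN₀ hN
  exact ⟨fun τ hτ s hs ⟨C, hC, η, hη, h⟩ => h₁.not_smoothing_bound_mul hτ hs hC hη h,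
    fun τ hτ r hr ⟨C, hC, η, hη, h⟩ => h₂.not_smoothing_bound_of_mul hτ hr hη h,
    fun τ hτ s hs ⟨C, hC, η, hη, h⟩ => h₃.not_smoothing_bound_mul hτ hs hC hη h,
    fun s _ ⟨C, _, hC, η, hη, h⟩ => h₁.not_time_bound hC hη fun τ t ht htη =>
      h τ t t (abs_pos.2 ht.ne') (by rwa [abs_of_pos ht]) ht htη,
    fun r _ ⟨C, _, hC, η, hη, h⟩ => h₂.not_time_bound (s := r) hC hη fun τ t ht htη => by
      have := mul_le_mul_of_nonneg_left
        (h τ t t (abs_pos.2 ht.ne') (by rwa [abs_of_pos ht]) ht htη) ht.le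
      linarith,
    fun s _ ⟨C, _, hC, η, hη, h⟩ => h₃.not_time_bound hC hη fun τ t ht htη =>
      h τ t t (abs_pos.2 ht.ne') (by rwa [abs_of_pos ht]) ht htη⟩
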